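/- **Setting.** Let $\mathcal A=\mathbb Z[v_i,w_i : i\in\mathbb Z]$ with shift $\Lambda v_i=v_{i+1}$, $\Lambda w_i=w_{i+1}$, and $L=\Lambda+v_0+w_0\Lambda^{-1}$. For a difference operator $P=\sum_m P_m\Lambda^m$ write $P_+=\sum_{m\ge 0}P_m\Lambda^m$, $P_-=P-P_+$, $\mathrm{Coef}(P,m)=P_m$. For $k\ge 0$ let $D_k$ be the derivation of $\mathcal A$ commuting with $\Lambda$ such that $D_k(v_0)=\mathrm{Coef}([(L^{k+1})_+,L],0)$ and $D_k(w_0)=\mathrm{Coef}([(L^{k+1})_+,L],-1)$. The canonical tau-structure is the unique family $\Omega_{p,q},S_p\in\mathcal A$ ($p,q\ge 0$), vanishing when all $v_i=w_i=0$, with $$\Omega_{p,q}=\Omega_{q,p},\quad D_r\Omega_{p,q}=D_q\Omega_{p,r},\quad (\Lambda-1)\Omega_{p,q}=D_qS_p,\quad w_0(1-\Lambda^{-1})S_p=D_p(w_0)\qquad(p,q,r\ge 0).$$ For $m\ge 3$ put $\Omega_{p_1,\dots,p_m}=D_{p_1}\cdots D_{p_{m-2}}\Omega_{p_{m-1},p_m}$.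 Let $K$ be a commutative $\mathbb Q$-algebra, $n\in\mathbb Z$ and $\mathbf t=(t_0,t_1,\dots)$. Let $v(n,\mathbf t),w(n,\mathbf t)\in K[[\mathbf t]]$ be a solution of the Toda lattice hierarchy $\partial v(n)/\partial t_k=D_k(v_0)(n)$, $\partial w(n)/\partial t_k=D_k(w_0)(n)$, $k\ge 0$, where for $f\in\mathcal A$ one writes $f(n,\mathbf t)$ for the image of $f$ under $v_i\mapsto v(n+i,\mathbf t)$, $w_i\mapsto w(n+i,\mathbf t)$. Let $e^{\sigma(n,\mathbf t)}$ be invertible elements of $K[[\mathbf t]]$ with $w(n,\mathbf t)=e^{\sigma(n-1,\mathbf t)-\sigma(n,\mathbf t)}$ and $\partial\sigma(n,\mathbf t)/\partial t_p=-S_p(n,\mathbf t)$ for all $p\ge 0$ (that is, $\partial_{t_p}e^{\sigma}=-S_p e^{\sigma}$). Now let $L=\Lambda+v(n,\mathbf t)+w(n,\mathbf t)\Lambda^{-1}$. A wave function of type A is $\psi_A=\phi_A\,\lambda^n e^{\sum_{k\ge 0} t_k\lambda^{k+1}}$ and one of type B is $\psi_B=\phi_B\,e^{-\sigma(n,\mathbf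 t)}\lambda^{-n}e^{-\sum_{k\ge 0} t_k\lambda^{k+1}}$, with $\phi_A(\lambda,n,\mathbf t),\phi_B(\lambda,n,\mathbf t)\in 1+\lambda^{-1}K[[\mathbf t]][[\lambda^{-1}]]$, such that for all $k\ge 0$ $$L\psi_A=\lambda\psi_A,\quad \frac{\partial\psi_A}{\partial t_k}=(L^{k+1})_+\psi_A,\qquad L\psi_B=\lambda\psi_B,\quad \frac{\partial\psi_B}{\partial t_k}=-(L^{k+1})_-\psi_B .$$ They form a pair if $e^{\sigma(n-1,\mathbf t)}\,d(\lambda,n,\mathbf t)=\lambda$ for all $n$, where $d(\lambda,n,\mathbf t)=\psi_A(\lambda,n,\mathbf t)\psi_B(\lambda,n-1,\mathbf t)-\psi_B(\lambda,n,\mathbf t)\psi_A(\lambda,n-1,\mathbf t)$. Put $$D(\lambda,\mu,n,\mathbf t)=\frac{\psi_A(\lambda,n,\mathbf t)\psi_B(\mu,n-1,\mathbf t)-\psi_A(\lambda,n-1,\mathbf t)\psi_B(\mu,n,\mathbf t)}{\lambda-\mu}.$$ **Theorem.** Let $\psi_A,\psi_B$ be a pair of wave functions associated to $(v,w)$. Then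 for every integer $k\ge 2$ and every $n$, $$\sum_{i_1,\dots,i_k\ge 0}\frac{\Omega_{i_1,\dots,i_k}(n,\mathbf t)}{\lambda_1^{i_1+2}\cdots\lambda_k^{i_k+2}}=(-1)^{k-1}\frac{e^{k\sigma(n-1,\mathbf t)}}{\prod_{j=1}^k\lambda_j}\sum_{\pi\in\mathcal S_k/C_k}\ \prod_{j=1}^kD(\lambda_{\pi(j)},\lambda_{\pi(j+1)},n,\mathbf t)-\frac{\delta_{k,2}}{(\lambda_1-\lambda_2)^2},$$ where $C_k$ is the group of cyclic rotations and $\pi(k+1)=\pi(1)$. The meaning is: for every permutation $(j_1,\dots,j_k)$ of $(1,\dots,k)$, the expansion of the right-hand side in the region $|\lambda_{j_1}|>\cdots>|\lambda_{j_k}|\gg 0$ is the formal series on the left-hand side. -/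

import Mathlib

namespace Toda

/-! ### Difference operators over a ring with a shift -/

/-- A difference operator `∑ m, P m • Λ^m` (finite sum) over a ring `R`. -/
abbrev DiffOp (R : Type*) [CommRing R] := ℤ →₀ R

namespace DiffOp

variable {R : Type*} [CommRing R]

/-- Composition of difference operators: `(a Λ^i) ∘ (b Λ^j) = a Λ^i(b) Λ^(i+j)`. -/
noncomputable def comp (Λ : RingAut R) (P Q : DiffOp R) : DiffOp R :=
  P.sum fun i a => Q.sum fun j b => Finsupp.single (i + j) (a * (Λ ^ i) b)

/-- The powers `P^k` of a difference operator. -/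
noncomputable def pow (Λ : RingAut R) (P : DiffOp R) : ℕ → DiffOp R
  | 0 => Finsupp.single 0 1
  | k + 1 => comp Λ P (pow Λ P k)

/-- The part `P_+ = ∑_{m ≥ 0} P m Λ^m`. -/
noncomputable def plus (P : DiffOp R) : DiffOp R := P.filter fun m => 0 ≤ m

/-- The part `P_- = ∑_{m < 0} P m Λ^m`. -/
noncomputable def minus (P : DiffOp R) : DiffOp R := P.filter fun m => m < 0

/-- The Toda Lax operator `L = Λ + v + w Λ⁻¹`. -/
noncomputable def lax (v w : R) : DiffOp R :=
  Finsupp.single 1 1 + Finsupp.single 0 v + Finsupp.single (-1) w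

end DiffOp

/-! ### The abstract Toda lattice hierarchy -/

/-- The polynomial ring `𝒜 = ℤ[v_i, w_i : i ∈ ℤ]`; `Sum.inl i` indexes `v_i`, `Sum.inr i`
indexes `w_i`. -/
abbrev Poly := MvPolynomial (ℤ ⊕ ℤ) ℤ

/-- The generator `v_i`. -/
noncomputable def vVar (i : ℤ) : Poly := MvPolynomial.X (Sum.inl i)

/-- The generator `w_i`. -/
noncomputable def wVar (i : ℤ) : Poly := MvPolynomial.X (Sum.inr i)

/-- The shift `Λ` of `𝒜`: `Λ v_i = v_{i+1}`, `Λ w_i = w_{i+1}`. -/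
noncomputable def shift : RingAut Poly :=
  (MvPolynomial.renameEquiv ℤ
    (Equiv.sumCongr (Equiv.addRight (1 : ℤ)) (Equiv.addRight (1 : ℤ)))).toRingEquiv

/-- The operator `A_k = (L^{k+1})_+` over `𝒜`. -/
noncomputable def opA (k : ℕ) : DiffOp Poly :=
  (DiffOp.pow shift (DiffOp.lax (vVar 0) (wVar 0)) (k + 1)).plus

/-- The commutator `[A_k, L]`. -/
noncomputable def laxBracket (k : ℕ) : DiffOp Poly :=
  DiffOp.comp shift (opA k) (DiffOp.lax (vVar 0) (wVar 0)) -
    DiffOp.comp shift (DiffOp.lax (vVar 0) (wVar 0)) (opA k)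

/-- The Toda lattice derivation `D_k`: the derivation of `𝒜` commuting with `Λ` such that
`D_k v_0 = Coef([A_k, L], 0)` and `D_k w_0 = Coef([A_k, L], -1)`. -/
noncomputable def todaD (k : ℕ) : Derivation ℤ Poly Poly :=
  MvPolynomial.mkDerivation ℤ
    (Sum.elim (fun i => (shift ^ i) (laxBracket k 0)) (fun i => (shift ^ i) (laxBracket k (-1))))

/-- A family of polynomials `(Ω_{p,q}, S_p)` in `𝒜`. -/
structure TauData where
  Ω : ℕ → ℕ → Poly
  S : ℕ → Poly

/-- The family `(Ω_{p,q}, S_p)` is a tau-structure of the Toda lattice derivations. -/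
structure TauData.IsTauStructure (T : TauData) : Prop where
  symm : ∀ p q, T.Ω p q = T.Ω q p
  deriv_Ω : ∀ p q r, todaD r (T.Ω p q) = todaD q (T.Ω p r)
  shift_Ω : ∀ p q, shift (T.Ω p q) - T.Ω p q = todaD q (T.S p)
  shift_S : ∀ p, wVar 0 * (T.S p - shift⁻¹ (T.S p)) = todaD p (wVar 0)

/-- A tau-structure is canonical if all `Ω_{p,q}` and `S_p` vanish at `v_i = w_i = 0`. -/
structure TauData.IsCanonical (T : TauData) : Prop extends T.IsTauStructure where
  Ω_zero : ∀ p q, MvPolynomial.constantCoeff (T.Ω p q) = 0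
  S_zero : ∀ p, MvPolynomial.constantCoeff (T.S p) = 0

instance : Nonempty TauData := ⟨⟨fun _ _ => 0, fun _ => 0⟩⟩

/-- The canonical tau-structure of the Toda lattice (there is exactly one). -/
noncomputable def canonicalTau : TauData := Classical.epsilon TauData.IsCanonical

/-- `Ω_{p_1,…,p_m} = D_{p_1} ⋯ D_{p_{m-2}} Ω_{p_{m-1},p_m}` for `m ≥ 2`
(lists of length less than two are not used and get the value `0`). -/
noncomputable def corrPoly : List ℕ → Poly
  | [] => 0
  | [_] => 0
  | [p, q] => canonicalTau.Ω p q
  | p :: q :: r :: l => todaD p (corrPoly (q :: r :: l))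

/-! ### Solutions

Functions of `n` and `𝐭 = (t_0, t_1, …)` are families, indexed by `n : ℤ`, of formal power series
in the `t_k` over a commutative ring `K`. -/

/-- Formal power series `K[[𝐭]]` in the infinitely many times `t_0, t_1, …`. -/
abbrev TimeSeries (K : Type*) := MvPowerSeries ℕ K

variable {K : Type*} [CommRing K]

/-- The image `f(n, 𝐭)` of `f ∈ 𝒜` under `v_i ↦ v(n+i, 𝐭)`, `w_i ↦ w(n+i, 𝐭)`. -/
noncomputable def evalAt (v w : ℤ → TimeSeries K) (n : ℤ) : Poly →+* TimeSeries K :=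
  MvPolynomial.eval₂Hom (Int.castRingHom (TimeSeries K))
    (Sum.elim (fun i => v (n + i)) (fun i => w (n + i)))

/-- `(v, w)` solves the Toda lattice hierarchy. -/
def IsSolution (v w : ℤ → TimeSeries K) : Prop :=
  ∀ (k : ℕ) (n : ℤ),
    MvPowerSeries.pderiv K k (v n) = evalAt v w n (todaD k (vVar 0)) ∧
    MvPowerSeries.pderiv K k (w n) = evalAt v w n (todaD k (wVar 0))

/-- `E n` is `e^{σ(n, 𝐭)}`, where `w(n, 𝐭) = e^{σ(n-1, 𝐭) - σ(n, 𝐭)}` and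
`∂σ(n, 𝐭)/∂t_p = -S_p(n, 𝐭)`. -/
def IsExpSigma (v w : ℤ → TimeSeries K) (E : ℤ → (TimeSeries K)ˣ) : Prop :=
  (∀ n, w n * (E n : TimeSeries K) = (E (n - 1) : TimeSeries K)) ∧
  ∀ (p : ℕ) (n : ℤ), MvPowerSeries.pderiv K p (E n : TimeSeries K) =
    -(evalAt v w n (canonicalTau.S p)) * (E n : TimeSeries K)

/-! ### Wave functions

The variable of a Laurent series is `λ⁻¹`. The ring `K((λ⁻¹))[[𝐭]]` contains `K[[𝐭, λ⁻¹]]`, the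
powers `λ^n` with `n ∈ ℤ`, and `exp (± ∑ t_k λ^{k+1})`. -/

/-- The ring `K((λ⁻¹))[[𝐭]]`. -/
abbrev WaveRing (K : Type*) [CommRing K] := MvPowerSeries ℕ (LaurentSeries K)

/-- The inclusion `K[[𝐭]] → K((λ⁻¹))[[𝐭]]`. -/
noncomputable def ofTime : TimeSeries K →+* WaveRing K :=
  MvPowerSeries.map HahnSeries.C

/-- The inclusion `K[[𝐭, λ⁻¹]] → K((λ⁻¹))[[𝐭]]`; an element of `K[[𝐭, λ⁻¹]]` is written as a
power series in `𝐭` with coefficients in `K[[λ⁻¹]]`. -/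
noncomputable def ofTimeLam : MvPowerSeries ℕ (PowerSeries K) →+* WaveRing K :=
  MvPowerSeries.map (HahnSeries.ofPowerSeries ℤ K)

/-- The power `λ^m`. -/
noncomputable def lamPow (m : ℤ) : WaveRing K :=
  MvPowerSeries.C (HahnSeries.single (-m) (1 : K))

/-- `exp (s ∑ t_k λ^{k+1}) = ∏_k ∑_a s^a t_k^a λ^{(k+1)a} / a!`. -/
noncomputable def expTime [Algebra ℚ K] (s : ℚ) : WaveRing K := fun α =>
  HahnSeries.single (-(α.sum fun k a => ((k : ℤ) + 1) * (a : ℤ)))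
    (algebraMap ℚ K (α.prod fun _ a => s ^ a / (a.factorial : ℚ)))

/-- The series `φ ∈ K[[𝐭, λ⁻¹]]` is of the form `1 + O(λ⁻¹)`. -/
def IsOneAddO (φ : MvPowerSeries ℕ (PowerSeries K)) : Prop :=
  MvPowerSeries.map (PowerSeries.constantCoeff (R := K)) φ = 1

/-- The shift `n ↦ n + 1` on functions of `(n, 𝐭)`. -/
def shiftFun : RingAut (ℤ → TimeSeries K) where
  toFun f n := f (n + 1)
  invFun f n := f (n - 1)
  left_inv f := by funext n; simp
  right_inv f := by funext n; simp
  map_mul' _ _ := rfl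
  map_add' _ _ := rfl

/-- The action of a difference operator with coefficients depending on `(n, 𝐭)`. -/
noncomputable def act (P : DiffOp (ℤ → TimeSeries K)) (ψ : ℤ → WaveRing K) : ℤ → WaveRing K :=
  fun n => P.sum fun m a => ofTime (a n) * ψ (n + m)

/-- The power `L^k` of the operator `L = Λ + v(n, 𝐭) + w(n, 𝐭) Λ⁻¹`. -/
noncomputable def laxPow (v w : ℤ → TimeSeries K) (k : ℕ) : DiffOp (ℤ → TimeSeries K) :=
  DiffOp.pow shiftFun (DiffOp.lax v w) k

/-- `ψ` is a wave function of type A associated to `(v, w)`. -/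
structure IsWaveA [Algebra ℚ K] (v w : ℤ → TimeSeries K) (ψ : ℤ → WaveRing K) : Prop where
  form : ∃ φ : ℤ → MvPowerSeries ℕ (PowerSeries K), (∀ n, IsOneAddO (φ n)) ∧
    ∀ n, ψ n = ofTimeLam (φ n) * lamPow n * expTime 1
  spectral : ∀ n, act (DiffOp.lax v w) ψ n = lamPow 1 * ψ n
  evolution : ∀ k n,
    MvPowerSeries.pderiv (LaurentSeries K) k (ψ n) = act (laxPow v w (k + 1)).plus ψ n

/-- `ψ` is a wave function of type B associated to `(v, w)` and `E = e^σ`. -/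
structure IsWaveB [Algebra ℚ K] (v w : ℤ → TimeSeries K) (E : ℤ → (TimeSeries K)ˣ)
    (ψ : ℤ → WaveRing K) : Prop where
  form : ∃ φ : ℤ → MvPowerSeries ℕ (PowerSeries K), (∀ n, IsOneAddO (φ n)) ∧
    ∀ n, ψ n = ofTimeLam (φ n) * ofTime ((E n)⁻¹ : (TimeSeries K)ˣ) * lamPow (-n) * expTime (-1)
  spectral : ∀ n, act (DiffOp.lax v w) ψ n = lamPow 1 * ψ n
  evolution : ∀ k n,
    MvPowerSeries.pderiv (LaurentSeries K) k (ψ n) = -act (laxPow v w (k + 1)).minus ψ n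

/-- `ψA` and `ψB` form a pair: `e^{σ(n-1)} d(λ, n) = λ`, where
`d(λ, n) = ψA(λ, n) ψB(λ, n-1) - ψB(λ, n) ψA(λ, n-1)`. -/
def IsPair (E : ℤ → (TimeSeries K)ˣ) (ψA ψB : ℤ → WaveRing K) : Prop :=
  ∀ n, ofTime (E (n - 1) : TimeSeries K) * (ψA n * ψB (n - 1) - ψB n * ψA (n - 1)) = lamPow 1

/-! ### Several spectral parameters

For a permutation `ρ` of the indices, series in `λ_0, …, λ_{k-1}` are expanded in the region
`|λ_{ρ 0}| > |λ_{ρ 1}| > ⋯ > |λ_{ρ (k-1)}| ≫ 0`. They are Hahn series over `ℤ^k` with the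
lexicographic order, the entry at position `p` of an exponent being the exponent of
`λ_{ρ p}⁻¹`. In this ring `λ_i - λ_j` (`i ≠ j`) is invertible, and its inverse is the geometric
expansion of `1 / (λ_i - λ_j)` in that region. -/

/-- The ring of expansions in `k` spectral parameters. -/
abbrev MultiLaurent (K : Type*) [CommRing K] (k : ℕ) := HahnSeries (Lex (Fin k → ℤ)) K

/-- The ring of power series in `𝐭` over the expansions in `k` spectral parameters. -/
abbrev MultiRing (K : Type*) [CommRing K] (k : ℕ) := MvPowerSeries ℕ (MultiLaurent K k)

variable {k : ℕ}

/-- The exponent of `λ_j^{-m}`. -/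
def slot (ρ : Equiv.Perm (Fin k)) (j : Fin k) : ℤ →+ Lex (Fin k → ℤ) where
  toFun m := toLex (Pi.single (ρ.symm j) m)
  map_zero' := by simp
  map_add' a b := by rw [Pi.single_add]; rfl

theorem slot_strictMono (ρ : Equiv.Perm (Fin k)) (j : Fin k) : StrictMono (slot ρ j) := by
  intro a b h
  refine ⟨ρ.symm j, fun i hi => ?_, ?_⟩
  · simp [slot, hi.ne]
  · simpa [slot] using h

/-- The substitution `λ ↦ λ_j`, from series in one spectral parameter to expansions in `k`
spectral parameters. -/
noncomputable def atSlot (ρ : Equiv.Perm (Fin k)) (j : Fin k) : WaveRing K →+* MultiRing K k :=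
  MvPowerSeries.map (HahnSeries.embDomainRingHom (slot ρ j) (slot_strictMono ρ j).injective
    fun _ _ => (slot_strictMono ρ j).le_iff_le)

/-- The inclusion of `K[[𝐭]]`. -/
noncomputable def ofTimeMulti : TimeSeries K →+* MultiRing K k :=
  MvPowerSeries.map HahnSeries.C

/-- The power `λ_j^m`. -/
noncomputable def lamAt (ρ : Equiv.Perm (Fin k)) (j : Fin k) (m : ℤ) : MultiLaurent K k :=
  HahnSeries.single (slot ρ j (-m)) 1

/-- The expansion of `1 / (λ_i - λ_j)`, `i ≠ j`. -/
noncomputable def invDiff (ρ : Equiv.Perm (Fin k)) (i j : Fin k) : MultiRing K k :=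
  MvPowerSeries.C (Ring.inverse (lamAt ρ i 1 - lamAt ρ j 1))

/-- `D(λ_i, λ_j, n, 𝐭) =
(ψA(λ_i, n) ψB(λ_j, n-1) - ψA(λ_i, n-1) ψB(λ_j, n)) / (λ_i - λ_j)`. -/
noncomputable def kernelD (ρ : Equiv.Perm (Fin k)) (ψA ψB : ℤ → WaveRing K) (n : ℤ)
    (i j : Fin k) : MultiRing K k :=
  (atSlot ρ i (ψA n) * atSlot ρ j (ψB (n - 1)) - atSlot ρ i (ψA (n - 1)) * atSlot ρ j (ψB n)) *
    invDiff ρ i j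

/-- The product `∏_j D(π(j), π(j+1))`, indices cyclic modulo `k`. -/
def cycleProd {R : Type*} [CommRing R] (D : Fin k → Fin k → R) (π : Equiv.Perm (Fin k)) : R :=
  ∏ j, D (π j) (π (finRotate k j))

theorem cycleProd_mul_zpow {R : Type*} [CommRing R] (D : Fin k → Fin k → R)
    (π : Equiv.Perm (Fin k)) (m : ℤ) :
    cycleProd D (π * finRotate k ^ m) = cycleProd D π := by
  have h : ∀ j, (finRotate k ^ m) (finRotate k j) = finRotate k ((finRotate k ^ m) j) := by
    intro j
    rw [← Equiv.Perm.mul_apply, ← Equiv.Perm.mul_apply]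
    exact DFunLike.congr_fun ((Commute.refl (finRotate k)).zpow_left m).eq j
  simp only [cycleProd, Equiv.Perm.mul_apply, h]
  exact Equiv.prod_comp (finRotate k ^ m) fun j => D (π j) (π (finRotate k j))

open Classical in
/-- The sum `∑_{π ∈ S_k/C_k} ∏_j D(π(j), π(j+1))`, where `C_k` is generated by the cyclic rotation
of the indices. -/
noncomputable def cyclicSum {R : Type*} [CommRing R] (D : Fin k → Fin k → R) : R :=
  ∑ q : Equiv.Perm (Fin k) ⧸ Subgroup.zpowers (finRotate k),
    Quotient.liftOn' q (cycleProd D) fun a b hab => by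
      obtain ⟨m, hm⟩ := Subgroup.mem_zpowers_iff.mp (QuotientGroup.leftRel_apply.mp hab)
      have hb : b = a * finRotate k ^ m := by rw [hm]; group
      rw [hb, cycleProd_mul_zpow]

/-- The exponent of `∏_j λ_j^{-(i_j + 2)}`. -/
def genExp (ρ : Equiv.Perm (Fin k)) (i : Fin k → ℕ) : Lex (Fin k → ℤ) :=
  toLex fun p => ((i (ρ p) : ℤ) + 2)

theorem genExp_monotone (ρ : Equiv.Perm (Fin k)) : Monotone (genExp ρ) := fun a b h =>
  Pi.toLex_monotone fun p => by simpa using h (ρ p)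

theorem genExp_injective (ρ : Equiv.Perm (Fin k)) : Function.Injective (genExp ρ) := by
  intro a b h
  funext j
  have := congrFun (congrArg ofLex h) (ρ.symm j)
  simpa [genExp] using this

/-- The series `∑_{i_1,…,i_k ≥ 0} c(i_1,…,i_k) / (λ_1^{i_1+2} ⋯ λ_k^{i_k+2})`. -/
noncomputable def genLaurent (ρ : Equiv.Perm (Fin k)) (c : (Fin k → ℕ) → K) :
    MultiLaurent K k where
  coeff := Function.extend (genExp ρ) c 0
  isPWO_support' := by
    refine Set.IsPWO.mono ((Set.isPWO_of_wellQuasiOrderedLE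
      (Set.univ : Set (Fin k → ℕ))).image_of_monotone (genExp_monotone ρ)) fun g hg => ?_
    by_contra hne
    refine hg (Function.extend_apply' _ _ _ ?_)
    rintro ⟨i, rfl⟩
    exact hne ⟨i, Set.mem_univ _, rfl⟩

/-- The generating series `∑ Ω_{i_1,…,i_k}(n, 𝐭) / (λ_1^{i_1+2} ⋯ λ_k^{i_k+2})` of the `k`-point
correlation functions. -/
noncomputable def corrSeries (ρ : Equiv.Perm (Fin k)) (v w : ℤ → TimeSeries K) (n : ℤ) :
    MultiRing K k := fun α =>
  genLaurent ρ fun i => MvPowerSeries.coeff α (evalAt v w n (corrPoly (List.ofFn i)))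

end Toda

open Toda

namespace Toda

open DiffOp

/-! ### The ring of difference operators -/

section Comp

variable {R : Type*} [CommRing R] (Λ : RingAut R)

/-! Write K(λ,μ) = e^{σ(n-1)} D(λ,μ,n) and ∇ = ∑_q λ_0^{-q-2} ∂/∂t_q, where λ_0 is a new, dominant
spectral parameter. Applying ∇ to the k-point series produces the (k+1)-point series, while the
kernel obeys ∇K(λ,μ) = -λ_0^{-1} K(λ,λ_0) K(λ_0,μ) (`isNabla_kernelK`). By the Leibniz rule ∇ of a
cyclic product of kernels is -λ_0^{-1} times the sum over all insertions of λ_0 into the cycle, and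
every cyclic order of k+1 elements arises from exactly one insertion (`isNabla_cyclicSum`). The
factor -λ_0^{-1} is the change of the prefactor, so the formula passes from k to k+1
(`corrSeries_eq`) and only k = 2 has to be computed.

Both inputs rest on the Green function G = (λ - L)^{-1}, which is λ^{-1} e^{σ(n')} ψ_A(min(n,n'))
ψ_B(max(n,n')). Its expansion in λ^{-1} lists the matrix entries of the powers of L
(`lamCoeff_green`). The flows of the wave functions therefore become half-infinite lattice sums,
whose terms are differences of K in n by the Christoffel–Darboux identity (`kernelK_succ_sub`). The
sums telescope, and the boundary term at distance M is of order at least M in λ_0^{-1}, hence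
invisible in a given coefficient once M is large.

For k = 2, the canonical tau-structure is first made explicit: S_p = Coef(L^{p+1}, 0), and
Ω_{p,q}(n) is the sum of (L^{p+1})_{ab} (L^{q+1})_{ba} over a ≥ n > b (`evalAt_Ω_eq_box`).
Uniqueness holds because only constants are shift invariant. The generating series is the sum of
G(λ_0; a,b) G(λ_1; b,a), which factors into a sum of ψ_A ψ_A over b < n and a sum of ψ_B ψ_B over a
≥ n (`twoPoint_eq_box`). Each factor telescopes, and the Plücker relation with the pair
normalisation turns the result into K(λ_0,λ_1) K(λ_1,λ_0) and the double pole (`kernelK_pluecker`).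

All this takes place in one region of expansion. The others follow by relabelling, since both sides
are symmetric in the spectral parameters. -/

theorem DiffOp.comp_add (P Q Q' : DiffOp R) : comp Λ P (Q + Q') = comp Λ P Q + comp Λ P Q' := by
  simp only [comp]
  rw [← Finsupp.sum_add]
  refine Finsupp.sum_congr fun i _ => ?_
  exact Finsupp.sum_add_index' (by simp) (by intros; simp [mul_add])

theorem DiffOp.add_comp (P P' Q : DiffOp R) : comp Λ (P + P') Q = comp Λ P Q + comp Λ P' Q := by
  simp only [comp]
  refine Finsupp.sum_add_index' (by simp) fun i a b => ?_
  rw [← Finsupp.sum_add]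
  exact Finsupp.sum_congr fun j _ => by simp [add_mul]

@[simp] theorem DiffOp.zero_comp (Q : DiffOp R) : comp Λ 0 Q = 0 := by simp [comp]

@[simp] theorem DiffOp.comp_zero (P : DiffOp R) : comp Λ P 0 = 0 := by simp [comp]

theorem DiffOp.comp_single_single (i j : ℤ) (a b : R) :
    comp Λ (Finsupp.single i a) (Finsupp.single j b) =
      Finsupp.single (i + j) (a * (Λ ^ i) b) := by
  simp [comp]

theorem DiffOp.single_comp_apply (i : ℤ) (a : R) (Q : DiffOp R) (m : ℤ) :
    comp Λ (Finsupp.single i a) Q m = a * (Λ ^ i) (Q (m - i)) := by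
  induction Q using Finsupp.induction_linear with
  | zero => simp
  | add f g hf hg => simp [comp_add, hf, hg, mul_add]
  | single j b =>
    rw [comp_single_single, Finsupp.single_apply, Finsupp.single_apply]
    by_cases h : i + j = m
    · rw [if_pos h, if_pos (by omega)]
    · rw [if_neg h, if_neg (by omega)]; simp

theorem DiffOp.comp_apply (P Q : DiffOp R) (m : ℤ) :
    comp Λ P Q m = P.sum fun i a => a * (Λ ^ i) (Q (m - i)) := by
  induction P using Finsupp.induction_linear with
  | zero => simp
  | add f g hf hg =>
    rw [add_comp, Finsupp.add_apply, hf, hg, Finsupp.sum_add_index' (by simp)]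
    intros; simp [add_mul]
  | single i a => rw [single_comp_apply]; simp

theorem DiffOp.comp_apply_of_subset (P Q : DiffOp R) (m : ℤ) (s : Finset ℤ)
    (hs : ∀ i ∉ s, P i = 0) :
    comp Λ P Q m = ∑ i ∈ s, P i * (Λ ^ i) (Q (m - i)) := by
  rw [comp_apply]
  exact Finsupp.sum_of_support_subset _ (fun i hi => by
    by_contra h; exact (Finsupp.mem_support_iff.mp hi) (hs i h)) _ (by simp)

theorem DiffOp.comp_single_apply (P : DiffOp R) (j : ℤ) (b : R) (m : ℤ) :
    comp Λ P (Finsupp.single j b) m = P (m - j) * (Λ ^ (m - j)) b := by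
  rw [comp_apply_of_subset Λ P _ m (P.support ∪ {m - j}) (by
    intro i hi; simp at hi; exact hi.2), Finset.sum_eq_single (m - j)]
  · simp
  · intro i _ hi
    rw [Finsupp.single_eq_of_ne (by omega)]; simp
  · intro h; simp at h

theorem DiffOp.comp_apply_of_subset_right (P Q : DiffOp R) (m : ℤ) (s : Finset ℤ)
    (hs : ∀ j ∉ s, Q j = 0) :
    comp Λ P Q m = ∑ j ∈ s, P (m - j) * (Λ ^ (m - j)) (Q j) := by
  have key : ∀ Q : DiffOp R,
      comp Λ P Q m = Q.sum fun j b => P (m - j) * (Λ ^ (m - j)) b := by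
    intro Q
    induction Q using Finsupp.induction_linear with
    | zero => simp
    | add f g hf hg =>
      rw [comp_add, Finsupp.add_apply, hf, hg, Finsupp.sum_add_index' (by simp)]
      intros; simp [mul_add]
    | single i a => rw [comp_single_apply]; simp
  rw [key]
  exact Finsupp.sum_of_support_subset _ (fun i hi => by
    by_contra h; exact (Finsupp.mem_support_iff.mp hi) (hs i h)) _ (by simp)

theorem DiffOp.comp_assoc (P Q S : DiffOp R) :
    comp Λ (comp Λ P Q) S = comp Λ P (comp Λ Q S) := by
  induction P using Finsupp.induction_linear with
  | zero => simp
  | add f g hf hg => simp [add_comp, hf, hg]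
  | single i a =>
    induction Q using Finsupp.induction_linear with
    | zero => simp
    | add f g hf hg => simp [add_comp, comp_add, hf, hg]
    | single j b =>
      induction S using Finsupp.induction_linear with
      | zero => simp
      | add f g hf hg => simp [comp_add, hf, hg]
      | single l c =>
        simp only [comp_single_single, map_mul, zpow_add, RingAut.mul_apply, add_assoc, mul_assoc]

/-- Difference operators with composition as multiplication. -/
def SkewLaurent {R : Type*} [CommRing R] (_ : RingAut R) := DiffOp R

noncomputable instance : AddCommGroup (SkewLaurent Λ) := inferInstanceAs (AddCommGroup (DiffOp R))

noncomputable instance : Ring (SkewLaurent Λ) :=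
  { (inferInstance : AddCommGroup (SkewLaurent Λ)) with
    mul := comp Λ
    one := (Finsupp.single 0 1 : DiffOp R)
    left_distrib := comp_add Λ
    right_distrib := add_comp Λ
    zero_mul := zero_comp Λ
    mul_zero := comp_zero Λ
    mul_assoc := comp_assoc Λ
    one_mul := fun P => Finsupp.ext fun m =>
      (single_comp_apply Λ 0 1 P m).trans (by simp)
    mul_one := fun P => Finsupp.ext fun m =>
      (comp_single_apply Λ P 0 1 m).trans (by simp) }

instance : FunLike (SkewLaurent Λ) ℤ R := inferInstanceAs (FunLike (DiffOp R) ℤ R)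

theorem DiffOp.pow_eq (P : SkewLaurent Λ) (k : ℕ) : DiffOp.pow Λ P k = P ^ k := by
  induction k with
  | zero => rfl
  | succ k ih => rw [pow_succ', ← ih]; rfl

variable {Λ}

@[simp] theorem SkewLaurent.add_apply (P Q : SkewLaurent Λ) (m : ℤ) : (P + Q) m = P m + Q m := rfl

@[simp] theorem SkewLaurent.sub_apply (P Q : SkewLaurent Λ) (m : ℤ) : (P - Q) m = P m - Q m := by
  exact Finsupp.sub_apply (G := R) P Q m

@[simp] theorem SkewLaurent.neg_apply (P : SkewLaurent Λ) (m : ℤ) : (-P) m = -P m := by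
  exact Finsupp.neg_apply (G := R) P m

@[ext] theorem SkewLaurent.ext {P Q : SkewLaurent Λ} (h : ∀ m, P m = Q m) : P = Q := Finsupp.ext h

/-- Coefficients vanish in negative degrees. -/
def SkewLaurent.IsPlus (P : SkewLaurent Λ) : Prop := ∀ m < 0, P m = 0

/-- Coefficients vanish in nonnegative degrees. -/
def SkewLaurent.IsMinus (P : SkewLaurent Λ) : Prop := ∀ m, 0 ≤ m → P m = 0

theorem SkewLaurent.mul_apply (P Q : SkewLaurent Λ) (m : ℤ) :
    (P * Q) m = ∑ i ∈ Finsupp.support (M := R) P, P i * (Λ ^ i) (Q (m - i)) :=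
  comp_apply Λ P Q m

theorem SkewLaurent.IsPlus.mul {P Q : SkewLaurent Λ} (hP : P.IsPlus) (hQ : Q.IsPlus) :
    (P * Q).IsPlus := fun m hm => by
  rw [mul_apply]
  refine Finset.sum_eq_zero fun i _ => ?_
  rcases lt_or_ge i 0 with h | h
  · rw [hP i h, zero_mul]
  · rw [hQ (m - i) (by omega), map_zero, mul_zero]

theorem SkewLaurent.IsMinus.mul {P Q : SkewLaurent Λ} (hP : P.IsMinus) (hQ : Q.IsMinus) :
    (P * Q).IsMinus := fun m hm => by
  rw [mul_apply]
  refine Finset.sum_eq_zero fun i _ => ?_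
  rcases lt_or_ge i 0 with h | h
  · rw [hQ (m - i) (by omega), map_zero, mul_zero]
  · rw [hP i h, zero_mul]

/-- The projection `P ↦ P_+` as an additive map. -/
noncomputable def SkewLaurent.plusHom (Λ : RingAut R) : SkewLaurent Λ →+ SkewLaurent Λ :=
  Finsupp.filterAddHom (M := R) fun m : ℤ => 0 ≤ m

theorem SkewLaurent.plusHom_apply (P : SkewLaurent Λ) (m : ℤ) :
    plusHom Λ P m = if 0 ≤ m then P m else 0 := by
  exact Finsupp.filter_apply (M := R) _ _ _

theorem SkewLaurent.IsPlus.plusHom_eq {P : SkewLaurent Λ} (hP : P.IsPlus) : plusHom Λ P = P := by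
  ext m
  rw [plusHom_apply]
  split_ifs with h
  · rfl
  · exact (hP m (by omega)).symm

theorem SkewLaurent.IsMinus.plusHom_eq {P : SkewLaurent Λ} (hP : P.IsMinus) :
    plusHom Λ P = 0 := by
  ext m
  rw [plusHom_apply]
  split_ifs with h
  · exact hP m h
  · rfl

theorem SkewLaurent.isPlus_plusHom (P : SkewLaurent Λ) : (plusHom Λ P).IsPlus := fun m hm => by
  rw [plusHom_apply, if_neg (by omega)]

theorem SkewLaurent.isMinus_sub_plusHom (P : SkewLaurent Λ) : (P - plusHom Λ P).IsMinus :=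
  fun m hm => by rw [sub_apply, plusHom_apply, if_pos hm, sub_self]

/-- A derivation acting on the coefficients of difference operators. -/
noncomputable def SkewLaurent.mapD (Λ : RingAut R) (d : Derivation ℤ R R) :
    SkewLaurent Λ →+ SkewLaurent Λ :=
  Finsupp.mapRange.addMonoidHom (d : R →+ R)

@[simp] theorem SkewLaurent.mapD_apply (d : Derivation ℤ R R) (P : SkewLaurent Λ) (m : ℤ) :
    mapD Λ d P m = d (P m) := rfl

theorem zpow_apply_comm {d : R → R} (hd : ∀ x, d (Λ x) = Λ (d x)) (i : ℤ) (x : R) :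
    d ((Λ ^ i) x) = (Λ ^ i) (d x) := by
  have hinv : ∀ x, d (Λ⁻¹ x) = Λ⁻¹ (d x) := fun x => by
    apply Λ.injective
    rw [← hd, ← RingAut.mul_apply, ← RingAut.mul_apply, mul_inv_cancel]; rfl
  induction i generalizing x with
  | zero => rfl
  | succ i ih => rw [zpow_add_one, RingAut.mul_apply, ih, hd]; rfl
  | pred i ih => rw [zpow_sub_one, RingAut.mul_apply, ih, hinv]; rfl

theorem SkewLaurent.mapD_mul {d : Derivation ℤ R R} (hd : ∀ x, d (Λ x) = Λ (d x))
    (P Q : SkewLaurent Λ) : mapD Λ d (P * Q) = mapD Λ d P * Q + P * mapD Λ d Q := by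
  ext m
  have hs : ∀ i ∉ Finsupp.support (M := R) P, P i = 0 := fun i hi => by
    exact Finsupp.notMem_support_iff.mp hi
  have h1 : (P * Q) m = _ := comp_apply_of_subset Λ P Q m _ hs
  have h2 : (mapD Λ d P * Q) m = _ := comp_apply_of_subset Λ (mapD Λ d P) Q m
    (Finsupp.support (M := R) P) (fun i hi => (congrArg d (hs i hi)).trans (map_zero d))
  have h3 : (P * mapD Λ d Q) m = _ := comp_apply_of_subset Λ P (mapD Λ d Q) m _ hs
  rw [add_apply, mapD_apply, h1, h2, h3, map_sum, ← Finset.sum_add_distrib]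
  refine Finset.sum_congr rfl fun i _ => ?_
  have e := Derivation.leibniz d (P i) ((Λ ^ i) (Q (m - i)))
  rw [zpow_apply_comm hd, smul_eq_mul, smul_eq_mul] at e
  exact e.trans (by rw [add_comm, mul_comm ((Λ ^ i) (Q (m - i)))]; rfl)

/-- Left multiplication by the Lax operator. -/
theorem DiffOp.lax_comp_apply (Λ : RingAut R) (v w : R) (P : DiffOp R) (m : ℤ) :
    comp Λ (lax v w) P m = Λ (P (m - 1)) + v * P m + w * Λ⁻¹ (P (m + 1)) := by
  simp [lax, add_comp, single_comp_apply]

/-- Right multiplication by the Lax operator. -/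
theorem DiffOp.comp_lax_apply (Λ : RingAut R) (v w : R) (P : DiffOp R) (m : ℤ) :
    comp Λ P (lax v w) m =
      P (m - 1) + P m * (Λ ^ m) v + P (m + 1) * (Λ ^ (m + 1)) w := by
  simp [lax, comp_add, comp_single_apply]

theorem DiffOp.pow_zero_apply (Λ : RingAut R) (P : DiffOp R) (m : ℤ) :
    DiffOp.pow Λ P 0 m = if m = 0 then 1 else 0 := by
  simp [DiffOp.pow, Finsupp.single_apply, eq_comm]

theorem DiffOp.lax_pow_succ_apply (Λ : RingAut R) (v w : R) (k : ℕ) (m : ℤ) :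
    DiffOp.pow Λ (lax v w) (k + 1) m = Λ (DiffOp.pow Λ (lax v w) k (m - 1)) +
      v * DiffOp.pow Λ (lax v w) k m + w * Λ⁻¹ (DiffOp.pow Λ (lax v w) k (m + 1)) :=
  lax_comp_apply Λ v w _ m

theorem DiffOp.lax_pow_apply_eq_zero (Λ : RingAut R) (v w : R) (k : ℕ) (m : ℤ)
    (hm : (k : ℤ) < |m|) : DiffOp.pow Λ (lax v w) k m = 0 := by
  induction k generalizing m with
  | zero => rw [pow_zero_apply, if_neg]; rintro rfl; simp at hm
  | succ k ih =>
    push_cast at hm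
    rw [lax_pow_succ_apply, ih, ih, ih] <;> first | simp | skip
    all_goals (rw [lt_abs] at *; omega)

end Comp

end Toda

namespace Toda

open DiffOp

/-! ### The Toda derivations commute -/

section Derivations

/-- The Lax operator over `𝒜`, as an element of the ring of difference operators. -/
noncomputable def laxS : SkewLaurent shift := lax (vVar 0) (wVar 0)

/-- `A_k = (L^{k+1})_+`. -/
noncomputable def opS (k : ℕ) : SkewLaurent shift := SkewLaurent.plusHom shift (laxS ^ (k + 1))

theorem opA_eq (k : ℕ) : opA k = opS k := by
  have h := pow_eq shift laxS (k + 1)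
  exact congrArg (SkewLaurent.plusHom shift) h

theorem laxBracket_eq (k : ℕ) : laxBracket k = (opS k * laxS - laxS * opS k : SkewLaurent shift) := by
  have : laxBracket k = comp shift (opA k) (lax (vVar 0) (wVar 0)) -
    comp shift (lax (vVar 0) (wVar 0)) (opA k) := rfl
  rw [this, opA_eq]; rfl

@[simp] theorem shift_vVar (i : ℤ) : shift (vVar i) = vVar (i + 1) := by
  simp [shift, vVar]

@[simp] theorem shift_wVar (i : ℤ) : shift (wVar i) = wVar (i + 1) := by
  simp [shift, wVar]

theorem shift_zpow_vVar (m i : ℤ) : (shift ^ m) (vVar i) = vVar (i + m) := by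
  have hinv : ∀ i, shift⁻¹ (vVar i) = vVar (i - 1) := fun i => by
    apply shift.injective
    rw [← RingAut.mul_apply, mul_inv_cancel, shift_vVar]; simp
  induction m generalizing i with
  | zero => simp
  | succ m ih => rw [zpow_add_one, RingAut.mul_apply, shift_vVar, ih]; congr 1; ring
  | pred m ih => rw [zpow_sub_one, RingAut.mul_apply, hinv, ih]; congr 1; ring

theorem shift_zpow_wVar (m i : ℤ) : (shift ^ m) (wVar i) = wVar (i + m) := by
  have hinv : ∀ i, shift⁻¹ (wVar i) = wVar (i - 1) := fun i => by
    apply shift.injective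
    rw [← RingAut.mul_apply, mul_inv_cancel, shift_wVar]; simp
  induction m generalizing i with
  | zero => simp
  | succ m ih => rw [zpow_add_one, RingAut.mul_apply, shift_wVar, ih]; congr 1; ring
  | pred m ih => rw [zpow_sub_one, RingAut.mul_apply, hinv, ih]; congr 1; ring

theorem todaD_vVar (k : ℕ) (i : ℤ) : todaD k (vVar i) = (shift ^ i) (laxBracket k 0) := by
  simp [todaD, vVar]

theorem todaD_wVar (k : ℕ) (i : ℤ) : todaD k (wVar i) = (shift ^ i) (laxBracket k (-1)) := by
  simp [todaD, wVar]

theorem todaD_shift (k : ℕ) (f : Poly) : todaD k (shift f) = shift (todaD k f) := by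
  induction f using MvPolynomial.induction_on with
  | C a => simp
  | add f g hf hg => simp [hf, hg]
  | mul_X f i hf =>
    have hX : todaD k (shift (MvPolynomial.X i)) = shift (todaD k (MvPolynomial.X i)) := by
      rcases i with i | i
      · change todaD k (shift (vVar i)) = shift (todaD k (vVar i))
        rw [shift_vVar, todaD_vVar, todaD_vVar, ← RingAut.mul_apply, ← zpow_one_add, add_comm]
      · change todaD k (shift (wVar i)) = shift (todaD k (wVar i))
        rw [shift_wVar, todaD_wVar, todaD_wVar, ← RingAut.mul_apply, ← zpow_one_add, add_comm]
    rw [map_mul, Derivation.leibniz, Derivation.leibniz, hf, hX]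
    simp

/-- Since `L^{k+1}` commutes with `L`, the bracket `[A_k, L]` equals `[L, B_k]` with `B_k =
(L^{k+1})_-`. The first form has no terms below degree -1, the second none above degree 0. Hence the
two coefficients that define `D_k` already give the full Lax equation. -/
theorem laxBracket_apply_eq_zero (k : ℕ) (m : ℤ) (h0 : m ≠ 0) (h1 : m ≠ -1) :
    laxBracket k m = 0 := by
  have hc : laxS ^ (k + 1) * laxS = laxS * laxS ^ (k + 1) := (pow_succ _ _).symm.trans (pow_succ' _ _)
  rw [laxBracket_eq]
  rcases lt_or_ge m 0 with h | h
  · have e1 : (opS k * laxS) m = _ := comp_lax_apply shift (vVar 0) (wVar 0) (opS k) m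
    have e2 : (laxS * opS k) m = _ := lax_comp_apply shift (vVar 0) (wVar 0) (opS k) m
    have z : ∀ m < 0, opS k m = 0 := SkewLaurent.isPlus_plusHom (laxS ^ (k + 1))
    refine (SkewLaurent.sub_apply _ _ m).trans ?_
    rw [e1, e2]
    change opS k (m - 1) + opS k m * _ + opS k (m + 1) * _ -
      (shift (opS k (m - 1)) + _ * opS k m + _ * shift⁻¹ (opS k (m + 1))) = 0
    rw [z (m - 1) (by omega), z m h, z (m + 1) (by omega)]
    simp
  · set B : SkewLaurent shift := laxS ^ (k + 1) - opS k with hB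
    have hb : opS k * laxS - laxS * opS k = laxS * B - B * laxS := by
      rw [hB, mul_sub, sub_mul, hc]; abel
    have e1 : (B * laxS) m = _ := comp_lax_apply shift (vVar 0) (wVar 0) B m
    have e2 : (laxS * B) m = _ := lax_comp_apply shift (vVar 0) (wVar 0) B m
    have z : ∀ m, 0 ≤ m → B m = 0 := SkewLaurent.isMinus_sub_plusHom (laxS ^ (k + 1))
    refine (congrArg (fun P : SkewLaurent shift => P m) hb).trans
      ((SkewLaurent.sub_apply _ _ m).trans ?_)
    rw [e1, e2]
    change (shift (B (m - 1)) + _ * B m + _ * shift⁻¹ (B (m + 1))) -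
      (B (m - 1) + B m * _ + B (m + 1) * _) = 0
    rw [z (m - 1) (by omega), z m h, z (m + 1) (by omega)]
    simp

/-- `D_k` on coefficients of difference operators. -/
noncomputable def opD (k : ℕ) : SkewLaurent shift →+ SkewLaurent shift :=
  SkewLaurent.mapD shift (todaD k)

theorem opD_apply (k : ℕ) (P : SkewLaurent shift) (m : ℤ) : opD k P m = todaD k (P m) := rfl

theorem lax_apply {R : Type*} [CommRing R] (v w : R) (m : ℤ) :
    lax v w m = if m = 1 then 1 else if m = 0 then v else if m = -1 then w else 0 := by
  simp only [lax, Finsupp.add_apply, Finsupp.single_apply]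
  by_cases h1 : m = 1
  · subst h1; simp
  · by_cases h0 : m = 0
    · subst h0; simp
    · by_cases h2 : m = -1
      · subst h2; simp
      · simp [h1, h0, h2, Ne.symm h1, Ne.symm h0, Ne.symm h2]

theorem opD_laxS (k : ℕ) : opD k laxS = opS k * laxS - laxS * opS k := by
  ext m : 1
  have hl : (opS k * laxS - laxS * opS k) m = laxBracket k m := by
    rw [laxBracket_eq]; rfl
  have hm : laxS m = _ := lax_apply (vVar 0) (wVar 0) m
  rw [hl, opD_apply, hm]
  by_cases h1 : m = 1
  · subst h1; simp [laxBracket_apply_eq_zero]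
  · by_cases h0 : m = 0
    · subst h0; simp [todaD_vVar]
    · by_cases h2 : m = -1
      · subst h2; simp [todaD_wVar]
      · simp [h1, h0, h2, laxBracket_apply_eq_zero]

theorem opD_mul (k : ℕ) (P Q : SkewLaurent shift) : opD k (P * Q) = opD k P * Q + P * opD k Q :=
  SkewLaurent.mapD_mul (todaD_shift k) P Q

theorem opD_one (k : ℕ) : opD k 1 = 0 := by
  have h := opD_mul k 1 1
  simpa using h

theorem opD_laxS_pow (k j : ℕ) : opD k (laxS ^ j) = opS k * laxS ^ j - laxS ^ j * opS k := by
  induction j with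
  | zero => simp [opD_one]
  | succ j ih => rw [pow_succ', opD_mul, ih, opD_laxS]; noncomm_ring

theorem opD_plusHom (k : ℕ) (P : SkewLaurent shift) :
    opD k (SkewLaurent.plusHom shift P) = SkewLaurent.plusHom shift (opD k P) := by
  ext m : 1
  rw [SkewLaurent.plusHom_apply, opD_apply, opD_apply,
    SkewLaurent.plusHom_apply]
  split_ifs <;> simp

/-- The zero curvature equations. -/
theorem opD_opS_sub (p q : ℕ) :
    opD p (opS q) - opD q (opS p) = opS p * opS q - opS q * opS p := by
  have hc : laxS ^ (p + 1) * laxS ^ (q + 1) = laxS ^ (q + 1) * laxS ^ (p + 1) := by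
    rw [← pow_add, ← pow_add, add_comm]
  have hB : ∀ k, (laxS ^ (k + 1) - opS k).IsMinus := fun k => SkewLaurent.isMinus_sub_plusHom _
  have hA : ∀ k, (opS k).IsPlus := fun k => SkewLaurent.isPlus_plusHom _
  -- With `B = L^{k+1} - A`, commutativity of the powers of `L` gives `[A_p, L^{q+1}] - [A_q,
  -- L^{p+1}] = [A_p, A_q] - [B_p, B_q]`. The plus part removes the second commutator.
  have e : opS p * laxS ^ (q + 1) - laxS ^ (q + 1) * opS p -
      (opS q * laxS ^ (p + 1) - laxS ^ (p + 1) * opS q) =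
      opS p * opS q - opS q * opS p -
        (laxS ^ (p + 1) - opS p) * (laxS ^ (q + 1) - opS q) +
        (laxS ^ (q + 1) - opS q) * (laxS ^ (p + 1) - opS p) := by
    have : opS p * opS q - opS q * opS p -
        (laxS ^ (p + 1) - opS p) * (laxS ^ (q + 1) - opS q) +
        (laxS ^ (q + 1) - opS q) * (laxS ^ (p + 1) - opS p) =
        opS p * laxS ^ (q + 1) - laxS ^ (q + 1) * opS p -
      (opS q * laxS ^ (p + 1) - laxS ^ (p + 1) * opS q) -
      (laxS ^ (p + 1) * laxS ^ (q + 1) - laxS ^ (q + 1) * laxS ^ (p + 1)) := by noncomm_ring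
    rw [this, hc]; abel
  have h1 : opD p (opS q) = SkewLaurent.plusHom shift (opD p (laxS ^ (q + 1))) := opD_plusHom _ _
  have h2 : opD q (opS p) = SkewLaurent.plusHom shift (opD q (laxS ^ (p + 1))) := opD_plusHom _ _
  rw [h1, h2, opD_laxS_pow, opD_laxS_pow, ← map_sub, e, map_add, map_sub, map_sub,
    ((hB p).mul (hB q)).plusHom_eq, ((hB q).mul (hB p)).plusHom_eq,
    ((hA p).mul (hA q)).plusHom_eq, ((hA q).mul (hA p)).plusHom_eq]
  abel

/-- By the Lax equation and the Jacobi identity the two sides differ by the commutator of `D_p A_q -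
D_q A_p - [A_p, A_q]` with `L`, which vanishes by zero curvature. -/
theorem opD_comm_laxS (p q : ℕ) : opD p (opD q laxS) = opD q (opD p laxS) := by
  have h := opD_opS_sub p q
  rw [opD_laxS, opD_laxS, map_sub, map_sub, opD_mul, opD_mul, opD_mul, opD_mul, opD_laxS, opD_laxS,
    ← sub_eq_zero]
  have h' : opD p (opS q) = opD q (opS p) + (opS p * opS q - opS q * opS p) := by
    rw [← h]; abel
  rw [h']
  noncomm_ring

theorem todaD_comm (p q : ℕ) (f : Poly) : todaD p (todaD q f) = todaD q (todaD p f) := by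
  have hv : todaD p (todaD q (vVar 0)) = todaD q (todaD p (vVar 0)) := by
    have h : (opD p (opD q laxS)) 0 = (opD q (opD p laxS)) 0 := by rw [opD_comm_laxS]
    have hm : laxS 0 = vVar 0 := (lax_apply (vVar 0) (wVar 0) 0).trans (by simp)
    simpa only [opD_apply, hm] using h
  have hw : todaD p (todaD q (wVar 0)) = todaD q (todaD p (wVar 0)) := by
    have h : (opD p (opD q laxS)) (-1) = (opD q (opD p laxS)) (-1) := by rw [opD_comm_laxS]
    have hm : laxS (-1) = wVar 0 := (lax_apply (vVar 0) (wVar 0) (-1)).trans (by simp)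
    simpa only [opD_apply, hm] using h
  induction f using MvPolynomial.induction_on with
  | C a => simp
  | add f g hf hg => simp [hf, hg]
  | mul_X f i hf =>
    have hX : todaD p (todaD q (MvPolynomial.X i)) = todaD q (todaD p (MvPolynomial.X i)) := by
      rcases i with i | i
      · have := congrArg (shift ^ i) hv
        rw [← zpow_apply_comm (todaD_shift p), ← zpow_apply_comm (todaD_shift q),
          ← zpow_apply_comm (todaD_shift q), ← zpow_apply_comm (todaD_shift p),
          shift_zpow_vVar, zero_add] at this
        exact this
      · have := congrArg (shift ^ i) hw
        rw [← zpow_apply_comm (todaD_shift p), ← zpow_apply_comm (todaD_shift q),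
          ← zpow_apply_comm (todaD_shift q), ← zpow_apply_comm (todaD_shift p),
          shift_zpow_wVar, zero_add] at this
        exact this
    simp only [Derivation.leibniz, map_add, smul_eq_mul, hf, hX]
    ring

end Derivations

end Toda

namespace Toda

open DiffOp MvPolynomial

/-! ### The canonical tau-structure -/

section TauStructure

/-- The coefficients of the powers of the Lax operator. -/
noncomputable def lp (k : ℕ) : DiffOp Poly := DiffOp.pow shift (lax (vVar 0) (wVar 0)) k

theorem lp_eq (k : ℕ) : lp k = laxS ^ k := DiffOp.pow_eq shift laxS k

theorem lp_apply_eq_zero (k : ℕ) (m : ℤ) (hm : (k : ℤ) < |m|) : lp k m = 0 :=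
  lax_pow_apply_eq_zero _ _ _ k m hm

theorem constantCoeff_shift (f : Poly) : constantCoeff (shift f) = constantCoeff f := by
  change constantCoeff (MvPolynomial.rename _ f) = _
  rw [constantCoeff_rename]

theorem constantCoeff_zpow_shift (m : ℤ) (f : Poly) :
    constantCoeff ((shift ^ m) f) = constantCoeff f := by
  have hinv : ∀ f, constantCoeff (shift⁻¹ f) = constantCoeff f := fun f => by
    rw [← constantCoeff_shift (shift⁻¹ f), ← RingAut.mul_apply, mul_inv_cancel]; rfl
  induction m generalizing f with
  | zero => rfl
  | succ m ih => rw [zpow_add_one, RingAut.mul_apply, ih, constantCoeff_shift]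
  | pred m ih => rw [zpow_sub_one, RingAut.mul_apply, ih, hinv]

@[simp] theorem constantCoeff_vVar (i : ℤ) : constantCoeff (vVar i) = 0 := by simp [vVar]

@[simp] theorem constantCoeff_wVar (i : ℤ) : constantCoeff (wVar i) = 0 := by simp [wVar]

theorem constantCoeff_lp (k : ℕ) (m : ℤ) :
    constantCoeff (lp k m) = if m = k then 1 else 0 := by
  induction k generalizing m with
  | zero =>
    rw [lp, pow_zero_apply]; simp only [Nat.cast_zero]; split_ifs <;> simp
  | succ k ih =>
    have h := lax_pow_succ_apply shift (vVar 0) (wVar 0) k m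
    change lp (k + 1) m = shift (lp k (m - 1)) + vVar 0 * lp k m + wVar 0 * shift⁻¹ (lp k (m + 1)) at h
    rw [h]
    simp only [map_add, map_mul, constantCoeff_vVar, constantCoeff_wVar, zero_mul, add_zero,
      constantCoeff_shift, ih]
    push_cast
    exact if_congr (by omega) rfl rfl

/-- At `v = w = 0` the operator `L` is `Λ`, which commutes with operators whose coefficients are
constants. -/
theorem constantCoeff_laxBracket (k : ℕ) (m : ℤ) : constantCoeff (laxBracket k m) = 0 := by
  have h : laxBracket k m = comp shift (opA k) (lax (vVar 0) (wVar 0)) m -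
    comp shift (lax (vVar 0) (wVar 0)) (opA k) m := by
      rw [laxBracket, Finsupp.sub_apply]
  rw [h, lax_comp_apply, comp_lax_apply]
  simp [constantCoeff_zpow_shift, constantCoeff_shift]

theorem constantCoeff_todaD (k : ℕ) (f : Poly) : constantCoeff (todaD k f) = 0 := by
  induction f using MvPolynomial.induction_on with
  | C a => simp
  | add f g hf hg => simp [hf, hg]
  | mul_X f i hf =>
    have hX : constantCoeff (todaD k (MvPolynomial.X i)) = 0 := by
      rcases i with i | i
      · have := todaD_vVar k i
        rw [vVar] at this
        rw [this, constantCoeff_zpow_shift, constantCoeff_laxBracket]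
      · have := todaD_wVar k i
        rw [wVar] at this
        rw [this, constantCoeff_zpow_shift, constantCoeff_laxBracket]
    simp [hf, hX]

/-- The shift-invariant elements of `𝒜` are the constants. -/
theorem eq_C_of_shift_eq {f : Poly} (hf : shift f = f) : f = C (constantCoeff f) := by
  set e : ℤ ⊕ ℤ ≃ ℤ ⊕ ℤ := Equiv.sumCongr (Equiv.addRight (1 : ℤ)) (Equiv.addRight (1 : ℤ)) with he
  have hf' : MvPolynomial.rename e f = f := hf
  let idx : ℤ ⊕ ℤ → ℤ := Sum.elim id id
  have hidx : ∀ x, idx (e x) = idx x + 1 := by rintro (x | x) <;> simp [idx, he]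
  -- The weight of a monomial is the sum of the lattice positions of its variables. A shift
  -- increases it by the degree, so a nonconstant monomial of maximal weight in the support would be
  -- sent to a heavier one, still in the support.
  let φ : (ℤ ⊕ ℤ →₀ ℕ) → ℤ := fun d => d.sum fun x a => (a : ℤ) * idx x
  have hφ : ∀ d : ℤ ⊕ ℤ →₀ ℕ, d ≠ 0 → φ d < φ (d.mapDomain e) := fun d hd => by
    simp only [φ]
    rw [Finsupp.sum_mapDomain_index (by simp) (by intros; push_cast; ring)]
    refine Finset.sum_lt_sum_of_nonempty (Finsupp.support_nonempty_iff.mpr hd) fun x hx => ?_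
    have : 0 < d x := Nat.pos_of_ne_zero (Finsupp.mem_support_iff.mp hx)
    simp only [hidx, mul_add]
    omega
  have hsupp : ∀ d ∈ f.support, d.mapDomain e ∈ f.support := fun d hd => by
    rw [mem_support_iff, ← hf', coeff_rename_mapDomain _ e.injective]
    exact mem_support_iff.mp hd
  have hzero : ∀ d ∈ f.support, d = 0 := by
    by_contra! hne
    have hne' : (f.support.filter (· ≠ 0)).Nonempty := by
      obtain ⟨d, hd, h0⟩ := hne
      exact ⟨d, Finset.mem_filter.mpr ⟨hd, h0⟩⟩
    obtain ⟨d, hd, hmax⟩ := Finset.exists_max_image _ φ hne'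
    obtain ⟨hd1, hd2⟩ := Finset.mem_filter.mp hd
    have := hmax (d.mapDomain e) (Finset.mem_filter.mpr ⟨hsupp d hd1, fun h => hd2 ?_⟩)
    · exact absurd (hφ d hd2) (not_lt.mpr this)
    · exact Finsupp.mapDomain_injective e.injective (h.trans Finsupp.mapDomain_zero.symm)
  ext d
  rw [coeff_C]
  split_ifs with h
  · rw [← h]; rfl
  · by_contra hd
    exact h (hzero d (mem_support_iff.mpr hd)).symm

/-- Reduces every identity of the canonical tau-structure to its image under `Λ - 1`, the
normalisation at zero taking care of the constant. -/
theorem eq_of_shift_sub_eq {f g : Poly} (h : shift f - f = shift g - g)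
    (h0 : constantCoeff f = constantCoeff g) : f = g := by
  have h1 : shift (f - g) = f - g := by
    rw [map_sub]; linear_combination h
  have h2 := eq_C_of_shift_eq h1
  rw [map_sub, h0, sub_self, map_zero] at h2
  exact sub_eq_zero.mp h2

/-- The `i`-th contribution `Coef(L^{p+1}, -i-1) Λ^{-i-1} Coef(L^{q+1}, i+1)` to the residue of
`L^{p+1} L^{q+1}`. -/
noncomputable def residueTerm (p q i : ℕ) : Poly :=
  lp (p + 1) (-(i + 1)) * (shift ^ (-((i : ℤ) + 1))) (lp (q + 1) (i + 1))

/-- The tau-structure in terms of coefficients of powers of the Lax operator. -/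
noncomputable def explicitTau : TauData where
  Ω p q := ∑ i ∈ Finset.range (q + 1), ∑ j ∈ Finset.range (i + 1), (shift ^ (j : ℤ)) (residueTerm p q i)
  S p := lp (p + 1) 0

theorem todaD_lp (q k : ℕ) (m : ℤ) :
    todaD q (lp k m) = (opS q * laxS ^ k - laxS ^ k * opS q) m := by
  rw [← opD_laxS_pow, opD_apply, ← lp_eq]; rfl

theorem opS_apply (k : ℕ) (m : ℤ) : opS k m = if 0 ≤ m then lp (k + 1) m else 0 := by
  rw [lp_eq]; exact SkewLaurent.plusHom_apply _ _

/-- The degree-zero coefficient of a product of two operators without negative part is `P 0 * Q 0`,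
and the coefficient ring is commutative. -/
theorem SkewLaurent.mul_comm_coeff_zero {P Q : SkewLaurent shift} (hP : P.IsPlus)
    (hQ : Q.IsPlus) : (P * Q - Q * P) 0 = 0 := by
  have h : ∀ {P Q : SkewLaurent shift}, P.IsPlus → Q.IsPlus → (P * Q) 0 = P 0 * Q 0 := by
    intro P Q hP hQ
    have e : (P * Q) 0 = _ := comp_apply_of_subset shift P Q 0
      (Finsupp.support (M := Poly) P ∪ {0}) (fun i hi => by
        simp only [Finset.mem_union, not_or] at hi; exact Finsupp.notMem_support_iff.mp hi.1)
    refine e.trans ((Finset.sum_eq_single 0 ?_ ?_).trans ?_)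
    · intro i _ hi
      rcases lt_or_gt_of_ne hi with h | h
      · exact (congrArg (· * _) (hP i h)).trans (zero_mul _)
      · have : Q (0 - i) = 0 := hQ _ (by omega)
        refine (congrArg (fun x => P i * (shift ^ i) x) this).trans (by simp)
    · intro h; simp at h
    · simp; rfl
  rw [sub_apply, h hP hQ, h hQ hP, mul_comm, sub_self]

/-- `D_q S_p = D_p S_q`. -/
theorem todaD_S_symm (p q : ℕ) : todaD q (lp (p + 1) 0) = todaD p (lp (q + 1) 0) := by
  have hc : laxS ^ (p + 1) * laxS ^ (q + 1) = laxS ^ (q + 1) * laxS ^ (p + 1) := by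
    rw [← pow_add, ← pow_add, add_comm]
  have hB : ∀ k, (laxS ^ (k + 1) - opS k).IsMinus := fun k => SkewLaurent.isMinus_sub_plusHom _
  have hA : ∀ k, (opS k).IsPlus := fun k => SkewLaurent.isPlus_plusHom _
  rw [todaD_lp, todaD_lp, ← sub_eq_zero, ← SkewLaurent.sub_apply]
  -- The splitting used for zero curvature, read here in degree zero: the commutator of the plus
  -- parts contributes nothing there, and products of minus parts have only negative degrees.
  have e : opS q * laxS ^ (p + 1) - laxS ^ (p + 1) * opS q -
      (opS p * laxS ^ (q + 1) - laxS ^ (q + 1) * opS p) =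
      -(opS p * opS q - opS q * opS p) +
        (laxS ^ (p + 1) - opS p) * (laxS ^ (q + 1) - opS q) -
        (laxS ^ (q + 1) - opS q) * (laxS ^ (p + 1) - opS p) := by
    have : opS p * opS q - opS q * opS p -
        (laxS ^ (p + 1) - opS p) * (laxS ^ (q + 1) - opS q) +
        (laxS ^ (q + 1) - opS q) * (laxS ^ (p + 1) - opS p) =
        opS p * laxS ^ (q + 1) - laxS ^ (q + 1) * opS p -
      (opS q * laxS ^ (p + 1) - laxS ^ (p + 1) * opS q) -
      (laxS ^ (p + 1) * laxS ^ (q + 1) - laxS ^ (q + 1) * laxS ^ (p + 1)) := by noncomm_ring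
    rw [hc, sub_self, sub_zero] at this
    rw [← neg_inj, neg_sub, ← this]; abel
  rw [e, SkewLaurent.sub_apply, SkewLaurent.add_apply, SkewLaurent.neg_apply,
    SkewLaurent.mul_comm_coeff_zero (hA p) (hA q), ((hB p).mul (hB q)) 0 le_rfl,
    ((hB q).mul (hB p)) 0 le_rfl]
  simp

theorem SkewLaurent.mul_apply_of_subset (P Q : SkewLaurent shift) (m : ℤ) (s : Finset ℤ)
    (hs : ∀ i ∉ s, P i = 0) : (P * Q) m = ∑ i ∈ s, P i * (shift ^ i) (Q (m - i)) := by
  exact comp_apply_of_subset shift P Q m s hs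

theorem SkewLaurent.mul_apply_of_subset_right (P Q : SkewLaurent shift) (m : ℤ) (s : Finset ℤ)
    (hs : ∀ i ∉ s, Q i = 0) : (P * Q) m = ∑ i ∈ s, P (m - i) * (shift ^ (m - i)) (Q i) := by
  exact comp_apply_of_subset_right shift P Q m s hs

theorem laxS_pow_apply (k : ℕ) (m : ℤ) : (laxS ^ k) m = lp k m := by
  rw [lp_eq]; rfl

/-- `D_q S_p` is the degree-zero coefficient of `[A_q, L^{p+1}]`. The degree `i+1` part of `A_q`
meets the degree `-(i+1)` part of `L^{p+1}` once on each side, and the two products are shifts of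
one another by `Λ^{i+1}`. This exhibits `D_q S_p` as an image of `Λ - 1`. -/
theorem todaD_S_eq_sum (p q : ℕ) : todaD q (lp (p + 1) 0) =
    ∑ i ∈ Finset.range (q + 1), ((shift ^ ((i : ℤ) + 1)) (residueTerm p q i) - residueTerm p q i) := by
  rw [todaD_lp, SkewLaurent.sub_apply]
  have hs : ∀ i ∉ (Finset.range (q + 2)).map (Nat.castEmbedding : ℕ ↪ ℤ), opS q i = 0 := by
    intro i hi
    rw [opS_apply]
    split_ifs with h
    · apply lp_apply_eq_zero
      lift i to ℕ using h
      simp only [Finset.mem_map, Finset.mem_range, Nat.castEmbedding_apply, Nat.cast_inj,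
        exists_eq_right] at hi
      rw [abs_of_nonneg (by positivity)]
      push_cast; omega
    · rfl
  rw [SkewLaurent.mul_apply_of_subset _ _ _ _ hs, SkewLaurent.mul_apply_of_subset_right _ _ _ _ hs,
    Finset.sum_map, Finset.sum_map, ← Finset.sum_sub_distrib, Finset.sum_range_succ']
  have hz : ∀ i : ℕ, (opS q : SkewLaurent shift) (i : ℤ) = lp (q + 1) i := fun i => by
    rw [opS_apply, if_pos (by positivity)]
  simp only [Nat.castEmbedding_apply, hz, laxS_pow_apply, residueTerm]
  -- The degree-zero part of `A_q` contributes a commutator of scalars, namely zero.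
  rw [add_eq_left.mpr (by simp [mul_comm])]
  refine Finset.sum_congr rfl fun i _ => ?_
  rw [map_mul, ← RingAut.mul_apply, ← zpow_add]
  push_cast
  rw [add_neg_cancel, zpow_zero, RingAut.one_apply, zero_sub]
  ring

/-- The inner sum in `explicitTau` is `(Λ^{i+1} - 1)/(Λ - 1)` applied to the residue term, so that
`Λ - 1` telescopes it. -/
theorem shift_sum_zpow_sub (i : ℕ) (x : Poly) :
    shift (∑ j ∈ Finset.range (i + 1), (shift ^ (j : ℤ)) x) -
      ∑ j ∈ Finset.range (i + 1), (shift ^ (j : ℤ)) x = (shift ^ ((i : ℤ) + 1)) x - x := by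
  have h := Finset.sum_range_sub (fun j : ℕ => (shift ^ (j : ℤ)) x) (i + 1)
  rw [map_sum, ← Finset.sum_sub_distrib]
  refine (Finset.sum_congr rfl fun j _ => ?_).trans (h.trans (by simp))
  rw [← RingAut.mul_apply, ← zpow_one_add, add_comm]
  push_cast
  rfl

theorem explicitTau_shift_Ω (p q : ℕ) :
    shift (explicitTau.Ω p q) - explicitTau.Ω p q = todaD q (explicitTau.S p) := by
  simp only [explicitTau]
  rw [todaD_S_eq_sum, map_sum, ← Finset.sum_sub_distrib]
  exact Finset.sum_congr rfl fun i _ => shift_sum_zpow_sub i _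

theorem explicitTau_Ω_zero (p q : ℕ) : constantCoeff (explicitTau.Ω p q) = 0 := by
  simp only [explicitTau, map_sum, constantCoeff_zpow_shift, residueTerm, map_mul, constantCoeff_lp]
  refine Finset.sum_eq_zero fun i _ => Finset.sum_eq_zero fun j _ => ?_
  rw [if_neg (by omega), zero_mul]

/-- Symmetry and closedness are checked after applying `Λ - 1`, where they become `D_q S_p = D_p
S_q` and the commutation of the flows. -/
theorem explicitTau_isCanonical : explicitTau.IsCanonical where
  symm p q := by
    refine eq_of_shift_sub_eq ?_ (by rw [explicitTau_Ω_zero, explicitTau_Ω_zero])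
    rw [explicitTau_shift_Ω, explicitTau_shift_Ω]
    exact todaD_S_symm p q
  deriv_Ω p q r := by
    refine eq_of_shift_sub_eq ?_ (by rw [constantCoeff_todaD, constantCoeff_todaD])
    rw [← todaD_shift, ← todaD_shift, ← map_sub, ← map_sub, explicitTau_shift_Ω,
      explicitTau_shift_Ω, todaD_comm]
  shift_Ω := explicitTau_shift_Ω
  shift_S p := by
    rw [todaD_wVar, laxBracket, Finsupp.sub_apply, lax_comp_apply, comp_lax_apply, opA_eq]
    have h0 : opS p 0 = lp (p + 1) 0 := by rw [opS_apply, if_pos le_rfl]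
    have h1 : opS p (-1) = 0 := by rw [opS_apply, if_neg (by omega)]
    have h2 : opS p (-2) = 0 := by rw [opS_apply, if_neg (by omega)]
    change _ = (shift ^ (0 : ℤ)) (opS p (-2) + opS p (-1) * _ + opS p 0 * _ -
      (shift (opS p (-2)) + _ * opS p (-1) + _ * shift⁻¹ (opS p 0)))
    rw [h0, h1, h2]
    simp [explicitTau]; ring
  Ω_zero := explicitTau_Ω_zero
  S_zero p := by
    simp only [explicitTau]
    rw [constantCoeff_lp, if_neg (by omega)]

/-- The factor `w_0` cancels because `𝒜` is a domain; what remains fixes `S_p` up to a constant. -/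
theorem TauData.IsCanonical.S_unique {T T' : TauData} (h : T.IsCanonical) (h' : T'.IsCanonical)
    (p : ℕ) : T.S p = T'.S p := by
  have e : wVar 0 * (T.S p - shift⁻¹ (T.S p)) = wVar 0 * (T'.S p - shift⁻¹ (T'.S p)) := by
    rw [h.shift_S, h'.shift_S]
  have e2 := mul_left_cancel₀ (MvPolynomial.X_ne_zero _) e
  refine eq_of_shift_sub_eq ?_ (by rw [h.S_zero, h'.S_zero])
  have e3 := congrArg shift e2
  rwa [map_sub, map_sub, ← RingAut.mul_apply, ← RingAut.mul_apply, mul_inv_cancel] at e3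

theorem TauData.IsCanonical.Ω_unique {T T' : TauData} (h : T.IsCanonical) (h' : T'.IsCanonical)
    (p q : ℕ) : T.Ω p q = T'.Ω p q := by
  refine eq_of_shift_sub_eq ?_ (by rw [h.Ω_zero, h'.Ω_zero])
  rw [h.shift_Ω, h'.shift_Ω, h.S_unique h']

theorem canonicalTau_isCanonical : canonicalTau.IsCanonical :=
  Classical.epsilon_spec (p := TauData.IsCanonical) ⟨_, explicitTau_isCanonical⟩

theorem canonicalTau_S (p : ℕ) : canonicalTau.S p = lp (p + 1) 0 :=
  canonicalTau_isCanonical.S_unique explicitTau_isCanonical p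

theorem canonicalTau_Ω (p q : ℕ) : canonicalTau.Ω p q =
    ∑ i ∈ Finset.range (q + 1), ∑ j ∈ Finset.range (i + 1), (shift ^ (j : ℤ)) (residueTerm p q i) :=
  canonicalTau_isCanonical.Ω_unique explicitTau_isCanonical p q

theorem corrPoly_cons (p : ℕ) {l : List ℕ} (hl : 2 ≤ l.length) :
    corrPoly (p :: l) = todaD p (corrPoly l) := by
  match l, hl with
  | _ :: _ :: _, _ => rfl

/-- Adjacent transpositions suffice: two flows commute, and near the end of the list the symmetry
and closedness of `Ω` apply. This symmetry later carries the theorem from one region of expansion to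
all others. -/
theorem corrPoly_perm {l l' : List ℕ} (h : l.Perm l') : corrPoly l = corrPoly l' := by
  induction h with
  | nil => rfl
  | @cons x l l' h ih =>
    by_cases hl : 2 ≤ l.length
    · rw [corrPoly_cons x hl, corrPoly_cons x (h.length_eq ▸ hl), ih]
    · match l, hl with
      | [], _ => rw [List.nil_perm.mp h]
      | [a], _ => rw [List.singleton_perm.mp h]
      | _ :: _ :: _, hl => simp at hl
  | swap x y l =>
    match l with
    | [] => exact canonicalTau_isCanonical.symm _ _
    | [z] =>
      change todaD y (canonicalTau.Ω x z) = todaD x (canonicalTau.Ω y z)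
      rw [canonicalTau_isCanonical.symm x z, canonicalTau_isCanonical.symm y z]
      exact canonicalTau_isCanonical.deriv_Ω z x y
    | _ :: _ :: _ => exact todaD_comm _ _ _
  | trans _ _ h1 h2 => exact h1.trans h2

end TauStructure

end Toda

namespace Toda

open DiffOp

/-! ### Evaluation on solutions -/

section Evaluation

variable {K : Type*} [CommRing K]

theorem evalAt_shift (v w : ℤ → TimeSeries K) (n : ℤ) (f : Poly) :
    evalAt v w n (shift f) = evalAt v w (n + 1) f := by
  induction f using MvPolynomial.induction_on with
  | C a => simp [shift, evalAt]
  | add f g hf hg => simp [hf, hg]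
  | mul_X f i hf =>
    rw [map_mul, map_mul, map_mul, hf]
    congr 1
    rcases i with i | i <;> simp [shift, evalAt, add_comm, add_left_comm]

theorem evalAt_zpow_shift (v w : ℤ → TimeSeries K) (n m : ℤ) (f : Poly) :
    evalAt v w n ((shift ^ m) f) = evalAt v w (n + m) f := by
  have hinv : ∀ n f, evalAt v w n (shift⁻¹ f) = evalAt v w (n - 1) f := fun n f => by
    have := evalAt_shift v w (n - 1) (shift⁻¹ f)
    rw [← RingAut.mul_apply, mul_inv_cancel, sub_add_cancel] at this
    exact this.symm
  induction m generalizing f with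
  | zero => simp
  | succ m ih => rw [zpow_add_one, RingAut.mul_apply, ih, evalAt_shift, add_assoc]
  | pred m ih => rw [zpow_sub_one, RingAut.mul_apply, ih, hinv, add_sub_assoc]

theorem pderiv_evalAt {v w : ℤ → TimeSeries K} (h : IsSolution v w) (k : ℕ) (n : ℤ) (f : Poly) :
    MvPowerSeries.pderiv K k (evalAt v w n f) = evalAt v w n (todaD k f) := by
  induction f using MvPolynomial.induction_on with
  | C a => simp [evalAt]
  | add f g hf hg => simp [hf, hg]
  | mul_X f i hf =>
    have hX : MvPowerSeries.pderiv K k (evalAt v w n (MvPolynomial.X i)) =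
        evalAt v w n (todaD k (MvPolynomial.X i)) := by
      rcases i with i | i
      · have h1 := (h k (n + i)).1
        rw [← evalAt_zpow_shift, ← zpow_apply_comm (todaD_shift k), shift_zpow_vVar,
          zero_add] at h1
        simpa [evalAt, vVar] using h1
      · have h1 := (h k (n + i)).2
        rw [← evalAt_zpow_shift, ← zpow_apply_comm (todaD_shift k), shift_zpow_wVar,
          zero_add] at h1
        simpa [evalAt, wVar] using h1
    rw [map_mul, Derivation.leibniz, Derivation.leibniz, hf, hX]
    simp

theorem laxPow_succ_apply (v w : ℤ → TimeSeries K) (k : ℕ) (m n : ℤ) :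
    laxPow v w (k + 1) m n = laxPow v w k (m - 1) (n + 1) + v n * laxPow v w k m n +
      w n * laxPow v w k (m + 1) (n - 1) := by
  unfold laxPow
  rw [lax_pow_succ_apply, Pi.add_apply, Pi.add_apply, Pi.mul_apply, Pi.mul_apply]
  rfl

theorem laxPow_zero_apply (v w : ℤ → TimeSeries K) (m n : ℤ) :
    laxPow v w 0 m n = if m = 0 then 1 else 0 :=
  (congrFun (pow_zero_apply (shiftFun (K := K)) (lax v w) m) n).trans (by split_ifs <;> rfl)

theorem laxPow_apply_eq_zero (v w : ℤ → TimeSeries K) (k : ℕ) (m n : ℤ) (hm : (k : ℤ) < |m|) :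
    laxPow v w k m n = 0 :=
  congrFun (lax_pow_apply_eq_zero (shiftFun (K := K)) v w k m hm) n

theorem evalAt_lp (v w : ℤ → TimeSeries K) (k : ℕ) (m n : ℤ) :
    evalAt v w n (lp k m) = laxPow v w k m n := by
  induction k generalizing m n with
  | zero =>
    rw [laxPow_zero_apply, lp, pow_zero_apply]
    split_ifs <;> simp
  | succ k ih =>
    have h := lax_pow_succ_apply shift (vVar 0) (wVar 0) k m
    change lp (k + 1) m =
      shift (lp k (m - 1)) + vVar 0 * lp k m + wVar 0 * (shift ^ (-1 : ℤ)) (lp k (m + 1)) at h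
    rw [h, laxPow_succ_apply, map_add, map_add, map_mul, map_mul, evalAt_shift, evalAt_zpow_shift,
      ih, ih, ih]
    simp [evalAt, vVar, wVar, sub_eq_add_neg]

/-- The entry `(n, n')` of the `k`-th power of the Lax matrix. -/
noncomputable def laxEntry (v w : ℤ → TimeSeries K) (k : ℕ) (n n' : ℤ) : TimeSeries K :=
  laxPow v w k (n' - n) n

theorem laxEntry_succ (v w : ℤ → TimeSeries K) (k : ℕ) (n n' : ℤ) :
    laxEntry v w (k + 1) n n' = laxEntry v w k (n + 1) n' + v n * laxEntry v w k n n' +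
      w n * laxEntry v w k (n - 1) n' := by
  rw [laxEntry, laxPow_succ_apply, laxEntry, laxEntry, laxEntry,
    show n' - (n + 1) = n' - n - 1 by ring, show n' - (n - 1) = n' - n + 1 by ring]

theorem laxEntry_zero (v w : ℤ → TimeSeries K) (n n' : ℤ) :
    laxEntry v w 0 n n' = if n = n' then 1 else 0 := by
  rw [laxEntry, laxPow_zero_apply]
  exact if_congr (by omega) rfl rfl

theorem laxEntry_eq_zero (v w : ℤ → TimeSeries K) (k : ℕ) (n n' : ℤ) (h : (k : ℤ) < |n' - n|) :
    laxEntry v w k n n' = 0 := laxPow_apply_eq_zero v w k _ n h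

theorem evalAt_S (v w : ℤ → TimeSeries K) (p : ℕ) (n : ℤ) :
    evalAt v w n (canonicalTau.S p) = laxEntry v w (p + 1) n n := by
  rw [canonicalTau_S, evalAt_lp, laxEntry, sub_self]

theorem evalAt_Ω (v w : ℤ → TimeSeries K) (p q : ℕ) (n : ℤ) :
    evalAt v w n (canonicalTau.Ω p q) =
      ∑ i ∈ Finset.range (q + 1), ∑ j ∈ Finset.range (i + 1),
        laxEntry v w (p + 1) (n + j) (n + j - (i + 1)) *
          laxEntry v w (q + 1) (n + j - (i + 1)) (n + j) := by
  rw [canonicalTau_Ω, map_sum]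
  refine Finset.sum_congr rfl fun i _ => ?_
  rw [map_sum]
  refine Finset.sum_congr rfl fun j _ => ?_
  rw [evalAt_zpow_shift, residueTerm, map_mul, evalAt_zpow_shift, evalAt_lp, evalAt_lp, laxEntry,
    laxEntry, show n + (j : ℤ) - (i + 1) - (n + j) = -(i + 1) by ring,
    show n + (j : ℤ) - (n + j - (i + 1)) = i + 1 by ring,
    show n + (j : ℤ) + -(i + 1) = n + j - (i + 1) by ring]

/-- Setting `s = i - j`, the row `n + j` runs over the sites `≥ n` and the column `n - (s+1)` over
the sites `< n`. Powers of `L` are banded, so any square box with side at least `p + 1` contains all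
nonzero terms. -/
theorem evalAt_Ω_eq_box (v w : ℤ → TimeSeries K) (p q M : ℕ) (hM : p + 1 ≤ M) (n : ℤ) :
    evalAt v w n (canonicalTau.Ω p q) =
      ∑ s ∈ Finset.range M, ∑ j ∈ Finset.range M,
        laxEntry v w (p + 1) (n + j) (n - (s + 1)) * laxEntry v w (q + 1) (n - (s + 1)) (n + j) := by
  rw [evalAt_Ω]
  set H : ℕ → ℕ → TimeSeries K := fun s j =>
    laxEntry v w (p + 1) (n + j) (n - (s + 1)) * laxEntry v w (q + 1) (n - (s + 1)) (n + j) with hH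
  have hp : ∀ s j, p + 1 ≤ s + j → H s j = 0 := fun s j h => by
    simp only [hH]
    rw [laxEntry_eq_zero v w (p + 1), zero_mul]
    rw [lt_abs]; right; push_cast; omega
  have hq : ∀ s j, q + 1 ≤ s + j → H s j = 0 := fun s j h => by
    simp only [hH]
    rw [laxEntry_eq_zero v w (q + 1), mul_zero]
    rw [lt_abs]; left; push_cast; omega
  have h1 : ∀ i j : ℕ, j ∈ Finset.range (i + 1) → laxEntry v w (p + 1) (n + j) (n + j - (i + 1)) *
      laxEntry v w (q + 1) (n + j - (i + 1)) (n + j) = H (i - j) j := fun i j hj => by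
    have hj := Finset.mem_range.mp hj
    have e : n + (j : ℤ) - (i + 1) = n - (((i - j : ℕ) : ℤ) + 1) := by
      rw [Nat.cast_sub (by omega)]; ring
    rw [e]
  rw [Finset.sum_congr rfl fun i _ => Finset.sum_congr rfl (h1 i)]
  have h2 : ∀ N, q + 1 ≤ N → ∑ i ∈ Finset.range (q + 1), ∑ j ∈ Finset.range (i + 1), H (i - j) j =
      ∑ i ∈ Finset.range N, ∑ j ∈ Finset.range (i + 1), H (i - j) j := fun N hN => by
    refine Finset.sum_subset (by simpa using hN) fun i _ hi => Finset.sum_eq_zero fun j hj => ?_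
    simp only [Finset.mem_range] at hi hj
    exact hq _ _ (by omega)
  have h3 : ∀ i, ∑ j ∈ Finset.range (i + 1), H (i - j) j =
      ∑ x ∈ Finset.HasAntidiagonal.antidiagonal i, H x.2 x.1 := fun i => by
    rw [Finset.Nat.sum_antidiagonal_eq_sum_range_succ_mk]
  -- The outer range is enlarged beyond `2M` so that every antidiagonal meeting the box occurs; the
  -- extra terms vanish.
  rw [h2 (q + 1 + 2 * M) (by omega), Finset.sum_congr rfl fun i _ => h3 i,
    Finset.sum_sigma', ← Finset.sum_product']
  refine Finset.sum_bij_ne_zero (fun x _ _ => (x.2.2, x.2.1)) ?_ ?_ ?_ ?_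
  · rintro ⟨i, a, b⟩ hx h0
    simp only [Finset.mem_sigma, Finset.mem_range, Finset.HasAntidiagonal.mem_antidiagonal] at hx
    by_contra hc
    apply h0
    refine hp _ _ ?_
    simp only [Finset.mem_product, Finset.mem_range] at hc
    change p + 1 ≤ b + a
    omega
  · rintro ⟨i, a, b⟩ hx _ ⟨i', a', b'⟩ hx' _ h
    simp only [Finset.mem_sigma, Finset.HasAntidiagonal.mem_antidiagonal, Prod.mk.injEq] at hx hx' h
    obtain ⟨rfl, rfl⟩ := h
    obtain rfl : i = i' := by omega
    rfl
  · rintro ⟨s, j⟩ hx h0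
    simp only [Finset.mem_product, Finset.mem_range] at hx
    refine ⟨⟨j + s, j, s⟩, ?_, h0, rfl⟩
    simp only [Finset.mem_sigma, Finset.mem_range, Finset.HasAntidiagonal.mem_antidiagonal, and_true]
    omega
  · rintro ⟨i, a, b⟩ _ _
    rfl

end Evaluation

end Toda

namespace Toda

open DiffOp

/-! ### The Green function of the Lax operator -/

section Green

variable {K : Type*} [CommRing K]

/-- The coefficient of `λ^{-m}`. -/
noncomputable def lamCoeff (m : ℤ) : WaveRing K →+ TimeSeries K where
  toFun x := fun α => (MvPowerSeries.coeff α x).coeff m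
  map_zero' := rfl
  map_add' _ _ := rfl

theorem coeff_lamCoeff (m : ℤ) (x : WaveRing K) (α : ℕ →₀ ℕ) :
    MvPowerSeries.coeff α (lamCoeff m x) = (MvPowerSeries.coeff α x).coeff m := rfl

theorem lamCoeff_ofTime_mul (m : ℤ) (a : TimeSeries K) (x : WaveRing K) :
    lamCoeff m (ofTime a * x) = a * lamCoeff m x := by
  ext α
  rw [coeff_lamCoeff, MvPowerSeries.coeff_mul, MvPowerSeries.coeff_mul, HahnSeries.coeff_sum]
  refine Finset.sum_congr rfl fun p _ => ?_
  rw [coeff_lamCoeff, ofTime, MvPowerSeries.coeff_map, HahnSeries.C_mul_eq_smul,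
    HahnSeries.coeff_smul, smul_eq_mul]

theorem lamCoeff_lamPow_mul (m j : ℤ) (x : WaveRing K) :
    lamCoeff m (lamPow j * x) = lamCoeff (m + j) x := by
  ext α
  rw [coeff_lamCoeff, coeff_lamCoeff, lamPow, MvPowerSeries.coeff_C_mul,
    HahnSeries.coeff_single_mul, one_mul, sub_neg_eq_add]

theorem lamCoeff_one (m : ℤ) : lamCoeff m (1 : WaveRing K) = if m = 0 then 1 else 0 := by
  ext α
  rw [coeff_lamCoeff, MvPowerSeries.coeff_one]
  by_cases hα : α = 0
  · rw [if_pos hα, HahnSeries.coeff_one]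
    split_ifs <;> simp [hα]
  · rw [if_neg hα]
    split_ifs <;> simp [MvPowerSeries.coeff_one, hα]

theorem lamPow_mul_lamPow (i j : ℤ) : (lamPow i * lamPow j : WaveRing K) = lamPow (i + j) := by
  rw [lamPow, lamPow, lamPow, ← map_mul, HahnSeries.single_mul_single, one_mul, neg_add]

theorem lamPow_zero : (lamPow 0 : WaveRing K) = 1 := by
  rw [lamPow, neg_zero, HahnSeries.single_zero_one, map_one]

theorem lamCoeff_ofTimeLam (m : ℤ) (hm : m < 0) (φ : MvPowerSeries ℕ (PowerSeries K)) :
    lamCoeff m (ofTimeLam φ) = 0 := by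
  ext α
  rw [coeff_lamCoeff, ofTimeLam, MvPowerSeries.coeff_map, map_zero]
  exact HahnSeries.embDomain_of_notMem_range (by rintro ⟨n, rfl⟩; simp at hm; omega)

theorem act_lax_apply (v w : ℤ → TimeSeries K) (ψ : ℤ → WaveRing K) (n : ℤ) :
    act (lax v w) ψ n = ψ (n + 1) + ofTime (v n) * ψ n + ofTime (w n) * ψ (n - 1) := by
  simp only [act, lax]
  rw [Finsupp.sum_add_index' (by simp) (by intros; simp [add_mul]),
    Finsupp.sum_add_index' (by simp) (by intros; simp [add_mul])]
  simp [sub_eq_add_neg]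

/-! ### Products of wave functions and the resolvent. -/

section Exp

variable [Algebra ℚ K]

theorem natCast_mul_cancel {R : Type*} [CommRing R] [Algebra ℚ R] {m : ℕ} (hm : m ≠ 0) {a b : R}
    (h : (m : R) * a = m * b) : a = b := by
  have hu : IsUnit (m : R) := by
    have h1 : IsUnit (m : ℚ) := IsUnit.mk0 _ (by exact_mod_cast hm)
    simpa using h1.map (algebraMap ℚ R)
  exact hu.mul_left_cancel h

theorem isAddTorsionFree_of_rat {R : Type*} [CommRing R] [Algebra ℚ R] : IsAddTorsionFree R where
  nsmul_right_injective m hm a b h := by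
    simp only [nsmul_eq_mul] at h
    exact natCast_mul_cancel hm h

theorem pderiv_expTime (s : ℚ) (k : ℕ) :
    MvPowerSeries.pderiv (LaurentSeries K) k (expTime s : WaveRing K) =
      MvPowerSeries.C (HahnSeries.C (algebraMap ℚ K s)) * lamPow (k + 1) * expTime s := by
  ext1 α
  have hc : ∀ α, MvPowerSeries.coeff α (expTime s : WaveRing K) =
    HahnSeries.single (-(α.sum fun k a => ((k : ℤ) + 1) * (a : ℤ)))
      (algebraMap ℚ K (α.prod fun _ a => s ^ a / (a.factorial : ℚ))) := fun _ => rfl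
  rw [MvPowerSeries.coeff_pderiv, lamPow, ← map_mul, MvPowerSeries.coeff_C_mul, hc, hc]
  have h1 : ((α + Finsupp.single k 1).sum fun k a => ((k : ℤ) + 1) * (a : ℤ)) =
      (α.sum fun k a => ((k : ℤ) + 1) * (a : ℤ)) + (k + 1) := by
    rw [Finsupp.sum_add_index' (by simp) (by intros; push_cast; ring)]
    simp
  have h2 : ((α + Finsupp.single k 1).prod fun _ a => s ^ a / (a.factorial : ℚ)) * (α k + 1) =
      s * (α.prod fun _ a => s ^ a / (a.factorial : ℚ)) := by
    have e1 := Finsupp.mul_prod_erase' (α + Finsupp.single k 1) k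
      (fun _ a => s ^ a / (a.factorial : ℚ)) (by simp)
    have e2 := Finsupp.mul_prod_erase' α k (fun _ a => s ^ a / (a.factorial : ℚ)) (by simp)
    have e3 : (α + Finsupp.single k 1).erase k = α.erase k := by
      rw [Finsupp.erase_add, Finsupp.erase_single, add_zero]
    rw [← e1, ← e2, e3]
    simp only [Finsupp.add_apply, Finsupp.single_eq_same, Nat.factorial_succ, pow_succ]
    have : ((α k).factorial : ℚ) ≠ 0 := by exact_mod_cast Nat.factorial_ne_zero _
    push_cast
    field_simp
  rw [h1]
  have h4 : ((α k : LaurentSeries K) + 1) = HahnSeries.C ((α k : K) + 1) := by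
    rw [map_add, map_natCast, map_one]
  rw [h4, HahnSeries.C_apply, HahnSeries.C_apply, HahnSeries.single_mul_single, HahnSeries.single_mul_single,
    HahnSeries.single_mul_single]
  congr 1
  · ring_nf
  · rw [mul_one, ← map_mul, ← h2]; simp

/-- Over `ℚ` a series is determined by its constant term and its first derivatives. The derivatives
of the product cancel by the Leibniz rule. -/
theorem expTime_mul_expTime_neg : (expTime 1 * expTime (-1) : WaveRing K) = 1 := by
  have : IsAddTorsionFree (LaurentSeries K) := isAddTorsionFree_of_rat
  refine MvPowerSeries.pderiv.ext (fun k => ?_) ?_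
  · rw [Derivation.leibniz, pderiv_expTime, pderiv_expTime, smul_eq_mul, smul_eq_mul,
      Derivation.map_one_eq_zero]
    simp only [map_neg, map_one]
    ring
  · rw [map_mul, map_one]
    have hc : ∀ s, MvPowerSeries.constantCoeff (expTime s : WaveRing K) = 1 := fun s => by
      have : MvPowerSeries.constantCoeff (expTime s : WaveRing K) =
        HahnSeries.single (-((0 : ℕ →₀ ℕ).sum fun k a => ((k : ℤ) + 1) * (a : ℤ)))
        (algebraMap ℚ K ((0 : ℕ →₀ ℕ).prod fun _ a => s ^ a / (a.factorial : ℚ))) := rfl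
      rw [this]; simp
    rw [hc, hc, one_mul]

variable {v w : ℤ → TimeSeries K} {E : ℤ → (TimeSeries K)ˣ} {ψA ψB : ℤ → WaveRing K}

/-- The product `ψ_A(λ, n) ψ_B(λ, n')` is `λ^{n-n'}` times a series in `λ^{-1}`. -/
theorem exists_waveA_mul_waveB (hA : IsWaveA v w ψA) (hB : IsWaveB v w E ψB) (n n' : ℤ) :
    ∃ χ : MvPowerSeries ℕ (PowerSeries K), ∃ a : TimeSeries K,
      ψA n * ψB n' = lamPow (n - n') * (ofTime a * ofTimeLam χ) := by
  obtain ⟨φ, -, hφ⟩ := hA.form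
  obtain ⟨φ', -, hφ'⟩ := hB.form
  refine ⟨φ n * φ' n', ((E n')⁻¹ : (TimeSeries K)ˣ), ?_⟩
  rw [hφ, hφ', sub_eq_add_neg, ← lamPow_mul_lamPow, map_mul]
  linear_combination (ofTimeLam (φ n) * lamPow n * (ofTimeLam (φ' n') *
    ofTime ((E n')⁻¹ : (TimeSeries K)ˣ) * lamPow (-n'))) * expTime_mul_expTime_neg (K := K)

/-- The exponentials cancel in the product, leaving `λ^{n-n'}` times a series in `λ^{-1}`. All
estimates of telescoping remainders come from this bound. -/
theorem lamCoeff_waveA_mul_waveB (hA : IsWaveA v w ψA) (hB : IsWaveB v w E ψB) (n n' m : ℤ)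
    (hm : m < n' - n) : lamCoeff m (ψA n * ψB n') = 0 := by
  obtain ⟨χ, a, h⟩ := exists_waveA_mul_waveB hA hB n n'
  rw [h, lamCoeff_lamPow_mul, lamCoeff_ofTime_mul, lamCoeff_ofTimeLam _ (by omega), mul_zero]

/-- The Green function `(λ - L)^{-1}` of the Lax operator. -/
noncomputable def green (E : ℤ → (TimeSeries K)ˣ) (ψA ψB : ℤ → WaveRing K) (n n' : ℤ) :
    WaveRing K :=
  lamPow (-1) * (ofTime (E n') * if n ≤ n' then ψA n * ψB n' else ψA n' * ψB n)

/-- Off the diagonal `L` acts on an eigenfunction, `ψ_A` for `n < n'` and `ψ_B` for `n > n'`. On the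
diagonal the recurrence of `ψ_A` asks for `ψ_A(n+1) ψ_B(n)` where the Green function has `ψ_A(n)
ψ_B(n+1)`; the defect is `d(λ, n+1)`, which the pair condition normalises to yield 1. -/
theorem lamPow_mul_green (hA : IsWaveA v w ψA) (hB : IsWaveB v w E ψB) (hP : IsPair E ψA ψB)
    (n n' : ℤ) : lamPow 1 * green E ψA ψB n n' = green E ψA ψB (n + 1) n' +
      ofTime (v n) * green E ψA ψB n n' + ofTime (w n) * green E ψA ψB (n - 1) n' +
      if n = n' then 1 else 0 := by
  have hsA := hA.spectral n
  have hsB := hB.spectral n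
  rw [act_lax_apply] at hsA hsB
  have hl : (lamPow (-1) * lamPow 1 : WaveRing K) = 1 := by
    rw [lamPow_mul_lamPow, neg_add_cancel, lamPow_zero]
  simp only [green]
  rcases lt_trichotomy n n' with h | h | h
  · rw [if_pos (by omega), if_pos (by omega), if_pos (by omega), if_neg (by omega)]
    linear_combination -(lamPow (-1) * ofTime (E n' : TimeSeries K) * ψB n') * hsA
  · subst h
    have hp := hP (n + 1)
    rw [add_sub_cancel_right] at hp
    rw [if_pos le_rfl, if_neg (by omega), if_pos (by omega), if_pos rfl]
    linear_combination -(lamPow (-1) * ofTime (E n : TimeSeries K) * ψB n) * hsA +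
      lamPow (-1) * hp + hl
  · by_cases h1 : n - 1 = n'
    · subst h1
      rw [if_neg (by omega), if_neg (by omega), if_pos le_rfl, if_neg (by omega)]
      linear_combination -(lamPow (-1) * ofTime (E (n - 1) : TimeSeries K) * ψA (n - 1)) * hsB
    · rw [if_neg (by omega), if_neg (by omega), if_neg (by omega), if_neg (by omega)]
      linear_combination -(lamPow (-1) * ofTime (E n' : TimeSeries K) * ψA n') * hsB

theorem lamCoeff_green_eq_zero (hA : IsWaveA v w ψA) (hB : IsWaveB v w E ψB)
    (n n' m : ℤ) (hm : m ≤ 0) : lamCoeff m (green E ψA ψB n n') = 0 := by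
  rw [green, lamCoeff_lamPow_mul, lamCoeff_ofTime_mul]
  split_ifs with h
  · rw [lamCoeff_waveA_mul_waveB hA hB _ _ _ (by omega), mul_zero]
  · rw [lamCoeff_waveA_mul_waveB hA hB _ _ _ (by omega), mul_zero]

/-- The Green function generates the entries of the powers of the Lax matrix. -/
theorem lamCoeff_green (hA : IsWaveA v w ψA) (hB : IsWaveB v w E ψB) (hP : IsPair E ψA ψB)
    (j : ℕ) (n n' : ℤ) : lamCoeff (j + 1) (green E ψA ψB n n') = laxEntry v w j n n' := by
  induction j generalizing n with
  | zero =>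
    have h := congrArg (lamCoeff 0) (lamPow_mul_green hA hB hP n n')
    rw [lamCoeff_lamPow_mul, map_add, map_add, map_add, lamCoeff_ofTime_mul, lamCoeff_ofTime_mul,
      lamCoeff_green_eq_zero hA hB _ _ _ le_rfl, lamCoeff_green_eq_zero hA hB _ _ _ le_rfl,
      lamCoeff_green_eq_zero hA hB _ _ _ le_rfl] at h
    rw [laxEntry_zero, Nat.cast_zero, h]
    split_ifs <;> simp [lamCoeff_one]
  | succ j ih =>
    have h := congrArg (lamCoeff (j + 1)) (lamPow_mul_green hA hB hP n n')
    rw [lamCoeff_lamPow_mul, map_add, map_add, map_add, lamCoeff_ofTime_mul, lamCoeff_ofTime_mul,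
      ih, ih, ih] at h
    rw [laxEntry_succ, Nat.cast_succ, h]
    have : lamCoeff (j + 1) (if n = n' then (1 : WaveRing K) else 0) = 0 := by
      split_ifs
      · rw [lamCoeff_one, if_neg (by omega)]
      · simp
    rw [this, add_zero]

end Exp

end Green

end Toda

namespace Toda

/-! ### Expansion in the first spectral parameter -/

section Front

variable {K : Type*} [CommRing K] {k : ℕ}

/-- Prepend an exponent. -/
def consExp (m : ℤ) (s : Lex (Fin k → ℤ)) : Lex (Fin (k + 1) → ℤ) :=
  toLex (Fin.cons m (ofLex s))

theorem consExp_lt_of_lt {m m' : ℤ} (h : m < m') (s s' : Lex (Fin k → ℤ)) :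
    consExp m s < consExp m' s' :=
  ⟨0, fun i hi => absurd hi (Fin.not_lt_zero i), h⟩

theorem consExp_strictMono (m : ℤ) : StrictMono (consExp m (k := k)) := by
  rintro s t ⟨i, hi, h⟩
  refine ⟨i.succ, fun j hj => ?_, h⟩
  induction j using Fin.cases with
  | zero => rfl
  | succ j => exact hi j (Fin.succ_lt_succ_iff.mp hj)

theorem consExp_add (m m' : ℤ) (s s' : Lex (Fin k → ℤ)) :
    consExp m s + consExp m' s' = consExp (m + m') (s + s') := by
  apply ofLex.injective
  funext i
  induction i using Fin.cases <;> rfl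

theorem exists_consExp_eq (g : Lex (Fin (k + 1) → ℤ)) : ∃ m s, consExp m s = g :=
  ⟨ofLex g 0, toLex (Fin.tail (ofLex g)), by
    apply ofLex.injective; exact Fin.cons_self_tail (ofLex g)⟩

theorem consExp_inj {m m' : ℤ} {s s' : Lex (Fin k → ℤ)} :
    consExp m s = consExp m' s' ↔ m = m' ∧ s = s' := by
  constructor
  · intro h
    have h' : (Fin.cons m (ofLex s) : Fin (k + 1) → ℤ) = Fin.cons m' (ofLex s') :=
      congrArg ofLex h
    exact ⟨(Fin.cons_inj.mp h').1, ofLex.injective (Fin.cons_inj.mp h').2⟩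
  · rintro ⟨rfl, rfl⟩; rfl

/-- The inclusion of exponents not involving the first spectral parameter. -/
def tailExp : Lex (Fin k → ℤ) →+ Lex (Fin (k + 1) → ℤ) where
  toFun := consExp 0
  map_zero' := by
    apply ofLex.injective; funext i; induction i using Fin.cases <;> rfl
  map_add' s t := by rw [consExp_add, add_zero]

theorem tailExp_strictMono : StrictMono (tailExp (k := k)) := consExp_strictMono 0

/-- The inclusion of series not involving the first spectral parameter. -/
noncomputable def tailHom : MultiLaurent K k →+* MultiLaurent K (k + 1) :=
  HahnSeries.embDomainRingHom tailExp tailExp_strictMono.injective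
    fun _ _ => tailExp_strictMono.le_iff_le

theorem tailHom_coeff (x : MultiLaurent K k) (m : ℤ) (s : Lex (Fin k → ℤ)) :
    (tailHom x).coeff (consExp m s) = if m = 0 then x.coeff s else 0 := by
  split_ifs with h
  · subst h
    exact HahnSeries.embDomain_coeff (f := ⟨⟨tailExp, tailExp_strictMono.injective⟩,
      tailExp_strictMono.le_iff_le⟩)
  · refine HahnSeries.embDomain_of_notMem_range ?_
    rintro ⟨t, ht⟩
    exact h (consExp_inj.mp ht).1.symm

/-- The coefficient of `λ_0^{-m}`. -/
noncomputable def front (m : ℤ) : MultiLaurent K (k + 1) →+ MultiLaurent K k where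
  toFun x :=
    { coeff := fun s => x.coeff (consExp m s)
      isPWO_support' := by
        intro f
        obtain ⟨i, j, hij, h⟩ := x.isPWO_support fun n => ⟨consExp m (f n), (f n).2⟩
        exact ⟨i, j, hij, (consExp_strictMono m).le_iff_le.mp h⟩ }
  map_zero' := rfl
  map_add' _ _ := rfl

theorem front_coeff (m : ℤ) (x : MultiLaurent K (k + 1)) (s : Lex (Fin k → ℤ)) :
    (front m x).coeff s = x.coeff (consExp m s) := rfl

theorem front_tailHom_mul (m : ℤ) (g : MultiLaurent K k) (x : MultiLaurent K (k + 1)) :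
    front m (tailHom g * x) = g * front m x := by
  ext s
  rw [front_coeff, HahnSeries.coeff_mul, HahnSeries.coeff_mul]
  symm
  refine Finset.sum_nbij (fun p => (consExp 0 p.1, consExp m p.2)) ?_ ?_ ?_ ?_
  · rintro ⟨a, b⟩ h
    rw [Finset.mem_antidiagonal] at h ⊢
    obtain ⟨h1, h2, h3⟩ := h
    refine ⟨?_, h2, ?_⟩
    · rw [HahnSeries.mem_support, tailHom_coeff, if_pos rfl]; exact h1
    · rw [consExp_add, zero_add]; exact congrArg _ h3
  · rintro ⟨a, b⟩ _ ⟨a', b'⟩ _ h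
    simp only [Prod.mk.injEq, consExp_inj, true_and] at h
    exact Prod.ext h.1 h.2
  · rintro ⟨a', b'⟩ h
    rw [Finset.mem_coe, Finset.mem_antidiagonal] at h
    obtain ⟨h1, h2, h3⟩ := h
    obtain ⟨i, a, rfl⟩ := exists_consExp_eq a'
    obtain ⟨j, b, rfl⟩ := exists_consExp_eq b'
    simp only at h1 h2 h3
    rw [HahnSeries.mem_support, tailHom_coeff] at h1
    have hi : i = 0 := by by_contra hc; exact h1 (if_neg hc)
    subst hi
    rw [if_pos rfl] at h1
    rw [consExp_add, zero_add, consExp_inj] at h3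
    obtain ⟨rfl, h3⟩ := h3
    exact ⟨(a, b), by
      rw [Finset.mem_coe, Finset.mem_antidiagonal]; exact ⟨h1, h2, h3⟩, rfl⟩
  · rintro ⟨a, b⟩ _
    simp only [tailHom_coeff, if_true, front_coeff]

theorem front_single_mul (m j : ℤ) (x : MultiLaurent K (k + 1)) :
    front m (HahnSeries.single (consExp j 0) 1 * x) = front (m - j) x := by
  ext s
  rw [front_coeff, front_coeff, HahnSeries.coeff_single_mul, one_mul]
  congr 1
  rw [sub_eq_iff_eq_add, consExp_add]
  simp

/-- In the lexicographic order the first exponent is a monotone function, so its values on a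
well-ordered support are bounded below. -/
theorem exists_front_eq_zero (x : MultiLaurent K (k + 1)) : ∃ N : ℤ, ∀ m < N, front m x = 0 := by
  have hmono : Monotone fun g : Lex (Fin (k + 1) → ℤ) => ofLex g 0 := by
    intro g g' h
    obtain ⟨m, s, rfl⟩ := exists_consExp_eq g
    obtain ⟨m', s', rfl⟩ := exists_consExp_eq g'
    change m ≤ m'
    by_contra hc
    exact absurd (consExp_lt_of_lt (not_le.mp hc) s' s) (not_lt.mpr h)
  have hw := (x.isPWO_support.image_of_monotone hmono).isWF
  by_cases hne : x.support.Nonempty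
  · refine ⟨hw.min (hne.image _), fun m hm => ?_⟩
    ext s
    by_contra hs
    exact hw.not_lt_min (hne.image _) ⟨consExp m s, hs, rfl⟩ hm
  · refine ⟨0, fun m _ => ?_⟩
    rw [HahnSeries.support_nonempty_iff, not_not] at hne
    rw [hne, map_zero]

/-! The same over the power series in the times. -/

/-- The inclusion of series not involving the first spectral parameter. -/
noncomputable def tailMap : MultiRing K k →+* MultiRing K (k + 1) := MvPowerSeries.map tailHom

/-- The coefficient of `λ_0^{-m}`. -/
noncomputable def frontCoeff (m : ℤ) : MultiRing K (k + 1) →+ MultiRing K k where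
  toFun x := fun α => front m (MvPowerSeries.coeff α x)
  map_zero' := by funext α; exact map_zero _
  map_add' x y := by funext α; exact map_add (front m) _ _

theorem coeff_frontCoeff (m : ℤ) (x : MultiRing K (k + 1)) (α : ℕ →₀ ℕ) :
    MvPowerSeries.coeff α (frontCoeff m x) = front m (MvPowerSeries.coeff α x) := rfl

theorem frontCoeff_ext {x y : MultiRing K (k + 1)} (h : ∀ m, frontCoeff m x = frontCoeff m y) :
    x = y := by
  ext α g
  obtain ⟨m, s, rfl⟩ := exists_consExp_eq g
  have h1 := congrArg (fun z => (MvPowerSeries.coeff α z).coeff s) (h m)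
  exact h1

theorem frontCoeff_tailMap_mul (m : ℤ) (g : MultiRing K k) (x : MultiRing K (k + 1)) :
    frontCoeff m (tailMap g * x) = g * frontCoeff m x := by
  ext1 α
  rw [coeff_frontCoeff, MvPowerSeries.coeff_mul, MvPowerSeries.coeff_mul, map_sum]
  refine Finset.sum_congr rfl fun p _ => ?_
  rw [tailMap, MvPowerSeries.coeff_map, front_tailHom_mul, coeff_frontCoeff]

theorem slot_one_zero (m : ℤ) :
    slot (1 : Equiv.Perm (Fin (k + 1))) 0 m = consExp m 0 := by
  apply ofLex.injective
  funext i
  induction i using Fin.cases with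
  | zero =>
    change (Pi.single 0 m : Fin (k + 1) → ℤ) 0 = m
    simp
  | succ i =>
    change (Pi.single 0 m : Fin (k + 1) → ℤ) i.succ = 0
    simp

theorem slot_one_succ (j : Fin k) (m : ℤ) :
    slot (1 : Equiv.Perm (Fin (k + 1))) j.succ m = tailExp (slot 1 j m) := by
  apply ofLex.injective
  funext i
  induction i using Fin.cases with
  | zero =>
    change (Pi.single j.succ m : Fin (k + 1) → ℤ) 0 = 0
    simp
  | succ i =>
    change (Pi.single j.succ m : Fin (k + 1) → ℤ) i.succ = (Pi.single j m : Fin k → ℤ) i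
    simp [Pi.single_apply]

theorem atSlot_ofTime (ρ : Equiv.Perm (Fin k)) (j : Fin k) (a : TimeSeries K) :
    atSlot ρ j (ofTime a) = ofTimeMulti a := by
  ext1 α
  rw [atSlot, ofTime, ofTimeMulti, MvPowerSeries.coeff_map, MvPowerSeries.coeff_map,
    MvPowerSeries.coeff_map, HahnSeries.embDomainRingHom_C]

theorem atSlot_lamPow (ρ : Equiv.Perm (Fin k)) (j : Fin k) (m : ℤ) :
    atSlot ρ j (lamPow m : WaveRing K) = MvPowerSeries.C (lamAt ρ j m) := by
  rw [atSlot, lamPow, MvPowerSeries.map_C, HahnSeries.embDomainRingHom_apply,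
    HahnSeries.embDomain_single]
  rfl

theorem tailMap_ofTimeMulti (a : TimeSeries K) :
    tailMap (ofTimeMulti a : MultiRing K k) = ofTimeMulti a := by
  ext1 α
  rw [tailMap, ofTimeMulti, ofTimeMulti, MvPowerSeries.coeff_map,
    MvPowerSeries.coeff_map, MvPowerSeries.coeff_map, tailHom, HahnSeries.embDomainRingHom_C]

theorem HahnSeries.embDomain_embDomain {Γ Γ' Γ'' R : Type*} [PartialOrder Γ] [PartialOrder Γ']
    [PartialOrder Γ''] [Zero R] (f : Γ ↪o Γ') (g : Γ' ↪o Γ'') (x : HahnSeries Γ R) :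
    HahnSeries.embDomain g (HahnSeries.embDomain f x) = HahnSeries.embDomain (f.trans g) x := by
  ext a
  by_cases ha : a ∈ Set.range (f.trans g)
  · obtain ⟨b, rfl⟩ := ha
    rw [HahnSeries.embDomain_coeff]
    exact HahnSeries.embDomain_coeff.trans HahnSeries.embDomain_coeff
  · rw [HahnSeries.embDomain_of_notMem_range ha]
    by_cases hb : a ∈ Set.range g
    · obtain ⟨b, rfl⟩ := hb
      rw [HahnSeries.embDomain_coeff]
      refine HahnSeries.embDomain_of_notMem_range ?_
      rintro ⟨c, rfl⟩
      exact ha ⟨c, rfl⟩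
    · exact HahnSeries.embDomain_of_notMem_range hb

theorem tailMap_atSlot (j : Fin k) (x : WaveRing K) :
    tailMap (atSlot 1 j x) = atSlot 1 j.succ x := by
  ext1 α
  rw [tailMap, atSlot, atSlot, MvPowerSeries.coeff_map, MvPowerSeries.coeff_map,
    MvPowerSeries.coeff_map, tailHom, HahnSeries.embDomainRingHom_apply,
    HahnSeries.embDomainRingHom_apply, HahnSeries.embDomainRingHom_apply,
    HahnSeries.embDomain_embDomain]
  congr 1
  ext m : 1
  exact (slot_one_succ j m).symm

theorem frontCoeff_atSlot_zero (m : ℤ) (x : WaveRing K) :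
    frontCoeff m (atSlot 1 0 x : MultiRing K (k + 1)) = ofTimeMulti (lamCoeff m x) := by
  ext α s
  rw [coeff_frontCoeff, front_coeff, ofTimeMulti, MvPowerSeries.coeff_map, coeff_lamCoeff, atSlot,
    MvPowerSeries.coeff_map, HahnSeries.C_apply, HahnSeries.coeff_single,
    HahnSeries.embDomainRingHom_apply]
  by_cases hs : s = 0
  · subst hs
    rw [if_pos rfl, ← slot_one_zero]
    exact HahnSeries.embDomain_coeff (f := ⟨⟨slot (1 : Equiv.Perm (Fin (k + 1))) 0, _⟩, _⟩)
  · rw [if_neg hs]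
    refine HahnSeries.embDomain_of_notMem_range ?_
    rintro ⟨m', hm'⟩
    have : slot (1 : Equiv.Perm (Fin (k + 1))) 0 m' = consExp m s := hm'
    rw [slot_one_zero, consExp_inj] at this
    exact hs this.2.symm

theorem frontCoeff_atSlot_zero_mul (m : ℤ) (x : WaveRing K) (y : MultiRing K k) :
    frontCoeff m (atSlot 1 0 x * tailMap y) = ofTimeMulti (lamCoeff m x) * y := by
  rw [mul_comm, frontCoeff_tailMap_mul, frontCoeff_atSlot_zero, mul_comm]

theorem frontCoeff_lam_mul (m j : ℤ) (x : MultiRing K (k + 1)) :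
    frontCoeff m (atSlot 1 0 (lamPow j) * x) = frontCoeff (m + j) x := by
  ext1 α
  rw [coeff_frontCoeff, coeff_frontCoeff, atSlot_lamPow, MvPowerSeries.coeff_C_mul, lamAt,
    slot_one_zero, front_single_mul, sub_neg_eq_add]

/-- Division by `λ_0 - λ_{j+1}` raises the order in `λ_0^{-1}`. -/
theorem frontCoeff_eq_zero_of_mul (j : Fin k) (z u : MultiRing K (k + 1)) (N : ℤ)
    (h : (atSlot 1 0 (lamPow 1) - atSlot 1 j.succ (lamPow 1)) * z = u)
    (hu : ∀ m < N, frontCoeff m u = 0) : ∀ m < N + 1, frontCoeff m z = 0 := by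
  -- The coefficient of `λ_0^{-m}` in `(λ_0 - λ_{j+1}) z = u`.
  have hrec : ∀ m, frontCoeff (m + 1) z = atSlot 1 j (lamPow 1) * frontCoeff m z + frontCoeff m u := by
    intro m
    have h1 := congrArg (frontCoeff m) h
    rw [sub_mul, map_sub, frontCoeff_lam_mul, ← tailMap_atSlot, frontCoeff_tailMap_mul] at h1
    rw [← h1]; ring
  intro m hm
  ext1 α
  rw [map_zero]
  -- A lower bound on the order in `λ_0^{-1}` exists for each coefficient in the times separately,
  -- not uniformly, so the recursion is run at a fixed `α`.
  obtain ⟨N₀, hN₀⟩ := exists_front_eq_zero (MvPowerSeries.coeff α z)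
  have key : ∀ i : ℕ, ∀ m < N + 1, m < N₀ + i → MvPowerSeries.coeff α (frontCoeff m z) = 0 := by
    intro i
    induction i with
    | zero => intro m _ hm; exact hN₀ m (by simpa using hm)
    | succ i ih =>
      intro m hm hm'
      have := hrec (m - 1)
      rw [sub_add_cancel, hu (m - 1) (by omega), add_zero, atSlot_lamPow] at this
      rw [this, MvPowerSeries.coeff_C_mul, ih (m - 1) (by omega) (by push_cast at hm'; omega),
        mul_zero]
  exact key (m - N₀ + 1).toNat m hm (by omega)

/-- If `λ_i` dominates, the difference is `λ_i (1 - λ_j/λ_i)`, and the inverse of the second factor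
is the image of the one-variable geometric series under `x ↦ λ_j/λ_i`. In the opposite case the sign
is reversed. -/
theorem isUnit_lamAt_sub (ρ : Equiv.Perm (Fin k)) {i j : Fin k} (hij : i ≠ j) :
    IsUnit (lamAt ρ i 1 - lamAt ρ j 1 : MultiLaurent K k) := by
  have key : ∀ i j : Fin k, ρ.symm i < ρ.symm j →
      IsUnit (lamAt ρ i 1 - lamAt ρ j 1 : MultiLaurent K k) := by
    intro i j h
    let f : ℤ →+ Lex (Fin k → ℤ) := slot ρ i - slot ρ j
    have hf : StrictMono f := by
      intro a b hab
      refine ⟨ρ.symm i, fun l hl => ?_, ?_⟩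
      · have h1 : l ≠ ρ.symm i := hl.ne
        have h2 : l ≠ ρ.symm j := (hl.trans h).ne
        change (Pi.single (ρ.symm i) a - Pi.single (ρ.symm j) a : Fin k → ℤ) l =
          (Pi.single (ρ.symm i) b - Pi.single (ρ.symm j) b : Fin k → ℤ) l
        simp [h1, h2]
      · change (Pi.single (ρ.symm i) a - Pi.single (ρ.symm j) a : Fin k → ℤ) (ρ.symm i) <
          (Pi.single (ρ.symm i) b - Pi.single (ρ.symm j) b : Fin k → ℤ) (ρ.symm i)
        have h1 : ρ.symm i ≠ ρ.symm j := h.ne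
        simpa [h1] using hab
    let F : LaurentSeries K →+* MultiLaurent K k :=
      HahnSeries.embDomainRingHom f hf.injective fun _ _ => hf.le_iff_le
    have hu : IsUnit (1 - HahnSeries.single (1 : ℤ) (1 : K) : LaurentSeries K) := by
      have h1 : IsUnit (1 - PowerSeries.X : PowerSeries K) := by
        rw [PowerSeries.isUnit_iff_constantCoeff]; simp
      have h2 := h1.map (HahnSeries.ofPowerSeries ℤ K)
      rwa [map_sub, map_one, HahnSeries.ofPowerSeries_X] at h2
    have e : (lamAt ρ i 1 - lamAt ρ j 1 : MultiLaurent K k) =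
        lamAt ρ i 1 * F (1 - HahnSeries.single (1 : ℤ) (1 : K)) := by
      have h1 : F (HahnSeries.single (1 : ℤ) (1 : K)) = HahnSeries.single (f 1) 1 :=
        HahnSeries.embDomain_single
      rw [map_sub, map_one, h1, mul_sub, mul_one, lamAt, lamAt, HahnSeries.single_mul_single, one_mul]
      congr 2
      refine congrArg HahnSeries.single ?_
      change slot ρ j (-1) = slot ρ i (-1) + (slot ρ i 1 - slot ρ j 1)
      rw [map_neg, map_neg]; abel
    have hl : IsUnit (lamAt ρ i 1 : MultiLaurent K k) := by
      refine IsUnit.of_mul_eq_one (lamAt ρ i (-1)) ?_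
      rw [lamAt, lamAt, HahnSeries.single_mul_single, ← map_add]
      simp
    rw [e]
    exact hl.mul (hu.map F)
  rcases lt_or_gt_of_ne (ρ.symm.injective.ne hij) with h | h
  · exact key i j h
  · rw [← neg_sub]
    exact (key j i h).neg

theorem lam_sub_mul_invDiff (ρ : Equiv.Perm (Fin k)) {i j : Fin k} (hij : i ≠ j) :
    (atSlot ρ i (lamPow 1) - atSlot ρ j (lamPow 1)) * (invDiff ρ i j : MultiRing K k) = 1 := by
  rw [atSlot_lamPow, atSlot_lamPow, invDiff, ← map_sub, ← map_mul,
    Ring.mul_inverse_cancel _ (isUnit_lamAt_sub ρ hij), map_one]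

theorem invDiff_eq_of_mul_eq_one (ρ : Equiv.Perm (Fin k)) {i j : Fin k} (hij : i ≠ j)
    {x : MultiRing K k} (h : (atSlot ρ i (lamPow 1) - atSlot ρ j (lamPow 1)) * x = 1) :
    x = invDiff ρ i j := by
  have h1 := lam_sub_mul_invDiff (K := K) ρ hij
  linear_combination (invDiff ρ i j) * h - x * h1

theorem invDiff_swap (ρ : Equiv.Perm (Fin k)) {i j : Fin k} (hij : i ≠ j) :
    (invDiff ρ j i : MultiRing K k) = -invDiff ρ i j := by
  symm
  refine invDiff_eq_of_mul_eq_one ρ hij.symm ?_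
  linear_combination lam_sub_mul_invDiff (K := K) ρ hij

theorem tailMap_invDiff {i j : Fin k} (hij : i ≠ j) :
    tailMap (invDiff 1 i j : MultiRing K k) = invDiff 1 i.succ j.succ := by
  refine invDiff_eq_of_mul_eq_one 1 (by simpa using hij) ?_
  have h := congrArg tailMap (lam_sub_mul_invDiff (K := K) 1 hij)
  rwa [map_mul, map_sub, map_one, tailMap_atSlot, tailMap_atSlot] at h

theorem MvPowerSeries.pderiv_map {R S : Type*} [CommRing R] [CommRing S] (f : R →+* S) (i : ℕ)
    (x : MvPowerSeries ℕ R) : MvPowerSeries.pderiv S i (MvPowerSeries.map f x) =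
      MvPowerSeries.map f (MvPowerSeries.pderiv R i x) := by
  ext n
  simp [MvPowerSeries.coeff_pderiv]

end Front

end Toda

namespace Toda

open DiffOp

/-! ### The generating derivation `∑_q λ_0^{-q-2} ∂/∂t_q` -/

section Nabla

variable {K : Type*} [CommRing K] {k : ℕ}

/-- `F = ∑_q λ_0^{-q-2} ∂f/∂t_q`. -/
structure IsNabla (f : MultiRing K k) (F : MultiRing K (k + 1)) : Prop where
  low : ∀ m ≤ 1, frontCoeff m F = 0
  high : ∀ q : ℕ, frontCoeff (q + 2) F = MvPowerSeries.pderiv (MultiLaurent K k) q f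

/-- Two generating series agree as soon as both are `∇` of the same series; this is what closes the
induction on the number of points. -/
theorem IsNabla.unique {f : MultiRing K k} {F G : MultiRing K (k + 1)} (hF : IsNabla f F)
    (hG : IsNabla f G) : F = G := by
  refine frontCoeff_ext fun m => ?_
  rcases le_or_gt m 1 with h | h
  · rw [hF.low m h, hG.low m h]
  · obtain ⟨q, rfl⟩ : ∃ q : ℕ, m = q + 2 := ⟨(m - 2).toNat, by omega⟩
    rw [hF.high, hG.high]

theorem IsNabla.congr {f : MultiRing K k} {F G : MultiRing K (k + 1)} (hF : IsNabla f F)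
    (h : F = G) : IsNabla f G := h ▸ hF

theorem IsNabla.add {f g : MultiRing K k} {F G : MultiRing K (k + 1)} (hF : IsNabla f F)
    (hG : IsNabla g G) : IsNabla (f + g) (F + G) where
  low m hm := by rw [map_add, hF.low m hm, hG.low m hm, add_zero]
  high q := by rw [map_add, map_add, hF.high, hG.high]

theorem IsNabla.neg {f : MultiRing K k} {F : MultiRing K (k + 1)} (hF : IsNabla f F) :
    IsNabla (-f) (-F) where
  low m hm := by rw [map_neg, hF.low m hm, neg_zero]
  high q := by rw [map_neg, map_neg, hF.high]

theorem IsNabla.sub {f g : MultiRing K k} {F G : MultiRing K (k + 1)} (hF : IsNabla f F)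
    (hG : IsNabla g G) : IsNabla (f - g) (F - G) := by
  rw [sub_eq_add_neg, sub_eq_add_neg]; exact hF.add hG.neg

theorem IsNabla.mul {f g : MultiRing K k} {F G : MultiRing K (k + 1)} (hF : IsNabla f F)
    (hG : IsNabla g G) : IsNabla (f * g) (tailMap f * G + tailMap g * F) where
  low m hm := by
    rw [map_add, frontCoeff_tailMap_mul, frontCoeff_tailMap_mul, hF.low m hm, hG.low m hm]; simp
  high q := by
    rw [map_add, frontCoeff_tailMap_mul, frontCoeff_tailMap_mul, hF.high, hG.high,
      Derivation.leibniz, smul_eq_mul, smul_eq_mul]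

theorem IsNabla.const {f : MultiRing K k}
    (hf : ∀ q, MvPowerSeries.pderiv (MultiLaurent K k) q f = 0) : IsNabla f 0 where
  low m _ := map_zero _
  high q := by rw [map_zero, hf]

theorem IsNabla.C (a : MultiLaurent K k) : IsNabla (MvPowerSeries.C a) 0 :=
  IsNabla.const fun q => by
    rw [← mul_one (MvPowerSeries.C a), ← MvPowerSeries.smul_eq_C_mul]; simp

theorem IsNabla.zero : IsNabla (0 : MultiRing K k) 0 := IsNabla.const fun _ => map_zero _

theorem IsNabla.one : IsNabla (1 : MultiRing K k) 0 :=
  IsNabla.const fun _ => Derivation.map_one_eq_zero _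

theorem IsNabla.sum {ι : Type*} (s : Finset ι) {f : ι → MultiRing K k}
    {F : ι → MultiRing K (k + 1)} (h : ∀ i ∈ s, IsNabla (f i) (F i)) :
    IsNabla (∑ i ∈ s, f i) (∑ i ∈ s, F i) where
  low m hm := by rw [map_sum]; exact Finset.sum_eq_zero fun i hi => (h i hi).low m hm
  high q := by
    rw [map_sum, map_sum]; exact Finset.sum_congr rfl fun i hi => (h i hi).high q

theorem IsNabla.prod {ι : Type*} [DecidableEq ι] (s : Finset ι) {f : ι → MultiRing K k}
    {F : ι → MultiRing K (k + 1)} (h : ∀ i ∈ s, IsNabla (f i) (F i)) :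
    IsNabla (∏ i ∈ s, f i) (∑ i ∈ s, F i * ∏ j ∈ s.erase i, tailMap (f j)) := by
  induction s using Finset.induction_on with
  | empty => simpa using IsNabla.one
  | insert a s ha ih =>
    rw [Finset.prod_insert ha, Finset.sum_insert ha, Finset.erase_insert ha]
    have h1 := (h a (Finset.mem_insert_self a s)).mul
      (ih fun i hi => h i (Finset.mem_insert_of_mem hi))
    convert h1 using 1
    rw [add_comm (F a * _), map_prod, Finset.mul_sum]
    congr 1
    · refine Finset.sum_congr rfl fun i hi => ?_
      have hai : a ≠ i := fun hc => ha (hc ▸ hi)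
      rw [Finset.erase_insert_of_ne hai, Finset.prod_insert (fun hc => ha (Finset.mem_of_mem_erase hc))]
      ring
    · ring

end Nabla

/-! ### Evolution of the wave functions and of the kernel under `∇`. -/

section Waves

variable {K : Type*} [CommRing K] {k : ℕ}

theorem act_plus (v w : ℤ → TimeSeries K) (k M : ℕ) (hM : k + 1 ≤ M) (ψ : ℤ → WaveRing K) (n : ℤ) :
    act (laxPow v w k).plus ψ n =
      ∑ i ∈ Finset.range M, ofTime (laxEntry v w k n (n + i)) * ψ (n + i) := by
  rw [act, Finsupp.sum_of_support_subset (s := (Finset.range M).map (Nat.castEmbedding : ℕ ↪ ℤ)),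
    Finset.sum_map]
  · refine Finset.sum_congr rfl fun i _ => ?_
    simp only [Nat.castEmbedding_apply, plus]
    rw [Finsupp.filter_apply_pos _ _ (by positivity), laxEntry, add_sub_cancel_left]
  · intro i hi
    rw [plus, Finsupp.support_filter, Finset.mem_filter, Finsupp.mem_support_iff] at hi
    obtain ⟨h1, h2⟩ := hi
    lift i to ℕ using h2
    simp only [Finset.mem_map, Finset.mem_range, Nat.castEmbedding_apply, Nat.cast_inj,
      exists_eq_right]
    by_contra hc
    refine h1 (funext fun n => laxPow_apply_eq_zero v w k i n ?_)
    rw [abs_of_nonneg (by positivity)]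
    omega
  · simp

theorem act_minus (v w : ℤ → TimeSeries K) (k M : ℕ) (hM : k ≤ M) (ψ : ℤ → WaveRing K) (n : ℤ) :
    act (laxPow v w k).minus ψ n =
      ∑ i ∈ Finset.range M, ofTime (laxEntry v w k n (n - 1 - i)) * ψ (n - 1 - i) := by
  let f : ℕ ↪ ℤ := ⟨fun i => -1 - (i : ℤ), fun a b h => by simpa using h⟩
  rw [act, Finsupp.sum_of_support_subset (s := (Finset.range M).map f), Finset.sum_map]
  · refine Finset.sum_congr rfl fun i _ => ?_
    have hf : f i = -1 - (i : ℤ) := rfl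
    rw [hf, minus, Finsupp.filter_apply_pos _ _ (by omega), laxEntry,
      show n - 1 - (i : ℤ) - n = -1 - i by ring, show n + (-1 - (i : ℤ)) = n - 1 - i by ring]
  · intro i hi
    rw [minus, Finsupp.support_filter, Finset.mem_filter, Finsupp.mem_support_iff] at hi
    obtain ⟨h1, h2⟩ := hi
    obtain ⟨j, rfl⟩ : ∃ j : ℕ, i = -1 - j := ⟨(-1 - i).toNat, by omega⟩
    refine Finset.mem_map.mpr ⟨j, Finset.mem_range.mpr ?_, rfl⟩
    by_contra hc
    refine h1 (funext fun n => laxPow_apply_eq_zero v w k _ n ?_)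
    rw [lt_abs]; right; omega
  · simp

theorem pderiv_atSlot (ρ : Equiv.Perm (Fin k)) (j : Fin k) (q : ℕ) (x : WaveRing K) :
    MvPowerSeries.pderiv (MultiLaurent K k) q (atSlot ρ j x) =
      atSlot ρ j (MvPowerSeries.pderiv (LaurentSeries K) q x) := MvPowerSeries.pderiv_map _ _ _

theorem pderiv_ofTimeMulti (q : ℕ) (a : TimeSeries K) :
    MvPowerSeries.pderiv (MultiLaurent K k) q (ofTimeMulti a) =
      ofTimeMulti (MvPowerSeries.pderiv K q a) := MvPowerSeries.pderiv_map _ _ _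

theorem lamCoeff_lamPow (m j : ℤ) :
    lamCoeff m (lamPow j : WaveRing K) = if m + j = 0 then 1 else 0 := by
  rw [← mul_one (lamPow j), lamCoeff_lamPow_mul, lamCoeff_one]

/-- The kernel `K(λ_i, λ_j) = e^{σ(n-1)} D(λ_i, λ_j, n)`. -/
noncomputable def kernelK (E : ℤ → (TimeSeries K)ˣ) (ψ ψ' : ℤ → WaveRing K) (n : ℤ) (i j : Fin k) :
    MultiRing K k :=
  ofTimeMulti (E (n - 1) : TimeSeries K) * kernelD 1 ψ ψ' n i j

/-- The Christoffel–Darboux identity, for any two families of solutions of `L ψ = λ ψ`. -/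
theorem kernelK_succ_sub {v w : ℤ → TimeSeries K} {E : ℤ → (TimeSeries K)ˣ}
    {ψ ψ' : ℤ → WaveRing K} (hE : ∀ n, w n * (E n : TimeSeries K) = (E (n - 1) : TimeSeries K))
    (hψ : ∀ n, act (lax v w) ψ n = lamPow 1 * ψ n)
    (hψ' : ∀ n, act (lax v w) ψ' n = lamPow 1 * ψ' n) (n : ℤ) {i j : Fin k} (hij : i ≠ j) :
    kernelK E ψ ψ' (n + 1) i j - kernelK E ψ ψ' n i j =
      ofTimeMulti (E n : TimeSeries K) * (atSlot 1 i (ψ n) * atSlot 1 j (ψ' n)) := by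
  have h1 := congrArg (atSlot (1 : Equiv.Perm (Fin k)) i) (hψ n)
  have h2 := congrArg (atSlot (1 : Equiv.Perm (Fin k)) j) (hψ' n)
  simp only [act_lax_apply, map_add, map_mul, atSlot_ofTime] at h1 h2
  have h3 := congrArg (ofTimeMulti (k := k)) (hE n)
  rw [map_mul] at h3
  have h4 := lam_sub_mul_invDiff (K := K) 1 hij
  simp only [kernelK, kernelD, add_sub_cancel_right, ← h3]
  linear_combination (ofTimeMulti (E n : TimeSeries K) * invDiff 1 i j * atSlot 1 j (ψ' n)) * h1 -
    (ofTimeMulti (E n : TimeSeries K) * invDiff 1 i j * atSlot 1 i (ψ n)) * h2 +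
    (ofTimeMulti (E n : TimeSeries K) * (atSlot 1 i (ψ n) * atSlot 1 j (ψ' n))) * h4

theorem kernelK_add_nat {v w : ℤ → TimeSeries K} {E : ℤ → (TimeSeries K)ˣ}
    {ψ ψ' : ℤ → WaveRing K} (hE : ∀ n, w n * (E n : TimeSeries K) = (E (n - 1) : TimeSeries K))
    (hψ : ∀ n, act (lax v w) ψ n = lamPow 1 * ψ n)
    (hψ' : ∀ n, act (lax v w) ψ' n = lamPow 1 * ψ' n) (n : ℤ) (M : ℕ) {i j : Fin k} (hij : i ≠ j) :
    kernelK E ψ ψ' (n + M) i j = kernelK E ψ ψ' n i j + ∑ s ∈ Finset.range M,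
      ofTimeMulti (E (n + s) : TimeSeries K) * (atSlot 1 i (ψ (n + s)) * atSlot 1 j (ψ' (n + s))) := by
  induction M with
  | zero => simp
  | succ M ih =>
    rw [Finset.sum_range_succ, ← kernelK_succ_sub hE hψ hψ' (n + M) hij, ← add_assoc, ← ih]
    push_cast
    rw [← add_assoc n]
    ring

theorem kernelK_sub_nat {v w : ℤ → TimeSeries K} {E : ℤ → (TimeSeries K)ˣ}
    {ψ ψ' : ℤ → WaveRing K} (hE : ∀ n, w n * (E n : TimeSeries K) = (E (n - 1) : TimeSeries K))
    (hψ : ∀ n, act (lax v w) ψ n = lamPow 1 * ψ n)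
    (hψ' : ∀ n, act (lax v w) ψ' n = lamPow 1 * ψ' n) (n : ℤ) (M : ℕ) {i j : Fin k} (hij : i ≠ j) :
    kernelK E ψ ψ' n i j = kernelK E ψ ψ' (n - M) i j + ∑ s ∈ Finset.range M,
      ofTimeMulti (E (n - 1 - s) : TimeSeries K) *
        (atSlot 1 i (ψ (n - 1 - s)) * atSlot 1 j (ψ' (n - 1 - s))) := by
  induction M with
  | zero => simp
  | succ M ih =>
    have h := kernelK_succ_sub hE hψ hψ' (n - 1 - M) hij
    rw [Finset.sum_range_succ, ← h, ih]
    push_cast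
    rw [show n - 1 - (M : ℤ) + 1 = n - M by ring, show n - ((M : ℤ) + 1) = n - 1 - M by ring]
    ring

variable [Algebra ℚ K] {v w : ℤ → TimeSeries K} {E : ℤ → (TimeSeries K)ˣ} {ψA ψB : ℤ → WaveRing K}

/-- The diagonal of the Green function generates the `S_p = (L^{p+1})_{nn}`, preceded by the term
`λ_0^{-1}` coming from `L^0`, which has to be removed. -/
theorem isNabla_expSigma (hE : IsExpSigma v w E) (hA : IsWaveA v w ψA) (hB : IsWaveB v w E ψB)
    (hP : IsPair E ψA ψB) (n : ℤ) :
    IsNabla (ofTimeMulti (E n : TimeSeries K) : MultiRing K k)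
      (tailMap (ofTimeMulti (E n : TimeSeries K)) *
        (atSlot 1 0 (lamPow (-1)) - atSlot 1 0 (green E ψA ψB n n))) where
  low m hm := by
    rw [frontCoeff_tailMap_mul, map_sub, frontCoeff_atSlot_zero, frontCoeff_atSlot_zero,
      lamCoeff_lamPow]
    rcases (by omega : m ≤ 0 ∨ m = 1) with h | rfl
    · rw [if_neg (by omega), lamCoeff_green_eq_zero hA hB _ _ _ h]; simp
    · have h := lamCoeff_green hA hB hP 0 n n
      rw [Nat.cast_zero, zero_add, laxEntry_zero, if_pos rfl] at h
      rw [h]; simp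
  high q := by
    have h := lamCoeff_green hA hB hP (q + 1) n n
    push_cast at h
    rw [frontCoeff_tailMap_mul, map_sub, frontCoeff_atSlot_zero, frontCoeff_atSlot_zero,
      lamCoeff_lamPow, if_neg (by omega), show (q : ℤ) + 2 = q + 1 + 1 by ring, h,
      pderiv_ofTimeMulti, hE.2, evalAt_S, map_mul, map_neg, map_zero]
    ring

/-- By the evolution equation `∇ψ_A(λ_j, n)` is the sum of `G(λ_0; n, n+i) ψ_A(λ_j, n+i)` over `i ≥
0`, minus the contribution `λ_0^{-1} ψ_A(λ_j, n)` of `L^0`. Christoffel–Darboux telescopes it to the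
kernel at `n`. The argument runs backwards: the closed form is unrolled `M` steps and the remainder
does not reach the coefficient considered. -/
theorem isNabla_waveA (hE : IsExpSigma v w E) (hA : IsWaveA v w ψA) (hB : IsWaveB v w E ψB)
    (hP : IsPair E ψA ψB) (n : ℤ) (j : Fin k) :
    IsNabla (atSlot 1 j (ψA n)) (-(atSlot 1 0 (lamPow (-1)) *
      (atSlot 1 0 (ψA n) * kernelK E ψA ψB n j.succ 0 + atSlot 1 j.succ (ψA n)))) := by
  have hj : j.succ ≠ 0 := Fin.succ_ne_zero j
  set F : MultiRing K (k + 1) := -(atSlot 1 0 (lamPow (-1)) *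
      (atSlot 1 0 (ψA n) * kernelK E ψA ψB n j.succ 0 + atSlot 1 j.succ (ψA n))) with hF
  have key : ∀ (M : ℕ) (m : ℤ), m < M + 1 → frontCoeff m F =
      ∑ i ∈ Finset.range M, ofTimeMulti (lamCoeff m (green E ψA ψB n (n + i))) *
        atSlot 1 j (ψA (n + i)) - ofTimeMulti (if m = 1 then 1 else 0) * atSlot 1 j (ψA n) := by
    intro M m hm
    set rem : MultiRing K (k + 1) := atSlot 1 0 (lamPow (-1)) *
      (atSlot 1 0 (ψA n) * kernelK E ψA ψB (n + M) j.succ 0) with hrem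
    have e1 : F = ∑ i ∈ Finset.range M, atSlot 1 0 (green E ψA ψB n (n + i)) *
        tailMap (atSlot 1 j (ψA (n + i))) -
        atSlot 1 0 (lamPow (-1)) * tailMap (atSlot 1 j (ψA n)) - rem := by
      have hg : ∀ i : ℕ, (atSlot 1 0 (green E ψA ψB n (n + i)) : MultiRing K (k + 1)) =
          atSlot 1 0 (lamPow (-1)) * (ofTimeMulti (E (n + i) : TimeSeries K) *
            (atSlot 1 0 (ψA n) * atSlot 1 0 (ψB (n + i)))) := fun i => by
        rw [green, if_pos (by omega), map_mul, map_mul, map_mul, atSlot_ofTime]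
      have hs : ∑ i ∈ Finset.range M, (atSlot 1 0 (green E ψA ψB n (n + i)) : MultiRing K (k + 1)) *
          tailMap (atSlot 1 j (ψA (n + i))) = atSlot 1 0 (lamPow (-1)) * atSlot 1 0 (ψA n) *
          ∑ i ∈ Finset.range M, ofTimeMulti (E (n + i) : TimeSeries K) *
            (atSlot 1 j.succ (ψA (n + i)) * atSlot 1 0 (ψB (n + i))) := by
        rw [Finset.mul_sum]
        refine Finset.sum_congr rfl fun i _ => ?_
        rw [hg, tailMap_atSlot]; ring
      rw [hs, hF, hrem, kernelK_add_nat hE.1 hA.spectral hB.spectral n M hj, tailMap_atSlot]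
      ring
    have e2 : frontCoeff m rem = 0 := by
      -- Clearing the denominator of the kernel leaves products `ψ_A(λ_0, n) ψ_B(λ_0, n')` with `n'
      -- ≥ n + M - 1`, which with the factor `λ_0^{-1}` have order at least `M`. The division gains
      -- one more.
      refine frontCoeff_eq_zero_of_mul j rem _ M rfl (fun m' hm' => ?_) m hm
      have e3 : (atSlot 1 0 (lamPow 1) - atSlot 1 j.succ (lamPow 1)) * rem =
          atSlot 1 0 (lamPow (-1) * (ofTime (E (n + M - 1) : TimeSeries K) *
            (ψA n * ψB (n + M)))) * tailMap (atSlot 1 j (ψA (n + M - 1))) -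
          atSlot 1 0 (lamPow (-1) * (ofTime (E (n + M - 1) : TimeSeries K) *
            (ψA n * ψB (n + M - 1)))) * tailMap (atSlot 1 j (ψA (n + M))) := by
        have h4 := lam_sub_mul_invDiff (K := K) 1 hj
        simp only [hrem, kernelK, kernelD, map_mul, atSlot_ofTime, tailMap_atSlot]
        linear_combination -(atSlot 1 0 (lamPow (-1)) * (atSlot 1 0 (ψA n) *
          (ofTimeMulti (E (n + M - 1) : TimeSeries K) * (atSlot 1 j.succ (ψA (n + M)) *
          atSlot 1 0 (ψB (n + M - 1)) - atSlot 1 j.succ (ψA (n + M - 1)) *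
          atSlot 1 0 (ψB (n + M)))))) * h4
      rw [e3, map_sub, frontCoeff_atSlot_zero_mul, frontCoeff_atSlot_zero_mul,
        lamCoeff_lamPow_mul, lamCoeff_lamPow_mul, lamCoeff_ofTime_mul, lamCoeff_ofTime_mul,
        lamCoeff_waveA_mul_waveB hA hB _ _ _ (by omega),
        lamCoeff_waveA_mul_waveB hA hB _ _ _ (by omega)]
      simp
    rw [e1, map_sub, map_sub, map_sum, e2, sub_zero, frontCoeff_atSlot_zero_mul, lamCoeff_lamPow]
    congr 1
    · exact Finset.sum_congr rfl fun i _ => frontCoeff_atSlot_zero_mul _ _ _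
    · simp only [← sub_eq_add_neg, sub_eq_zero]
  constructor
  · intro m hm
    rcases (by omega : m ≤ 0 ∨ m = 1) with h | rfl
    · rw [key 0 m (by push_cast; omega), if_neg (by omega)]
      simp
    · rw [key 1 1 (by norm_num)]
      have h := lamCoeff_green hA hB hP 0 n n
      rw [Nat.cast_zero, zero_add, laxEntry_zero, if_pos rfl] at h
      simp [h]
  · intro q
    rw [key (q + 2) (q + 2) (by push_cast; omega), if_neg (by omega), map_zero, zero_mul, sub_zero,
      pderiv_atSlot, hA.evolution, act_plus v w (q + 1) (q + 2) le_rfl, map_sum]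
    refine Finset.sum_congr rfl fun i _ => ?_
    have h := lamCoeff_green hA hB hP (q + 1) n (n + i)
    push_cast at h
    rw [show (q : ℤ) + 2 = q + 1 + 1 by ring, h, map_mul, atSlot_ofTime]

/-- The same telescoping towards lower sites. The minus part of `L^{q+1}` excludes the diagonal, so
there is no correction from `L^0`. -/
theorem isNabla_waveB (hE : IsExpSigma v w E) (hA : IsWaveA v w ψA) (hB : IsWaveB v w E ψB)
    (hP : IsPair E ψA ψB) (n : ℤ) (j : Fin k) :
    IsNabla (atSlot 1 j (ψB n)) (-(atSlot 1 0 (lamPow (-1)) *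
      (atSlot 1 0 (ψB n) * kernelK E ψA ψB n 0 j.succ))) := by
  have hj : 0 ≠ j.succ := (Fin.succ_ne_zero j).symm
  set F : MultiRing K (k + 1) := -(atSlot 1 0 (lamPow (-1)) *
      (atSlot 1 0 (ψB n) * kernelK E ψA ψB n 0 j.succ)) with hF
  have key : ∀ (M : ℕ) (m : ℤ), m < M + 1 → frontCoeff m F =
      -∑ i ∈ Finset.range M, ofTimeMulti (lamCoeff m (green E ψA ψB n (n - 1 - i))) *
        atSlot 1 j (ψB (n - 1 - i)) := by
    intro M m hm
    set rem : MultiRing K (k + 1) := atSlot 1 0 (lamPow (-1)) *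
      (atSlot 1 0 (ψB n) * kernelK E ψA ψB (n - M) 0 j.succ) with hrem
    have e1 : F = -∑ i ∈ Finset.range M, atSlot 1 0 (green E ψA ψB n (n - 1 - i)) *
        tailMap (atSlot 1 j (ψB (n - 1 - i))) - rem := by
      have hg : ∀ i : ℕ, (atSlot 1 0 (green E ψA ψB n (n - 1 - i)) : MultiRing K (k + 1)) =
          atSlot 1 0 (lamPow (-1)) * (ofTimeMulti (E (n - 1 - i) : TimeSeries K) *
            (atSlot 1 0 (ψA (n - 1 - i)) * atSlot 1 0 (ψB n))) := fun i => by
        rw [green, if_neg (by omega), map_mul, map_mul, map_mul, atSlot_ofTime]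
      have hs : ∑ i ∈ Finset.range M,
          (atSlot 1 0 (green E ψA ψB n (n - 1 - i)) : MultiRing K (k + 1)) *
          tailMap (atSlot 1 j (ψB (n - 1 - i))) = atSlot 1 0 (lamPow (-1)) * atSlot 1 0 (ψB n) *
          ∑ i ∈ Finset.range M, ofTimeMulti (E (n - 1 - i) : TimeSeries K) *
            (atSlot 1 0 (ψA (n - 1 - i)) * atSlot 1 j.succ (ψB (n - 1 - i))) := by
        rw [Finset.mul_sum]
        refine Finset.sum_congr rfl fun i _ => ?_
        rw [hg, tailMap_atSlot]; ring
      rw [hs, hF, hrem, kernelK_sub_nat hE.1 hA.spectral hB.spectral n M hj]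
      ring
    have e2 : frontCoeff m rem = 0 := by
      refine frontCoeff_eq_zero_of_mul j rem _ M rfl (fun m' hm' => ?_) m hm
      have e3 : (atSlot 1 0 (lamPow 1) - atSlot 1 j.succ (lamPow 1)) * rem =
          atSlot 1 0 (lamPow (-1) * (ofTime (E (n - M - 1) : TimeSeries K) *
            (ψA (n - M) * ψB n))) * tailMap (atSlot 1 j (ψB (n - M - 1))) -
          atSlot 1 0 (lamPow (-1) * (ofTime (E (n - M - 1) : TimeSeries K) *
            (ψA (n - M - 1) * ψB n))) * tailMap (atSlot 1 j (ψB (n - M))) := by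
        have h4 := lam_sub_mul_invDiff (K := K) 1 hj
        simp only [hrem, kernelK, kernelD, map_mul, atSlot_ofTime, tailMap_atSlot]
        linear_combination (atSlot 1 0 (lamPow (-1)) * (atSlot 1 0 (ψB n) *
          (ofTimeMulti (E (n - M - 1) : TimeSeries K) * (atSlot 1 0 (ψA (n - M)) *
          atSlot 1 j.succ (ψB (n - M - 1)) - atSlot 1 0 (ψA (n - M - 1)) *
          atSlot 1 j.succ (ψB (n - M)))))) * h4
      rw [e3, map_sub, frontCoeff_atSlot_zero_mul, frontCoeff_atSlot_zero_mul,
        lamCoeff_lamPow_mul, lamCoeff_lamPow_mul, lamCoeff_ofTime_mul, lamCoeff_ofTime_mul,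
        lamCoeff_waveA_mul_waveB hA hB _ _ _ (by omega),
        lamCoeff_waveA_mul_waveB hA hB _ _ _ (by omega)]
      simp
    rw [e1, map_sub, map_neg, map_sum, e2, sub_zero]
    congr 1
    exact Finset.sum_congr rfl fun i _ => frontCoeff_atSlot_zero_mul _ _ _
  constructor
  · intro m hm
    rcases (by omega : m ≤ 0 ∨ m = 1) with h | rfl
    · rw [key 0 m (by push_cast; omega)]
      simp
    · rw [key 1 1 (by norm_num)]
      have h := lamCoeff_green hA hB hP 0 n (n - 1)
      rw [Nat.cast_zero, zero_add, laxEntry_zero, if_neg (by omega)] at h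
      simp [h]
  · intro q
    rw [key (q + 2) (q + 2) (by push_cast; omega), pderiv_atSlot, hB.evolution,
      act_minus v w (q + 1) (q + 2) (by omega), map_neg, map_sum]
    congr 1
    refine Finset.sum_congr rfl fun i _ => ?_
    have h := lamCoeff_green hA hB hP (q + 1) n (n - 1 - i)
    push_cast at h
    rw [show (q : ℤ) + 2 = q + 1 + 1 by ring, h, map_mul, atSlot_ofTime]

/-- The kernel evolves by splitting at the new spectral parameter. -/
theorem isNabla_kernelK (hE : IsExpSigma v w E) (hA : IsWaveA v w ψA) (hB : IsWaveB v w E ψB)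
    (hP : IsPair E ψA ψB) (n : ℤ) {i j : Fin k} (hij : i ≠ j) :
    IsNabla (kernelK E ψA ψB n i j) (-(atSlot 1 0 (lamPow (-1)) *
      (kernelK E ψA ψB n i.succ 0 * kernelK E ψA ψB n 0 j.succ))) := by
  -- The Leibniz rule for the three factors `e^{σ(n-1)}`, the numerator, and `1/(λ_i - λ_j)`, the
  -- last being constant in the times.
  have hnum := ((isNabla_waveA hE hA hB hP n i).mul (isNabla_waveB hE hA hB hP (n - 1) j)).sub
    ((isNabla_waveA hE hA hB hP (n - 1) i).mul (isNabla_waveB hE hA hB hP n j))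
  have h := (isNabla_expSigma (k := k) hE hA hB hP (n - 1)).mul (hnum.mul (IsNabla.C
    (Ring.inverse (lamAt 1 i 1 - lamAt 1 j 1))))
  refine IsNabla.congr (f := kernelK E ψA ψB n i j) h ?_
  have hi0 : i.succ ≠ 0 := Fin.succ_ne_zero i
  have h0j : 0 ≠ j.succ := (Fin.succ_ne_zero j).symm
  have hinv : tailMap (MvPowerSeries.C (Ring.inverse (lamAt 1 i 1 - lamAt 1 j 1))) =
    (invDiff 1 i.succ j.succ : MultiRing K (k + 1)) := tailMap_invDiff hij
  have c1 := kernelK_succ_sub hE.1 hA.spectral hB.spectral (n - 1) hi0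
  have c2 := kernelK_succ_sub hE.1 hA.spectral hB.spectral (n - 1) h0j
  rw [sub_add_cancel] at c1 c2
  have i1 := lam_sub_mul_invDiff (K := K) 1 hi0
  have i2 := lam_sub_mul_invDiff (K := K) 1 h0j
  have i3 := lam_sub_mul_invDiff (K := K) (1 : Equiv.Perm (Fin (k + 1)))
    (i := i.succ) (j := j.succ) (by simpa using hij)
  have hg : (atSlot 1 0 (green E ψA ψB (n - 1) (n - 1)) : MultiRing K (k + 1)) =
      atSlot 1 0 (lamPow (-1)) * (ofTimeMulti (E (n - 1) : TimeSeries K) *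
        (atSlot 1 0 (ψA (n - 1)) * atSlot 1 0 (ψB (n - 1)))) := by
    rw [green, if_pos le_rfl, map_mul, map_mul, map_mul, atSlot_ofTime]
  rw [hinv, hg]
  simp only [map_mul, map_sub, tailMap_atSlot, tailMap_ofTimeMulti, hinv]
  have d1 : (atSlot 1 i.succ (lamPow 1) - atSlot 1 0 (lamPow 1)) * kernelK E ψA ψB n i.succ 0 =
      ofTimeMulti (E (n - 1) : TimeSeries K) * (atSlot 1 i.succ (ψA n) * atSlot 1 0 (ψB (n - 1)) -
        atSlot 1 i.succ (ψA (n - 1)) * atSlot 1 0 (ψB n)) := by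
    rw [kernelK, kernelD]; linear_combination (ofTimeMulti (E (n - 1) : TimeSeries K) *
      (atSlot 1 i.succ (ψA n) * atSlot 1 0 (ψB (n - 1)) -
        atSlot 1 i.succ (ψA (n - 1)) * atSlot 1 0 (ψB n))) * i1
  have d2 : (atSlot 1 0 (lamPow 1) - atSlot 1 j.succ (lamPow 1)) * kernelK E ψA ψB n 0 j.succ =
      ofTimeMulti (E (n - 1) : TimeSeries K) * (atSlot 1 0 (ψA n) * atSlot 1 j.succ (ψB (n - 1)) -
        atSlot 1 0 (ψA (n - 1)) * atSlot 1 j.succ (ψB n)) := by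
    rw [kernelK, kernelD]; linear_combination (ofTimeMulti (E (n - 1) : TimeSeries K) *
      (atSlot 1 0 (ψA n) * atSlot 1 j.succ (ψB (n - 1)) -
        atSlot 1 0 (ψA (n - 1)) * atSlot 1 j.succ (ψB n))) * i2
  -- Christoffel–Darboux moves the kernels at `n - 1` to `n`. The products of wave functions at `n -
  -- 1` produced by this cancel against the diagonal Green function in `∇e^{σ(n-1)}`.
  have c1' : kernelK E ψA ψB (n - 1) i.succ 0 = kernelK E ψA ψB n i.succ 0 -
    ofTimeMulti (E (n - 1) : TimeSeries K) *
      (atSlot 1 i.succ (ψA (n - 1)) * atSlot 1 0 (ψB (n - 1))) := by rw [← c1]; ring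
  have c2' : kernelK E ψA ψB (n - 1) 0 j.succ = kernelK E ψA ψB n 0 j.succ -
    ofTimeMulti (E (n - 1) : TimeSeries K) *
      (atSlot 1 0 (ψA (n - 1)) * atSlot 1 j.succ (ψB (n - 1))) := by rw [← c2]; ring
  rw [c1', c2']
  generalize kernelK E ψA ψB n i.succ 0 = K1 at *
  generalize kernelK E ψA ψB n 0 j.succ = K2 at *
  generalize (ofTimeMulti (E (n - 1) : TimeSeries K) : MultiRing K (k + 1)) = e at *
  generalize (invDiff 1 i.succ j.succ : MultiRing K (k + 1)) = I at *
  generalize (atSlot 1 0 (lamPow (-1)) : MultiRing K (k + 1)) = l at *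
  -- The two surviving terms combine through `(λ_i - λ_0) + (λ_0 - λ_j) = λ_i - λ_j`, which cancels
  -- the denominator `I`.
  linear_combination (I * l * K1) * d2 + (I * l * K2) * d1 - (l * K1 * K2) * i3

end Waves

end Toda

namespace Toda

open DiffOp

/-! ### Generating series of correlation functions -/

section GenSeries

variable {K : Type*} [CommRing K] {k : ℕ}

/-- The series `∑ c(i_1,…,i_k) / (λ_1^{i_1+2} ⋯ λ_k^{i_k+2})` with coefficients in `K[[𝐭]]`. -/
noncomputable def genSeries (c : (Fin k → ℕ) → TimeSeries K) : MultiRing K k := fun α =>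
  genLaurent 1 fun i => MvPowerSeries.coeff α (c i)

theorem coeff_genSeries (c : (Fin k → ℕ) → TimeSeries K) (α : ℕ →₀ ℕ) (s : Lex (Fin k → ℤ)) :
    (MvPowerSeries.coeff α (genSeries c)).coeff s =
      Function.extend (genExp 1) (fun i => MvPowerSeries.coeff α (c i)) 0 s := rfl

theorem genExp_cons (p : ℕ) (i : Fin k → ℕ) :
    genExp 1 (Fin.cons p i : Fin (k + 1) → ℕ) = consExp ((p : ℤ) + 2) (genExp 1 i) := by
  apply ofLex.injective
  funext j
  induction j using Fin.cases <;> rfl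

theorem frontCoeff_genSeries (p : ℕ) (c : (Fin (k + 1) → ℕ) → TimeSeries K) :
    frontCoeff (p + 2) (genSeries c) = genSeries fun i => c (Fin.cons p i) := by
  ext α s
  rw [coeff_frontCoeff, front_coeff, coeff_genSeries, coeff_genSeries]
  by_cases hs : ∃ i, genExp 1 i = s
  · obtain ⟨i, rfl⟩ := hs
    rw [← genExp_cons, (genExp_injective 1).extend_apply, (genExp_injective 1).extend_apply]
  · rw [Function.extend_apply' _ _ _ hs, Function.extend_apply']
    · rfl
    · rintro ⟨i, hi⟩
      rw [← Fin.cons_self_tail i, genExp_cons, consExp_inj] at hi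
      exact hs ⟨_, hi.2⟩

theorem frontCoeff_genSeries_eq_zero (m : ℤ) (hm : m ≤ 1) (c : (Fin (k + 1) → ℕ) → TimeSeries K) :
    frontCoeff m (genSeries c) = 0 := by
  ext α s
  rw [coeff_frontCoeff, front_coeff, coeff_genSeries, Function.extend_apply']
  · rfl
  · rintro ⟨i, hi⟩
    rw [← Fin.cons_self_tail i, genExp_cons, consExp_inj] at hi
    omega

theorem pderiv_genSeries (q : ℕ) (c : (Fin k → ℕ) → TimeSeries K) :
    MvPowerSeries.pderiv (MultiLaurent K k) q (genSeries c) =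
      genSeries fun i => MvPowerSeries.pderiv K q (c i) := by
  ext α s
  have h : ((α q : MultiLaurent K k) + 1) = HahnSeries.C ((α q : K) + 1) := by
    rw [map_add, map_natCast, map_one]
  rw [MvPowerSeries.coeff_pderiv, h, mul_comm, HahnSeries.C_mul_eq_smul, HahnSeries.coeff_smul,
    coeff_genSeries, coeff_genSeries, smul_eq_mul]
  by_cases hs : ∃ i, genExp 1 i = s
  · obtain ⟨i, rfl⟩ := hs
    rw [(genExp_injective 1).extend_apply, (genExp_injective 1).extend_apply,
      MvPowerSeries.coeff_pderiv, mul_comm]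
  · rw [Function.extend_apply' _ _ _ hs, Function.extend_apply' _ _ _ hs]
    simp

theorem genSeries_fin_zero (c : (Fin 0 → ℕ) → TimeSeries K) :
    genSeries c = ofTimeMulti (c default) := by
  ext α s
  have hs : s = genExp 1 default := Subsingleton.elim (α := Fin 0 → ℤ) _ _
  have h0 : s = 0 := Subsingleton.elim (α := Fin 0 → ℤ) _ _
  rw [coeff_genSeries, ofTimeMulti, MvPowerSeries.coeff_map, h0, HahnSeries.C_apply,
    HahnSeries.coeff_single_same, ← h0, hs, (genExp_injective 1).extend_apply]

/-- Prepending an index amounts to applying a flow, but only to lists with at least two entries;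
hence `2 ≤ k`. -/
theorem isNabla_corrSeries {v w : ℤ → TimeSeries K} (hvw : IsSolution v w) (hk : 2 ≤ k) (n : ℤ) :
    IsNabla (corrSeries (1 : Equiv.Perm (Fin k)) v w n) (corrSeries 1 v w n) where
  low m hm := frontCoeff_genSeries_eq_zero m hm _
  high q := by
    refine (frontCoeff_genSeries q _).trans (Eq.trans ?_ (pderiv_genSeries q _).symm)
    congr 1
    funext i
    rw [pderiv_evalAt hvw, List.ofFn_cons, corrPoly_cons q (by simpa using hk)]

end GenSeries

/-! ### The two-point function -/

section TwoPoint

variable {K : Type*} [CommRing K] {v w : ℤ → TimeSeries K} {E : ℤ → (TimeSeries K)ˣ}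
  {ψA ψB : ℤ → WaveRing K}

/-- The Plücker relation. -/
theorem kernelK_pluecker (hP : IsPair E ψA ψB) (n : ℤ) :
    -(atSlot 1 0 (lamPow (-1)) * atSlot 1 (0 : Fin 1).succ (lamPow (-1)) *
      (kernelK E ψA ψB n 0 (0 : Fin 1).succ * kernelK E ψA ψB n (0 : Fin 1).succ 0)) -
      invDiff 1 0 (0 : Fin 1).succ ^ 2 =
    -(atSlot 1 0 (lamPow (-1)) * atSlot 1 (0 : Fin 1).succ (lamPow (-1)) *
      (kernelK E ψA ψA n 0 (0 : Fin 1).succ * kernelK E ψB ψB n 0 (0 : Fin 1).succ)) := by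
  have hs : (invDiff 1 (0 : Fin 1).succ 0 : MultiRing K 2) = -invDiff 1 0 (0 : Fin 1).succ :=
    invDiff_swap 1 (by simp)
  have p0 := congrArg (atSlot (1 : Equiv.Perm (Fin 2)) 0) (hP n)
  have p1 := congrArg (atSlot (1 : Equiv.Perm (Fin 2)) (0 : Fin 1).succ) (hP n)
  have hl : (lamPow (-1) * lamPow 1 : WaveRing K) = 1 := by
    rw [lamPow_mul_lamPow, neg_add_cancel, lamPow_zero]
  have l0 := congrArg (atSlot (1 : Equiv.Perm (Fin 2)) 0) hl
  have l1 := congrArg (atSlot (1 : Equiv.Perm (Fin 2)) (0 : Fin 1).succ) hl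
  simp only [map_mul, map_sub, map_one, atSlot_ofTime] at p0 p1 l0 l1
  simp only [kernelK, kernelD, hs]
  generalize (invDiff 1 0 (0 : Fin 1).succ : MultiRing K 2) = I at *
  generalize (atSlot 1 0 (lamPow (-1)) : MultiRing K 2) = m0 at *
  generalize (atSlot 1 (0 : Fin 1).succ (lamPow (-1)) : MultiRing K 2) = m1 at *
  generalize (atSlot 1 0 (lamPow 1) : MultiRing K 2) = x0 at *
  generalize (atSlot 1 (0 : Fin 1).succ (lamPow 1) : MultiRing K 2) = x1 at *
  generalize (ofTimeMulti (E (n - 1) : TimeSeries K) : MultiRing K 2) = e at *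
  generalize (atSlot 1 0 (ψA n) : MultiRing K 2) = a1 at *
  generalize (atSlot 1 0 (ψA (n - 1)) : MultiRing K 2) = a2 at *
  generalize (atSlot 1 (0 : Fin 1).succ (ψA n) : MultiRing K 2) = a3 at *
  generalize (atSlot 1 (0 : Fin 1).succ (ψA (n - 1)) : MultiRing K 2) = a4 at *
  generalize (atSlot 1 0 (ψB n) : MultiRing K 2) = b1 at *
  generalize (atSlot 1 0 (ψB (n - 1)) : MultiRing K 2) = b2 at *
  generalize (atSlot 1 (0 : Fin 1).succ (ψB n) : MultiRing K 2) = b3 at *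
  generalize (atSlot 1 (0 : Fin 1).succ (ψB (n - 1)) : MultiRing K 2) = b4 at *
  -- The product of the pair conditions at both spectral parameters. It rewrites the double pole as
  -- a product of two minors of a 2×4 matrix, and the rest is the quadratic relation among such
  -- minors.
  have h1 : m0 * m1 * (e * (a1 * b2 - b1 * a2) * (e * (a3 * b4 - b3 * a4))) = 1 := by
    rw [p0, p1]; linear_combination (m1 * x1) * l0 + l1
  linear_combination I ^ 2 * h1

variable [Algebra ℚ K]

/-- Controls the boundary terms of the two-point telescoping: a `ψ_A ψ_A` kernel at `N` times a `ψ_B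
ψ_B` kernel at `N'` becomes small in `λ_0^{-1}` as `N' - N` grows. -/
theorem frontCoeff_kernelK_mul_kernelK (hA : IsWaveA v w ψA) (hB : IsWaveB v w E ψB) (N N' m : ℤ)
    (hm : m < N' - N) : frontCoeff m (atSlot 1 0 (lamPow (-1)) * atSlot 1 (0 : Fin 1).succ (lamPow (-1)) *
      (kernelK E ψA ψA N 0 (0 : Fin 1).succ * kernelK E ψB ψB N' 0 (0 : Fin 1).succ)) = 0 := by
  set z : MultiRing K 2 := atSlot 1 0 (lamPow (-1)) * atSlot 1 (0 : Fin 1).succ (lamPow (-1)) *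
      (kernelK E ψA ψA N 0 (0 : Fin 1).succ * kernelK E ψB ψB N' 0 (0 : Fin 1).succ) with hz
  set d : MultiRing K 2 := atSlot 1 0 (lamPow 1) - atSlot 1 (0 : Fin 1).succ (lamPow 1) with hd
  -- Two multiplications by `λ_0 - λ_1` clear both denominators. The numerator has order at least
  -- `N' - N`, and each division gains one; this surplus is not needed.
  refine frontCoeff_eq_zero_of_mul 0 z (d * z) (N' - N + 1) rfl ?_ m (by omega)
  refine frontCoeff_eq_zero_of_mul 0 (d * z) (d * (d * z)) (N' - N) rfl fun m hm => ?_
  let T : ℤ → ℤ → WaveRing K := fun x y => lamPow (-1) * (ofTime (E (N - 1) : TimeSeries K) *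
    (ofTime (E (N' - 1) : TimeSeries K) * (ψA x * ψB y)))
  let Y : ℤ → ℤ → MultiRing K 1 := fun x y => atSlot 1 0 (lamPow (-1) * (ψA x * ψB y))
  have e : d * (d * z) = atSlot 1 0 (T N N') * tailMap (Y (N - 1) (N' - 1)) -
      atSlot 1 0 (T N (N' - 1)) * tailMap (Y (N - 1) N') -
      atSlot 1 0 (T (N - 1) N') * tailMap (Y N (N' - 1)) +
      atSlot 1 0 (T (N - 1) (N' - 1)) * tailMap (Y N N') := by
    have h : d * invDiff 1 0 (0 : Fin 1).succ = 1 := lam_sub_mul_invDiff 1 (by simp)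
    simp only [T, Y, tailMap_atSlot, map_mul, atSlot_ofTime, hz, kernelK, kernelD]
    generalize (invDiff 1 0 (0 : Fin 1).succ : MultiRing K 2) = I at *
    generalize (atSlot 1 0 (lamPow (-1)) : MultiRing K 2) = l at *
    generalize (atSlot 1 (0 : Fin 1).succ (lamPow (-1)) : MultiRing K 2) = l1 at *
    clear_value d
    have h2 : d * d * (I * I) = 1 := by linear_combination (d * I + 1) * h
    generalize (ofTimeMulti (E (N - 1) : TimeSeries K) : MultiRing K 2) = e
    generalize (ofTimeMulti (E (N' - 1) : TimeSeries K) : MultiRing K 2) = e'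
    generalize (atSlot 1 0 (ψA N) : MultiRing K 2) = a1
    generalize (atSlot 1 0 (ψA (N - 1)) : MultiRing K 2) = a2
    generalize (atSlot 1 (0 : Fin 1).succ (ψA N) : MultiRing K 2) = a3
    generalize (atSlot 1 (0 : Fin 1).succ (ψA (N - 1)) : MultiRing K 2) = a4
    generalize (atSlot 1 0 (ψB N') : MultiRing K 2) = b1
    generalize (atSlot 1 0 (ψB (N' - 1)) : MultiRing K 2) = b2
    generalize (atSlot 1 (0 : Fin 1).succ (ψB N') : MultiRing K 2) = b3
    generalize (atSlot 1 (0 : Fin 1).succ (ψB (N' - 1)) : MultiRing K 2) = b4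
    linear_combination (l * l1 * (e * (a1 * a4 - a2 * a3)) * (e' * (b1 * b4 - b2 * b3))) * h2
  have hT : ∀ x y, x ≤ N → N' - 1 ≤ y → lamCoeff m (T x y) = 0 := fun x y hx hy => by
    simp only [T]
    rw [lamCoeff_lamPow_mul, lamCoeff_ofTime_mul, lamCoeff_ofTime_mul,
      lamCoeff_waveA_mul_waveB hA hB _ _ _ (by omega), mul_zero, mul_zero]
  rw [e, map_add, map_sub, map_sub, frontCoeff_atSlot_zero_mul, frontCoeff_atSlot_zero_mul,
    frontCoeff_atSlot_zero_mul, frontCoeff_atSlot_zero_mul, hT _ _ (by omega) (by omega),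
    hT _ _ (by omega) (by omega), hT _ _ (by omega) (by omega), hT _ _ (by omega) (by omega)]
  simp

/-- After the Plücker relation the `ψ_A ψ_A` kernel is telescoped down to `n - M` and the `ψ_B ψ_B`
kernel up to `n + M`. The product of the two sums is the box of Green functions, because the
summands factor for `n - 1 - s < n + j`. The three other products involve kernels at distance at
least `M` and are negligible. -/
theorem twoPoint_eq_box (hE : IsExpSigma v w E) (hA : IsWaveA v w ψA) (hB : IsWaveB v w E ψB)
    (hP : IsPair E ψA ψB) (n m : ℤ) (M : ℕ) (hm : m < M) :
    frontCoeff m (-(atSlot 1 0 (lamPow (-1)) * atSlot 1 (0 : Fin 1).succ (lamPow (-1)) *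
      (kernelK E ψA ψB n 0 (0 : Fin 1).succ * kernelK E ψA ψB n (0 : Fin 1).succ 0)) -
      invDiff 1 0 (0 : Fin 1).succ ^ 2) =
    ∑ s ∈ Finset.range M, ∑ j ∈ Finset.range M,
      ofTimeMulti (lamCoeff m (green E ψA ψB (n + j) (n - 1 - s))) *
        atSlot 1 0 (green E ψA ψB (n - 1 - s) (n + j)) := by
  have h01 : (0 : Fin 2) ≠ (0 : Fin 1).succ := by simp
  have hU := kernelK_sub_nat hE.1 hA.spectral hA.spectral n M h01
  have hV := kernelK_add_nat hE.1 hB.spectral hB.spectral n M h01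
  have hS : ∑ s ∈ Finset.range M, ∑ j ∈ Finset.range M,
      (atSlot 1 0 (green E ψA ψB (n + j) (n - 1 - s)) : MultiRing K 2) *
        tailMap (atSlot 1 0 (green E ψA ψB (n - 1 - s) (n + j))) =
      atSlot 1 0 (lamPow (-1)) * atSlot 1 (0 : Fin 1).succ (lamPow (-1)) *
      ((∑ s ∈ Finset.range M, ofTimeMulti (E (n - 1 - s) : TimeSeries K) *
        (atSlot 1 0 (ψA (n - 1 - s)) * atSlot 1 (0 : Fin 1).succ (ψA (n - 1 - s)))) *
      ∑ j ∈ Finset.range M, ofTimeMulti (E (n + j) : TimeSeries K) *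
        (atSlot 1 0 (ψB (n + j)) * atSlot 1 (0 : Fin 1).succ (ψB (n + j)))) := by
    rw [Finset.sum_mul_sum, Finset.mul_sum]
    refine Finset.sum_congr rfl fun s _ => ?_
    rw [Finset.mul_sum]
    refine Finset.sum_congr rfl fun j _ => ?_
    rw [green, if_neg (by omega), green, if_pos (by omega), tailMap_atSlot]
    simp only [map_mul, atSlot_ofTime]
    ring
  rw [kernelK_pluecker hP]
  have e : -(atSlot 1 0 (lamPow (-1)) * atSlot 1 (0 : Fin 1).succ (lamPow (-1)) *
      (kernelK E ψA ψA n 0 (0 : Fin 1).succ * kernelK E ψB ψB n 0 (0 : Fin 1).succ)) =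
      ∑ s ∈ Finset.range M, ∑ j ∈ Finset.range M,
      (atSlot 1 0 (green E ψA ψB (n + j) (n - 1 - s)) : MultiRing K 2) *
        tailMap (atSlot 1 0 (green E ψA ψB (n - 1 - s) (n + j))) -
      atSlot 1 0 (lamPow (-1)) * atSlot 1 (0 : Fin 1).succ (lamPow (-1)) *
      (kernelK E ψA ψA n 0 (0 : Fin 1).succ * kernelK E ψB ψB (n + M) 0 (0 : Fin 1).succ) +
      atSlot 1 0 (lamPow (-1)) * atSlot 1 (0 : Fin 1).succ (lamPow (-1)) *
      (kernelK E ψA ψA (n - M) 0 (0 : Fin 1).succ * kernelK E ψB ψB (n + M) 0 (0 : Fin 1).succ) -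
      atSlot 1 0 (lamPow (-1)) * atSlot 1 (0 : Fin 1).succ (lamPow (-1)) *
      (kernelK E ψA ψA (n - M) 0 (0 : Fin 1).succ * kernelK E ψB ψB n 0 (0 : Fin 1).succ) := by
    rw [hS, hU, hV]
    ring
  rw [e, map_sub, map_add, map_sub, frontCoeff_kernelK_mul_kernelK hA hB _ _ _ (by omega),
    frontCoeff_kernelK_mul_kernelK hA hB _ _ _ (by omega),
    frontCoeff_kernelK_mul_kernelK hA hB _ _ _ (by omega), map_sum, sub_zero, add_zero, sub_zero]
  refine Finset.sum_congr rfl fun s _ => ?_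
  rw [map_sum]
  exact Finset.sum_congr rfl fun j _ => frontCoeff_atSlot_zero_mul _ _ _

/-- Taking coefficients in both spectral parameters turns the box of Green functions into the box of
entries of powers of `L` that computes `Ω_{p,q}`. Off the diagonal the Green function starts at
`λ^{-2}`, as the series on the left requires. -/
theorem corrSeries_two (hE : IsExpSigma v w E) (hA : IsWaveA v w ψA) (hB : IsWaveB v w E ψB)
    (hP : IsPair E ψA ψB) (n : ℤ) : corrSeries (1 : Equiv.Perm (Fin 2)) v w n =
    -(atSlot 1 0 (lamPow (-1)) * atSlot 1 (0 : Fin 1).succ (lamPow (-1)) *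
      (kernelK E ψA ψB n 0 (0 : Fin 1).succ * kernelK E ψA ψB n (0 : Fin 1).succ 0)) -
      invDiff 1 0 (0 : Fin 1).succ ^ 2 := by
  have hlow : ∀ a b m, a ≠ b → m ≤ 1 → lamCoeff m (green E ψA ψB a b) = 0 := fun a b m hab hm => by
    rcases (by omega : m ≤ 0 ∨ m = 1) with h | rfl
    · exact lamCoeff_green_eq_zero hA hB _ _ _ h
    · have h := lamCoeff_green hA hB hP 0 a b
      rwa [Nat.cast_zero, zero_add, laxEntry_zero, if_neg hab] at h
  have hhigh : ∀ (p : ℕ) a b, lamCoeff (p + 2) (green E ψA ψB a b) = laxEntry v w (p + 1) a b :=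
    fun p a b => by
      have h := lamCoeff_green hA hB hP (p + 1) a b
      push_cast at h
      rw [← h]; congr 2
  refine frontCoeff_ext fun m => ?_
  rw [twoPoint_eq_box hE hA hB hP n m (m.toNat + 2) (by omega)]
  rcases le_or_gt m 1 with hm | hm
  · rw [show frontCoeff m (corrSeries (1 : Equiv.Perm (Fin 2)) v w n) = 0 from
      frontCoeff_genSeries_eq_zero m hm _]
    symm
    refine Finset.sum_eq_zero fun s _ => Finset.sum_eq_zero fun j _ => ?_
    rw [hlow _ _ _ (by omega) hm, map_zero, zero_mul]
  · obtain ⟨p, rfl⟩ : ∃ p : ℕ, m = p + 2 := ⟨(m - 2).toNat, by omega⟩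
    rw [show frontCoeff ((p : ℤ) + 2) (corrSeries (1 : Equiv.Perm (Fin 2)) v w n) = genSeries _ from
      frontCoeff_genSeries p _]
    refine frontCoeff_ext fun m => ?_
    have hterm : ∀ s j : ℕ, frontCoeff m (ofTimeMulti (laxEntry v w (p + 1) (n + j) (n - 1 - s)) *
        (atSlot 1 0 (green E ψA ψB (n - 1 - s) (n + j)) : MultiRing K 1)) =
        ofTimeMulti (laxEntry v w (p + 1) (n + j) (n - 1 - s) *
          lamCoeff m (green E ψA ψB (n - 1 - s) (n + j))) := fun s j => by
      rw [← tailMap_ofTimeMulti, frontCoeff_tailMap_mul, frontCoeff_atSlot_zero, map_mul]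
    simp only [hhigh, map_sum, hterm]
    rcases le_or_gt m 1 with hm | hm
    · rw [frontCoeff_genSeries_eq_zero m hm]
      symm
      refine Finset.sum_eq_zero fun s _ => Finset.sum_eq_zero fun j _ => ?_
      rw [hlow _ _ _ (by omega) hm, mul_zero, map_zero]
    · obtain ⟨q, rfl⟩ : ∃ q : ℕ, m = q + 2 := ⟨(m - 2).toNat, by omega⟩
      rw [frontCoeff_genSeries, genSeries_fin_zero]
      have hc : corrPoly (List.ofFn (Fin.cons p (Fin.cons q (default : Fin 0 → ℕ)) : Fin 2 → ℕ)) =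
        canonicalTau.Ω p q := rfl
      rw [hc, evalAt_Ω_eq_box v w p q (((p : ℤ) + 2).toNat + 2) (by omega), map_sum]
      refine Finset.sum_congr rfl fun s _ => ?_
      rw [map_sum]
      refine Finset.sum_congr rfl fun j _ => ?_
      rw [hhigh, show n - ((s : ℤ) + 1) = n - 1 - s by ring]

end TwoPoint

end Toda

namespace Toda

/-! ### Sums over cyclic orders -/

section Cyclic

variable {R : Type*} [CommRing R] {k : ℕ}

/-- The value of `cycleProd D` on a coset. -/
theorem cyclicSum_eq (D : Fin k → Fin k → R) : cyclicSum D =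
    ∑ q : Equiv.Perm (Fin k) ⧸ Subgroup.zpowers (finRotate k), cycleProd D q.out := by
  classical
  rw [cyclicSum]
  refine Fintype.sum_congr _ _ fun q => ?_
  conv_lhs => rw [← Quotient.out_eq' q]
  rfl

theorem cycleProd_eq_of_mk_eq (D : Fin k → Fin k → R) {π π' : Equiv.Perm (Fin k)}
    (h : (π : Equiv.Perm (Fin k) ⧸ Subgroup.zpowers (finRotate k)) = π') :
    cycleProd D π = cycleProd D π' := by
  obtain ⟨m, hm⟩ := Subgroup.mem_zpowers_iff.mp (QuotientGroup.eq.mp h)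
  have : π' = π * finRotate k ^ m := by rw [hm]; group
  rw [this, cycleProd_mul_zpow]

/-- For `k ≥ 2` the rotation has order `k`, so every coset has `k` elements. Over a `ℚ`-algebra this
reduces identities of cyclic sums to sums over all permutations. -/
theorem natCast_mul_cyclicSum (hk : 2 ≤ k) (D : Fin k → Fin k → R) :
    (k : R) * cyclicSum D = ∑ π : Equiv.Perm (Fin k), cycleProd D π := by
  classical
  let H := Subgroup.zpowers (finRotate k)
  let e : Equiv.Perm (Fin k) ≃ (Equiv.Perm (Fin k) ⧸ H) × H := Subgroup.groupEquivQuotientProdSubgroup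
  have he : ∀ π, (e π).1 = (π : Equiv.Perm (Fin k) ⧸ H) := fun π => rfl
  have hcard : Fintype.card H = k := by
    rw [← Nat.card_eq_fintype_card, Nat.card_zpowers, (isCycle_finRotate_of_le hk).orderOf,
      support_finRotate_of_le hk, Finset.card_univ, Fintype.card_fin]
  have h1 : ∀ π, cycleProd D π = cycleProd D (e π).1.out := fun π =>
    cycleProd_eq_of_mk_eq D ((he π).symm.trans (Quotient.out_eq' (e π).1).symm)
  rw [Fintype.sum_congr _ _ h1, Equiv.sum_comp e fun x => cycleProd D x.1.out,
    Fintype.sum_prod_type, cyclicSum_eq]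
  simp only [Finset.sum_const, Finset.card_univ, hcard, nsmul_eq_mul]
  rw [Finset.mul_sum]

theorem cyclicSum_const_mul (c : R) (D : Fin k → Fin k → R) :
    cyclicSum (fun i j => c * D i j) = c ^ k * cyclicSum D := by
  rw [cyclicSum_eq, cyclicSum_eq, Finset.mul_sum]
  refine Finset.sum_congr rfl fun q _ => ?_
  simp [cycleProd, Finset.prod_mul_distrib]

theorem cyclicSum_comp [Algebra ℚ R] (hk : 2 ≤ k) (τ : Equiv.Perm (Fin k)) (D : Fin k → Fin k → R) :
    cyclicSum (fun i j => D (τ i) (τ j)) = cyclicSum D := by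
  refine natCast_mul_cancel (m := k) (by omega) ?_
  rw [natCast_mul_cyclicSum hk, natCast_mul_cyclicSum hk]
  exact Fintype.sum_equiv (Equiv.mulLeft τ) _ _ fun π => rfl

/-- The permutation of `{0, …, k}` fixing `0` and acting by `σ` on the remaining elements. -/
def extendZero (σ : Equiv.Perm (Fin k)) : Equiv.Perm (Fin (k + 1)) :=
  Equiv.Perm.decomposeFin.symm (0, σ)

@[simp] theorem extendZero_zero (σ : Equiv.Perm (Fin k)) : extendZero σ 0 = 0 := by
  simp [extendZero]

@[simp] theorem extendZero_succ (σ : Equiv.Perm (Fin k)) (i : Fin k) :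
    extendZero σ i.succ = (σ i).succ := by
  simp [extendZero, Equiv.Perm.decomposeFin_symm_apply_succ]

theorem cycleProd_mul_addRight (D : Fin (k + 1) → Fin (k + 1) → R) (π : Equiv.Perm (Fin (k + 1)))
    (c : Fin (k + 1)) : cycleProd D (π * Equiv.addRight c) = cycleProd D π := by
  simp only [cycleProd, Equiv.Perm.mul_apply]
  refine Fintype.prod_equiv (Equiv.addRight c) _ _ fun j => ?_
  simp [add_right_comm]

/-- Every permutation is uniquely a rotation followed by a permutation fixing `0`: the rotation by
`c` is determined by the position `-c` of the value `0`. -/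
theorem sum_cycleProd (D : Fin (k + 1) → Fin (k + 1) → R) :
    ∑ π : Equiv.Perm (Fin (k + 1)), cycleProd D π =
      ((k + 1 : ℕ) : R) * ∑ σ : Equiv.Perm (Fin k), cycleProd D (extendZero σ) := by
  let f : Fin (k + 1) × Equiv.Perm (Fin k) → Equiv.Perm (Fin (k + 1)) := fun x =>
    extendZero x.2 * Equiv.addRight x.1
  have hf : Function.Bijective f := by
    rw [Fintype.bijective_iff_injective_and_card]
    refine ⟨?_, by simp [Fintype.card_perm, Nat.factorial_succ]⟩
    rintro ⟨c, σ⟩ ⟨c', σ'⟩ h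
    have h0 := congrArg (fun π : Equiv.Perm (Fin (k + 1)) => π (-c)) h
    simp only [f, Equiv.Perm.mul_apply, Equiv.coe_addRight, neg_add_cancel, extendZero_zero] at h0
    have h1 : -c + c' = 0 := by
      apply (extendZero σ').injective
      rw [← h0, extendZero_zero]
    have h2 : c' = c := by rwa [neg_add_eq_zero, eq_comm] at h1
    subst h2
    have h3 := mul_right_cancel (b := Equiv.addRight c') (show extendZero σ * _ = extendZero σ' * _ from h)
    have h4 : σ = σ' := by
      have := Equiv.Perm.decomposeFin.symm.injective h3
      exact (Prod.mk.inj this).2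
    rw [h4]
  rw [← Function.Bijective.sum_comp hf, Fintype.sum_prod_type]
  simp only [f, cycleProd_mul_addRight, Finset.sum_const, Finset.card_univ, Fintype.card_fin,
    nsmul_eq_mul]

theorem cyclicSum_succ [Algebra ℚ R] (hk : 1 ≤ k) (D : Fin (k + 1) → Fin (k + 1) → R) :
    cyclicSum D = ∑ σ : Equiv.Perm (Fin k), cycleProd D (extendZero σ) := by
  refine natCast_mul_cancel (m := k + 1) (by omega) ?_
  rw [natCast_mul_cyclicSum (by omega), sum_cycleProd]

/-- The product over the cycle obtained from the cycle `π` by inserting `0` after the `j`-th place,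
all other elements being raised by one. -/
def insertProd (D : Fin (k + 1) → Fin (k + 1) → R) (π : Equiv.Perm (Fin k)) (j : Fin k) : R :=
  D (π j).succ 0 * D 0 (π (finRotate k j)).succ *
    ∏ i ∈ Finset.univ.erase j, D (π i).succ (π (finRotate k i)).succ

/-- Inserting `0` after the last place of the cycle `σ` gives the cycle that starts at `0` and then
follows `σ`. -/
theorem insertProd_last (D : Fin (k + 2) → Fin (k + 2) → R) (σ : Equiv.Perm (Fin (k + 1))) :
    insertProd D σ (Fin.last k) = cycleProd D (extendZero σ) := by
  rw [insertProd, cycleProd, Fin.prod_univ_succ, Fin.prod_univ_castSucc]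
  have h1 : ∏ i ∈ Finset.univ.erase (Fin.last k), D (σ i).succ (σ (finRotate (k + 1) i)).succ =
      ∏ i : Fin k, D (σ i.castSucc).succ (σ i.succ).succ := by
    rw [Fin.univ_castSuccEmb, Finset.erase_cons, Finset.prod_map]
    refine Finset.prod_congr rfl fun i _ => ?_
    simp
  rw [h1, finRotate_last]
  have h2 : finRotate (k + 2) 0 = (0 : Fin (k + 1)).succ := by simp
  have h3 : finRotate (k + 2) (Fin.last k).succ = 0 := by
    rw [Fin.succ_last, finRotate_last]
  have h4 : ∀ i : Fin k, finRotate (k + 2) i.castSucc.succ = i.succ.succ := fun i => by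
    rw [finRotate_apply, ← Fin.castSucc_succ, Fin.coeSucc_eq_succ]
  simp only [h2, h3, h4, extendZero_zero, extendZero_succ]
  ring

theorem sum_insertProd (D : Fin (k + 2) → Fin (k + 2) → R) (j : Fin (k + 1)) :
    ∑ π : Equiv.Perm (Fin (k + 1)), insertProd D π j =
      ∑ σ : Equiv.Perm (Fin (k + 1)), cycleProd D (extendZero σ) := by
  -- The rotation that brings the place `j` to the last one; it commutes with `finRotate`.
  let r : Equiv.Perm (Fin (k + 1)) := Equiv.addRight (Fin.last k - j)
  have hr : ∀ i, r (finRotate (k + 1) i) = finRotate (k + 1) (r i) := fun i => by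
    simp [r, add_right_comm]
  have hrj : r j = Fin.last k := by simp [r]
  rw [← Equiv.sum_comp (Equiv.mulRight r)]
  refine Finset.sum_congr rfl fun σ _ => ?_
  rw [← insertProd_last, insertProd, insertProd, Equiv.coe_mulRight]
  simp only [Equiv.Perm.mul_apply, hr, hrj]
  congr 1
  refine Finset.prod_nbij r ?_ r.injective.injOn ?_ fun i _ => rfl
  · intro i hi
    rw [Finset.mem_erase] at hi ⊢
    exact ⟨fun h => hi.1 (r.injective (h.trans hrj.symm)), Finset.mem_univ _⟩
  · intro i hi
    rw [Finset.mem_coe, Finset.mem_erase] at hi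
    refine ⟨r.symm i, ?_, r.apply_symm_apply i⟩
    rw [Finset.mem_coe, Finset.mem_erase]
    exact ⟨fun h => hi.1 (by rw [← hrj, ← h, r.apply_symm_apply]), Finset.mem_univ _⟩

/-- A cyclic order on `k + 1` elements comes from one cyclic order on `k` elements and one gap. The
factor `k` counts the permutations that represent a given cyclic order. -/
theorem sum_sum_insertProd [Algebra ℚ R] (hk : 1 ≤ k) (D : Fin (k + 1) → Fin (k + 1) → R) :
    ∑ π : Equiv.Perm (Fin k), ∑ j, insertProd D π j = (k : R) * cyclicSum D := by
  obtain ⟨k, rfl⟩ := Nat.exists_eq_add_of_le' hk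
  rw [Finset.sum_comm, cyclicSum_succ hk]
  simp only [sum_insertProd, Finset.sum_const, Finset.card_univ, Fintype.card_fin, nsmul_eq_mul]

theorem cyclicSum_two [Algebra ℚ R] (D : Fin 2 → Fin 2 → R) : cyclicSum D = D 0 1 * D 1 0 := by
  rw [cyclicSum_succ le_rfl, Fintype.sum_unique, ← insertProd_last, insertProd]
  simp [mul_comm]

end Cyclic

end Toda

namespace Toda

open DiffOp

/-! ### The `k`-point functions -/

section Main

variable {K : Type*} [CommRing K] {k : ℕ} {v w : ℤ → TimeSeries K} {E : ℤ → (TimeSeries K)ˣ}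
  {ψA ψB : ℤ → WaveRing K}

theorem tailMap_kernelK (n : ℤ) {i j : Fin k} (hij : i ≠ j) :
    tailMap (kernelK E ψA ψB n i j) = kernelK E ψA ψB n i.succ j.succ := by
  simp only [kernelK, kernelD, map_mul, map_sub, tailMap_atSlot, tailMap_ofTimeMulti,
    tailMap_invDiff hij]

theorem apply_ne_apply_finRotate (hk : 2 ≤ k) (π : Equiv.Perm (Fin k)) (j : Fin k) :
    π j ≠ π (finRotate k j) := fun h => by
  have hj : j ∈ (finRotate k).support := by
    rw [support_finRotate_of_le hk]; exact Finset.mem_univ j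
  exact Equiv.Perm.mem_support.mp hj (π.injective h).symm

variable [Algebra ℚ K]

theorem IsNabla.of_natCast_mul {m : ℕ} (hm : m ≠ 0) {f : MultiRing K k}
    {F : MultiRing K (k + 1)} (h : IsNabla ((m : MultiRing K k) * f) (m * F)) : IsNabla f F := by
  have hF : ∀ i, frontCoeff i ((m : MultiRing K (k + 1)) * F) = m * frontCoeff i F := fun i => by
    rw [← nsmul_eq_mul, map_nsmul, nsmul_eq_mul]
  constructor
  · intro i hi
    refine natCast_mul_cancel hm ?_
    rw [← hF, h.low i hi, mul_zero]
  · intro q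
    refine natCast_mul_cancel hm ?_
    rw [← hF, h.high, ← nsmul_eq_mul, map_nsmul, nsmul_eq_mul]

/-- The Leibniz rule: splitting the `j`-th kernel inserts the new parameter after the place `j`.
Consecutive entries are distinct because `k ≥ 2`, so the evolution law of the kernel applies to
every factor. -/
theorem isNabla_cycleProd (hE : IsExpSigma v w E) (hA : IsWaveA v w ψA) (hB : IsWaveB v w E ψB)
    (hP : IsPair E ψA ψB) (hk : 2 ≤ k) (n : ℤ) (π : Equiv.Perm (Fin k)) :
    IsNabla (cycleProd (kernelK E ψA ψB n) π)
      (-(atSlot 1 0 (lamPow (-1)) * ∑ j, insertProd (kernelK E ψA ψB n) π j)) := by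
  classical
  refine (IsNabla.prod Finset.univ fun j _ =>
    isNabla_kernelK hE hA hB hP n (apply_ne_apply_finRotate hk π j)).congr ?_
  rw [Finset.mul_sum, ← Finset.sum_neg_distrib]
  refine Finset.sum_congr rfl fun j _ => ?_
  simp only [tailMap_kernelK n (apply_ne_apply_finRotate hk π _), insertProd]
  ring

theorem isNabla_cyclicSum (hE : IsExpSigma v w E) (hA : IsWaveA v w ψA) (hB : IsWaveB v w E ψB)
    (hP : IsPair E ψA ψB) (hk : 2 ≤ k) (n : ℤ) :
    IsNabla (cyclicSum (kernelK E ψA ψB n) : MultiRing K k)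
      (-(atSlot 1 0 (lamPow (-1)) * cyclicSum (kernelK E ψA ψB n))) := by
  refine IsNabla.of_natCast_mul (m := k) (by omega) ?_
  rw [natCast_mul_cyclicSum hk]
  refine (IsNabla.sum Finset.univ fun π _ => isNabla_cycleProd hE hA hB hP hk n π).congr ?_
  rw [Finset.sum_neg_distrib, ← Finset.mul_sum, sum_sum_insertProd (by omega)]
  ring

/-- The theorem in the region `|λ_0| > |λ_1| > ⋯`. -/
theorem corrSeries_eq (hvw : IsSolution v w) (hE : IsExpSigma v w E) (hA : IsWaveA v w ψA)
    (hB : IsWaveB v w E ψB) (hP : IsPair E ψA ψB) (n : ℤ) (k : ℕ) :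
    corrSeries (1 : Equiv.Perm (Fin (k + 2))) v w n =
      (-1) ^ (k + 1) * (MvPowerSeries.C (∏ j, lamAt 1 j (-1)) *
        cyclicSum (kernelK E ψA ψB n)) - if k = 0 then invDiff 1 0 1 ^ 2 else 0 := by
  induction k with
  | zero =>
    rw [corrSeries_two hE hA hB hP, cyclicSum_two, Fin.prod_univ_two, map_mul, ← atSlot_lamPow,
      ← atSlot_lamPow, if_pos rfl]
    change -(_ * _ * _) - _ = (-1) ^ (0 + 1) * (atSlot 1 0 (lamPow (-1)) *
      atSlot 1 (0 : Fin 1).succ (lamPow (-1)) * (kernelK E ψA ψB n 0 (0 : Fin 1).succ *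
      kernelK E ψA ψB n (0 : Fin 1).succ 0)) - invDiff 1 0 (0 : Fin 1).succ ^ 2
    ring
  | succ k ih =>
    have h1 := isNabla_corrSeries (k := k + 2) hvw (by omega) n
    rw [ih] at h1
    have hsign : IsNabla ((-1 : MultiRing K (k + 2)) ^ (k + 1)) 0 := by
      simpa using IsNabla.C ((-1 : MultiLaurent K (k + 2)) ^ (k + 1))
    -- The double pole does not depend on the times, so it contributes nothing beyond two points.
    have hdelta : IsNabla (if k = 0 then invDiff 1 0 1 ^ 2 else 0 : MultiRing K (k + 2)) 0 := by
      split_ifs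
      · have h := IsNabla.C ((Ring.inverse (lamAt 1 0 1 - lamAt 1 1 1) : MultiLaurent K (k + 2)) ^ 2)
        rwa [map_pow] at h
      · exact IsNabla.zero
    have hprod : tailMap (MvPowerSeries.C (∏ j : Fin (k + 2), lamAt 1 j (-1))) *
        atSlot 1 0 (lamPow (-1)) =
        (MvPowerSeries.C (∏ j : Fin (k + 2 + 1), lamAt 1 j (-1)) : MultiRing K (k + 2 + 1)) := by
      simp only [map_prod, ← atSlot_lamPow, tailMap_atSlot]
      rw [Fin.prod_univ_succ (n := k + 2), mul_comm]
    have h2 := (hsign.mul ((IsNabla.C (∏ j : Fin (k + 2), lamAt 1 j (-1))).mul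
      (isNabla_cyclicSum hE hA hB hP (by omega) n))).sub hdelta
    refine (h1.unique h2).trans ?_
    rw [if_neg (Nat.succ_ne_zero k), sub_zero, sub_zero]
    change _ = (-1) ^ (k + 1 + 1) * (MvPowerSeries.C (∏ j : Fin (k + 2 + 1), lamAt 1 j (-1)) *
      cyclicSum (kernelK E ψA ψB n))
    rw [← hprod, map_pow, map_neg, map_one]
    ring

end Main

/-! ### Passage between the regions of expansion. -/

section Relabel

variable {K : Type*} [CommRing K] {k : ℕ}

theorem lamAt_eq_one (ρ : Equiv.Perm (Fin k)) (j : Fin k) (m : ℤ) :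
    (lamAt ρ j m : MultiLaurent K k) = lamAt 1 (ρ.symm j) m := rfl

theorem invDiff_eq_one (ρ : Equiv.Perm (Fin k)) (i j : Fin k) :
    (invDiff ρ i j : MultiRing K k) = invDiff 1 (ρ.symm i) (ρ.symm j) := rfl

theorem kernelD_eq_one (ρ : Equiv.Perm (Fin k)) (ψA ψB : ℤ → WaveRing K) (n : ℤ) (i j : Fin k) :
    kernelD ρ ψA ψB n i j = kernelD 1 ψA ψB n (ρ.symm i) (ρ.symm j) := rfl

theorem corrPoly_ofFn_comp (ρ : Equiv.Perm (Fin k)) (i : Fin k → ℕ) :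
    corrPoly (List.ofFn (i ∘ ρ)) = corrPoly (List.ofFn i) :=
  corrPoly_perm (Equiv.Perm.ofFn_comp_perm ρ i)

/-- Changing the region permutes the exponents, and the symmetry of the correlators in their indices
compensates for it. -/
theorem corrSeries_eq_one (ρ : Equiv.Perm (Fin k)) (v w : ℤ → TimeSeries K) (n : ℤ) :
    corrSeries ρ v w n = corrSeries 1 v w n := by
  have hexp : ∀ i : Fin k → ℕ, genExp 1 i = genExp ρ (i ∘ ρ.symm) := fun i => by
    simp [genExp]
  ext α s
  have h : ∀ ρ : Equiv.Perm (Fin k), (MvPowerSeries.coeff α (corrSeries ρ v w n)).coeff s =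
      Function.extend (genExp ρ) (fun i => MvPowerSeries.coeff α
        (evalAt v w n (corrPoly (List.ofFn i)))) 0 s := fun _ => rfl
  rw [h, h]
  by_cases hs : ∃ i, genExp 1 i = s
  · obtain ⟨i, rfl⟩ := hs
    rw [(genExp_injective 1).extend_apply, hexp, (genExp_injective ρ).extend_apply,
      corrPoly_ofFn_comp ρ.symm]
  · rw [Function.extend_apply' _ _ _ hs, Function.extend_apply']
    rintro ⟨i, rfl⟩
    exact hs ⟨i ∘ ρ, by rw [hexp]; congr 1; funext j; simp⟩

theorem cyclicSum_kernelK (E : ℤ → (TimeSeries K)ˣ) (ψA ψB : ℤ → WaveRing K) (n : ℤ) :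
    (cyclicSum (kernelK E ψA ψB n) : MultiRing K k) =
      ofTimeMulti ((E (n - 1) : TimeSeries K) ^ k) * cyclicSum (kernelD 1 ψA ψB n) := by
  rw [map_pow, ← cyclicSum_const_mul]
  rfl

/-- Exchanging the two parameters changes only the sign of the inverse difference. -/
theorem invDiff_sq_eq_one (ρ : Equiv.Perm (Fin 2)) :
    (invDiff ρ 0 1 : MultiRing K 2) ^ 2 = invDiff 1 0 1 ^ 2 := by
  have h01 : (0 : Fin 2) ≠ 1 := by decide
  have h := ρ.symm.injective.ne h01
  rw [invDiff_eq_one]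
  generalize ρ.symm 0 = a at *
  generalize ρ.symm 1 = b at *
  fin_cases a <;> fin_cases b
  · exact absurd rfl h
  · rfl
  · have := invDiff_swap (K := K) 1 h01
    change (invDiff 1 1 0 : MultiRing K 2) ^ 2 = _
    rw [this, neg_sq]
  · exact absurd rfl h

end Relabel

end Toda

/-! ### The theorem in an arbitrary region. -/

open Toda
theorem mainTheorem2 {K : Type*} [CommRing K] [Algebra ℚ K]
    (v w : ℤ → TimeSeries K) (hvw : IsSolution v w)
    (E : ℤ → (TimeSeries K)ˣ) (hE : IsExpSigma v w E)
    (ψA ψB : ℤ → WaveRing K) (hA : IsWaveA v w ψA) (hB : IsWaveB v w E ψB)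
    (hpair : IsPair E ψA ψB)
    (k : ℕ) (hk : 2 ≤ k) (n : ℤ) (ρ : Equiv.Perm (Fin k)) :
    corrSeries ρ v w n =
      (-1) ^ (k - 1) * ofTimeMulti ((E (n - 1) : TimeSeries K) ^ k) *
          MvPowerSeries.C (∏ j : Fin k, lamAt ρ j (-1)) *
          cyclicSum (kernelD ρ ψA ψB n) -
        if k = 2 then invDiff ρ ⟨0, by omega⟩ ⟨1, by omega⟩ ^ 2 else 0 := by
  -- The ring of expansions does not depend on `ρ`: the kernel for `ρ` is the kernel for `1` with
  -- its indices relabelled by `ρ.symm`, and the cyclic sum, like the product of the `λ_j^{-1}`,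
  -- does not see the relabelling.
  have hD : cyclicSum (kernelD ρ ψA ψB n) = cyclicSum (kernelD 1 ψA ψB n) := by
    rw [← cyclicSum_comp hk ρ.symm (kernelD 1 ψA ψB n)]
    exact congrArg cyclicSum (funext₂ fun i j => kernelD_eq_one ρ ψA ψB n i j)
  have hl : ∏ j : Fin k, (lamAt ρ j (-1) : MultiLaurent K k) = ∏ j, lamAt 1 j (-1) := by
    rw [← Equiv.prod_comp ρ.symm fun j => (lamAt 1 j (-1) : MultiLaurent K k)]
    exact Finset.prod_congr rfl fun j _ => lamAt_eq_one ρ j (-1)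
  rw [corrSeries_eq_one, hD, hl]
  obtain ⟨k, rfl⟩ := Nat.exists_eq_add_of_le' hk
  rw [corrSeries_eq hvw hE hA hB hpair, cyclicSum_kernelK, show k + 2 - 1 = k + 1 from rfl]
  have hδ : (if k = 0 then invDiff 1 0 1 ^ 2 else 0 : MultiRing K (k + 2)) =
      if k + 2 = 2 then invDiff ρ ⟨0, by omega⟩ ⟨1, by omega⟩ ^ 2 else 0 := by
    rcases k with _ | k
    · rw [if_pos rfl, if_pos rfl]
      exact (invDiff_sq_eq_one ρ).symm
    · rw [if_neg (Nat.succ_ne_zero k), if_neg (by omega)]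
  rw [hδ]
  ring
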